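/- **Setting.** Let $A$ be a $C^*$-algebra; all representations of $A$ on Hilbert spaces are nondegenerate $*$-representations. A $C^*$-correspondence over $A$ is a (right) Hilbert $C^*$-module $E$ over $A$ with an essential left action of $A$ by adjointable operators, given by a $*$-homomorphism; for a representation $\sigma$ of $A$ on $H$, $E\otimes_\sigma H$ is the Hilbert space completion of the algebraic tensor product for $\langle \xi\otimes h,\eta\otimes g\rangle=\langle h,\sigma(\langle\xi,\eta\rangle)g\rangle$. Let $\mathbb E=(\mathbb E(n))_{n\in\mathbb N_0^k}$ be a product system of $C^*$-correspondences over $A$, i.e. $\mathbb E(0)=A$ and there is an associative multiplication inducing isomorphisms $\mathbb E(m)\otimes_A\mathbb E(n)\cong\mathbb E(m+n)$, which for $\mathbb E(0)=A$ are the left and right actions. Put $E_i=\mathbb E(e_i)$ and let $t_{i,j}:E_i\otimes E_j\to E_j\otimes E_i$ be the isomorphism obtained by identifying both sides with $\mathbb E(e_i+e_j)$. A (completely contractive covariant) representation of $\mathbb E$ on $H$ is a tuple $(\sigma,T^{(1)},\dots,T^{(k)})$, where $\sigma$ is a representation of $A$ on $H$ and $T^{(i)}:E_i\to B(H)$ are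 linear completely contractive maps with $T^{(i)}(a\xi b)=\sigma(a)T^{(i)}(\xi)\sigma(b)$ such that the contractions $\widetilde T^{(i)}:E_i\otimes_\sigma H\to H$, $\xi\otimes h\mapsto T^{(i)}(\xi)h$, satisfy $$\widetilde T^{(i)}(I_{E_i}\otimes\widetilde T^{(j)})=\widetilde T^{(j)}(I_{E_j}\otimes\widetilde T^{(i)})(t_{i,j}\otimes I_H)\qquad\text{for all } i,j .$$ It is isometric if $T^{(i)}(\xi)^*T^{(i)}(\eta)=\sigma(\langle\xi,\eta\rangle)$ for all $i$ and $\xi,\eta\in E_i$, and doubly commuting if $$\widetilde T^{(j)*}\widetilde T^{(i)}=(I_{E_j}\otimes\widetilde T^{(i)})(t_{i,j}\otimes I_H)(I_{E_i}\otimes\widetilde T^{(j)*})\qquad\text{for all } i\ne j .$$ For $n\in\mathbb N_0^k$ let $\widetilde T(n):\mathbb E(n)\otimes_\sigma H\to H$ be the contraction which sends $\xi_1\cdots\xi_l\otimes h$ to $T^{(i_1)}(\xi_1)\cdots T^{(i_l)}(\xi_l)h$, where $i_1,\dots,i_l$ is the sequence consisting of $n_1$ times $1$, then $n_2$ times $2$,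 and so on, and $\xi_s\in E_{i_s}$ (and $a\otimes h$ to $\sigma(a)h$ if $n=0$). A minimal isometric (regular) dilation of $(\sigma,T^{(1)},\dots,T^{(k)})$ is an isometric representation $(\sigma',V^{(1)},\dots,V^{(k)})$ of $\mathbb E$ on a Hilbert space $K\supset H$ such that $H$ reduces $\sigma'$ with $\sigma'|_H=\sigma$, $H$ is invariant under every $V^{(i)}(\xi)^*$ ($\xi\in E_i$), $$(I_{\mathbb E(m)}\otimes P_H)\widetilde V(m)^*\widetilde V(n)|_{\mathbb E(n)\otimes_\sigma H}=\widetilde T(m)^*\widetilde T(n)\qquad\text{for all } m,n\in\mathbb N_0^k \text{ with } m\wedge n=0,$$ and no proper closed subspace of $K$ contains $H$ and is invariant under all $V^{(i)}(\xi)$. The representation of $\mathbb E$ induced by a representation $\pi$ of $A$ on a Hilbert space $G$ acts on $\bigoplus_{n\in\mathbb N_0^k}\mathbb E(n)\otimes_\pi G$ by letting $a\in A$ act as the left action of $a$ tensored with $I_G$, and $\xi\in E_i$ as the creation operator $\eta\otimes g\mapsto\xi\eta\otimes g$, $\mathbb E(n)\otimes_\pi G\to\mathbb E(n+e_i)\otimes_\pi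 G$. Two representations are isomorphic if a unitary operator intertwines all the maps in the tuples. **Proposition.** Let $(\sigma,T^{(1)},\dots,T^{(k)})$ be a doubly commuting completely contractive covariant representation of $\mathbb E$ on a Hilbert space $H$, and let $(\sigma',V^{(1)},\dots,V^{(k)})$ be its minimal isometric dilation. Then $(\sigma',V^{(1)},\dots,V^{(k)})$ is isomorphic to an induced representation if and only if $$\lim_{l\to\infty}\|\widetilde T(l e_j)^*h\|=0\qquad\text{for all } h\in H \text{ and } j\in\{1,\dots,k\}.$$ -/

import Mathlib

open scoped TensorProduct

set_option linter.unusedSectionVars false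

universe w

noncomputable section

/-- A `C*`-correspondence over a `C*`-algebra `A`: a Hilbert `C*`-module `E` over `A` (a *right*
`A`-module with an `A`-valued inner product `ip`, linear in the second variable, which induces the
norm of `E`; completeness is the separate assumption `CompleteSpace E`), with a left action of `A`
by adjointable operators which is a `*`-homomorphism and is essential. Mathlib's `CStarModule` is
not used, because there `⟪x, a • y⟫ = a * ⟪x, y⟫`, which describes left Hilbert modules. -/
class CStarCorrespondence (A E : Type*) [NonUnitalCStarAlgebra A] [PartialOrder A]
    [StarOrderedRing A] [NormedAddCommGroup E] [NormedSpace ℂ E] where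
  /-- the `A`-valued inner product `⟨x, y⟩` -/
  ip : E →ₗ⋆[ℂ] E →ₗ[ℂ] A
  star_ip : ∀ x y, star (ip x y) = ip y x
  ip_self_nonneg : ∀ x, 0 ≤ ip x x
  norm_sq : ∀ x, ‖x‖ ^ 2 = ‖ip x x‖
  /-- the right action: `right a x` is `x · a` -/
  right : A →ₗ[ℂ] E →ₗ[ℂ] E
  right_mul : ∀ a b x, right (a * b) x = right b (right a x)
  ip_right : ∀ x y a, ip x (right a y) = ip x y * a
  /-- the left action: `left a x` is `φ(a) x = a · x` -/
  left : A →ₙₐ[ℂ] Module.End ℂ E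
  ip_left : ∀ a x y, ip (left a x) y = ip x (left (star a) y)
  essential : (Submodule.span ℂ {z : E | ∃ a x, left a x = z}).topologicalClosure = ⊤

namespace InteriorTensor

open CStarCorrespondence

variable {A E H : Type*} [NonUnitalCStarAlgebra A] [PartialOrder A] [StarOrderedRing A]
  [NormedAddCommGroup E] [NormedSpace ℂ E] [CStarCorrespondence A E]
  [NormedAddCommGroup H] [InnerProductSpace ℂ H] [CompleteSpace H]

variable (E) in
/-- The sesquilinear form on the algebraic tensor product `E ⊗ H` with
`⟨x ⊗ h, y ⊗ g⟩ = ⟨h, σ(⟨x, y⟩) g⟩`. -/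
def form (σ : A →⋆ₙₐ[ℂ] (H →L[ℂ] H)) : E ⊗[ℂ] H →ₗ⋆[ℂ] E ⊗[ℂ] H →ₗ[ℂ] ℂ :=
  TensorProduct.lift <|
    LinearMap.mk₂'ₛₗ (starRingEnd ℂ) (starRingEnd ℂ)
      (fun (x : E) (h : H) => TensorProduct.lift <|
        LinearMap.mk₂ ℂ (fun (y : E) (g : H) => inner ℂ h (σ (ip x y : A) g))
          (by intros; simp) (by intros; simp) (by intros; simp) (by intros; simp))
      (by intros; ext; simp) (by intros; ext; simp) (by intros; ext; simp)
      (by intros; ext; simp [mul_comm])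

lemma form_tmul (σ : A →⋆ₙₐ[ℂ] (H →L[ℂ] H)) (x y : E) (h g : H) :
    form E σ (x ⊗ₜ h) (y ⊗ₜ g) = inner ℂ h (σ (ip x y : A) g) := rfl

lemma inner_rep (σ : A →⋆ₙₐ[ℂ] (H →L[ℂ] H)) (a : A) (h g : H) :
    inner ℂ (σ a h) g = inner ℂ h (σ (star a) g) := by
  rw [map_star, ContinuousLinearMap.star_eq_adjoint, ContinuousLinearMap.adjoint_inner_right]

/-- The values of the form on sums of elementary tensors with second entries in a cyclic subspace
are non-negative. -/
lemma sum_nonneg_of_mem_cyclic (σ : A →⋆ₙₐ[ℂ] (H →L[ℂ] H)) (u : H) {n : ℕ} (x : Fin n → E)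
    (h : Fin n → H)
    (hh : ∀ i, h i ∈ closure (Set.range fun a : A => σ a u)) :
    0 ≤ (∑ i, ∑ j, inner ℂ (h i) (σ (ip (x i) (x j) : A) (h j))).re := by
  have hmem : h ∈ closure (Set.range fun (a : Fin n → A) (i : Fin n) => σ (a i) u) := by
    have : (Set.range fun (a : Fin n → A) (i : Fin n) => σ (a i) u)
        = Set.pi Set.univ fun _ : Fin n => Set.range fun a : A => σ a u := by
      ext f
      simp only [Set.mem_range, Set.mem_pi, Set.mem_univ, true_imp_iff]
      constructor
      · rintro ⟨a, rfl⟩ i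
        exact ⟨a i, rfl⟩
      · intro hf
        choose a ha using hf
        exact ⟨a, funext ha⟩
    rw [this, closure_pi_set]
    exact fun i _ => hh i
  have hcl : IsClosed {h : Fin n → H |
      0 ≤ (∑ i, ∑ j, inner ℂ (h i) (σ (ip (x i) (x j) : A) (h j))).re} := by
    refine isClosed_le continuous_const (Complex.continuous_re.comp ?_)
    fun_prop
  refine closure_minimal ?_ hcl hmem
  rintro _ ⟨a, rfl⟩
  have key : ∑ i, ∑ j, inner ℂ (σ (a i) u) (σ (ip (x i) (x j) : A) (σ (a j) u))
      = inner ℂ u (σ (ip (∑ i, right (a i) (x i)) (∑ j, right (a j) (x j)) : A) u) := by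
    have hr : ∀ (b : A) (y z : E), (ip (right b y) z : A) = star b * ip y z := by
      intro b y z
      rw [← star_ip, ip_right, star_mul, star_ip]
    simp only [map_sum, LinearMap.sum_apply, sum_apply, inner_sum, hr, ip_right,
      map_mul, mul_apply_eq_comp, inner_rep]
    rw [Finset.sum_comm]
  simp only [Set.mem_ofPred_eq, key]
  obtain ⟨b, hb⟩ := CStarAlgebra.nonneg_iff_eq_star_mul_self.mp
    (ip_self_nonneg (A := A) (∑ i, right (a i) (x i)))
  rw [hb, map_mul, mul_apply_eq_comp, ← inner_rep]
  exact inner_self_nonneg (𝕜 := ℂ)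

lemma sum_nonneg (σ : A →⋆ₙₐ[ℂ] (H →L[ℂ] H)) {n : ℕ} (x : Fin n → E) (h : Fin n → H) :
    0 ≤ (∑ i, ∑ j, inner ℂ (h i) (σ (ip (x i) (x j) : A) (h j))).re := by
  induction n with
  | zero => simp
  | succ n ih =>
    set V : Submodule ℂ H := LinearMap.range (
      (LinearMap.applyₗ (h 0) : (H →ₗ[ℂ] H) →ₗ[ℂ] H) ∘ₗ (ContinuousLinearMap.coeLM ℂ) ∘ₗ
        (σ : A →ₗ[ℂ] (H →L[ℂ] H))) with hV
    have hVmem : ∀ v, v ∈ V ↔ ∃ a, σ a (h 0) = v := fun v => Iff.rfl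
    set W := V.topologicalClosure with hW
    have hinv : ∀ a, ∀ v ∈ W, σ a v ∈ W := by
      intro a v hv
      have : Set.MapsTo (σ a) (V : Set H) V := by
        intro v hv
        obtain ⟨b, rfl⟩ := (hVmem v).1 hv
        exact (hVmem _).2 ⟨a * b, by simp⟩
      exact this.closure (σ a).continuous hv
    have hinv' : ∀ a, ∀ v ∈ Wᗮ, σ a v ∈ Wᗮ := by
      intro a v hv w hw
      have := hv _ (hinv (star a) w hw)
      rwa [inner_rep, star_star] at this
    have h0 : ∀ a, σ a (h 0) ∈ W := fun a => V.le_topologicalClosure ((hVmem _).2 ⟨a, rfl⟩)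
    set p : Fin (n + 1) → H := fun i => W.starProjection (h i) with hp
    set q : Fin (n + 1) → H := fun i => h i - p i with hq
    have hpW : ∀ i, p i ∈ W := fun i => W.starProjection_apply_mem _
    have hqW : ∀ i, q i ∈ Wᗮ := fun i => W.sub_starProjection_mem_orthogonal _
    have hsum : ∀ i, h i = p i + q i := fun i => by simp [hq]
    have hq0 : ∀ a, σ a (q 0) = 0 := by
      intro a
      have h1 : σ a (q 0) ∈ Wᗮ := hinv' a _ (hqW 0)
      have h2 : σ a (q 0) ∈ W := by
        rw [hq, map_sub]
        exact W.sub_mem (h0 a) (hinv a _ (hpW 0))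
      exact Submodule.disjoint_def.1 W.orthogonal_disjoint _ h2 h1
    have hsplit : ∑ i, ∑ j, inner ℂ (h i) (σ (ip (x i) (x j) : A) (h j))
        = ∑ i, ∑ j, inner ℂ (p i) (σ (ip (x i) (x j) : A) (p j))
          + ∑ i, ∑ j, inner ℂ (q i) (σ (ip (x i) (x j) : A) (q j)) := by
      simp only [← Finset.sum_add_distrib]
      refine Finset.sum_congr rfl fun i _ => Finset.sum_congr rfl fun j _ => ?_
      rw [hsum i, hsum j, map_add, inner_add_left, inner_add_right, inner_add_right,
        Submodule.inner_right_of_mem_orthogonal (hpW i) (hinv' _ _ (hqW j)),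
        Submodule.inner_left_of_mem_orthogonal (hinv _ _ (hpW j)) (hqW i)]
      ring
    have hqred : ∑ i, ∑ j, inner ℂ (q i) (σ (ip (x i) (x j) : A) (q j))
        = ∑ i : Fin n, ∑ j : Fin n,
            inner ℂ (q i.succ) (σ (ip (x i.succ) (x j.succ) : A) (q j.succ)) := by
      have hz : ∀ a g, inner ℂ (q 0) (σ a g) = 0 := by
        intro a g
        rw [← star_star a, ← inner_rep, hq0, inner_zero_left]
      simp [Fin.sum_univ_succ, hq0, hz]
    rw [hsplit, hqred, Complex.add_re]
    refine add_nonneg ?_ (ih (fun i => x i.succ) (fun i => q i.succ))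
    exact sum_nonneg_of_mem_cyclic σ (h 0) x p hpW

lemma form_conj_symm (σ : A →⋆ₙₐ[ℂ] (H →L[ℂ] H)) (z w : E ⊗[ℂ] H) :
    (starRingEnd ℂ) (form E σ w z) = form E σ z w := by
  induction z with
  | zero => simp
  | add z₁ z₂ h₁ h₂ => simp [h₁, h₂]
  | tmul x h =>
    induction w with
    | zero => simp
    | add w₁ w₂ h₁ h₂ => simp [h₁, h₂]
    | tmul y g => rw [form_tmul, form_tmul, inner_conj_symm, inner_rep, star_ip]

lemma form_self_nonneg (σ : A →⋆ₙₐ[ℂ] (H →L[ℂ] H)) (z : E ⊗[ℂ] H) :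
    0 ≤ (form E σ z z).re := by
  obtain ⟨n, x, h, rfl⟩ : ∃ (n : ℕ) (x : Fin n → E) (h : Fin n → H),
      z = ∑ i, x i ⊗ₜ[ℂ] h i := by
    obtain ⟨S, hS⟩ := TensorProduct.exists_finset z
    refine ⟨S.card, fun i => (S.equivFin.symm i).1.1, fun i => (S.equivFin.symm i).1.2, ?_⟩
    rw [hS, ← Finset.sum_coe_sort S, ← S.equivFin.symm.sum_comp]
  have := sum_nonneg σ x h
  have e : form E σ (∑ i, x i ⊗ₜ[ℂ] h i) (∑ i, x i ⊗ₜ[ℂ] h i)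
      = ∑ i, ∑ j, inner ℂ (h i) (σ (ip (x i) (x j) : A) (h j)) := by
    rw [map_sum (form E σ), LinearMap.sum_apply]
    exact Finset.sum_congr rfl fun i _ => by rw [map_sum]; rfl
  rwa [e]

/-- The algebraic tensor product `E ⊗ H` with the semi-inner product `form E σ`. -/
def PreSpace (E : Type*) {A H : Type*} [NonUnitalCStarAlgebra A] [NormedAddCommGroup E]
    [NormedSpace ℂ E] [NormedAddCommGroup H] [InnerProductSpace ℂ H] [CompleteSpace H]
    (_σ : A →⋆ₙₐ[ℂ] (H →L[ℂ] H)) : Type _ := E ⊗[ℂ] H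

instance (σ : A →⋆ₙₐ[ℂ] (H →L[ℂ] H)) : AddCommGroup (PreSpace E σ) :=
  inferInstanceAs (AddCommGroup (E ⊗[ℂ] H))

instance (σ : A →⋆ₙₐ[ℂ] (H →L[ℂ] H)) : Module ℂ (PreSpace E σ) :=
  inferInstanceAs (Module ℂ (E ⊗[ℂ] H))

/-- The semi-inner product of `PreSpace E σ`. -/
abbrev core (E : Type*) [NormedAddCommGroup E] [NormedSpace ℂ E] [CStarCorrespondence A E]
    (σ : A →⋆ₙₐ[ℂ] (H →L[ℂ] H)) : PreInnerProductSpace.Core ℂ (PreSpace E σ) where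
  inner z w := form E σ z w
  conj_inner_symm z w := form_conj_symm σ z w
  re_inner_nonneg z := form_self_nonneg σ z
  add_left _ _ _ := LinearMap.map_add₂ _ _ _ _
  smul_left _ _ _ := LinearMap.map_smulₛₗ₂ _ _ _ _

instance (σ : A →⋆ₙₐ[ℂ] (H →L[ℂ] H)) : SeminormedAddCommGroup (PreSpace E σ) :=
  InnerProductSpace.Core.toSeminormedAddCommGroup (c := core E σ)

instance (σ : A →⋆ₙₐ[ℂ] (H →L[ℂ] H)) : InnerProductSpace ℂ (PreSpace E σ) :=
  InnerProductSpace.ofCore (core E σ)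

end InteriorTensor

open InteriorTensor in
/-- The interior tensor product `E ⊗_σ H`, a Hilbert space: the Hausdorff completion of the
algebraic tensor product for the semi-inner product
`⟨x ⊗ h, y ⊗ g⟩ = ⟨h, σ(⟨x, y⟩) g⟩`. -/
def InteriorTensor (E : Type*) {A H : Type*} [NonUnitalCStarAlgebra A] [PartialOrder A]
    [StarOrderedRing A] [NormedAddCommGroup E] [NormedSpace ℂ E] [CStarCorrespondence A E]
    [NormedAddCommGroup H] [InnerProductSpace ℂ H] [CompleteSpace H]
    (σ : A →⋆ₙₐ[ℂ] (H →L[ℂ] H)) : Type _ :=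
  UniformSpace.Completion (PreSpace E σ)

namespace InteriorTensor

variable {A E H : Type*} [NonUnitalCStarAlgebra A] [PartialOrder A] [StarOrderedRing A]
  [NormedAddCommGroup E] [NormedSpace ℂ E] [CStarCorrespondence A E]
  [NormedAddCommGroup H] [InnerProductSpace ℂ H] [CompleteSpace H]
  (σ : A →⋆ₙₐ[ℂ] (H →L[ℂ] H))

instance : NormedAddCommGroup (InteriorTensor E σ) :=
  inferInstanceAs (NormedAddCommGroup (UniformSpace.Completion (PreSpace E σ)))

instance : InnerProductSpace ℂ (InteriorTensor E σ) :=
  inferInstanceAs (InnerProductSpace ℂ (UniformSpace.Completion (PreSpace E σ)))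

instance : CompleteSpace (InteriorTensor E σ) :=
  inferInstanceAs (CompleteSpace (UniformSpace.Completion (PreSpace E σ)))

end InteriorTensor

namespace InteriorTensor

open CStarCorrespondence
open scoped ComplexOrder

variable {A E F H : Type*} [NonUnitalCStarAlgebra A] [PartialOrder A] [StarOrderedRing A]
  [NormedAddCommGroup E] [NormedSpace ℂ E] [CStarCorrespondence A E]
  [NormedAddCommGroup F] [NormedSpace ℂ F] [CStarCorrespondence A F]
  [NormedAddCommGroup H] [InnerProductSpace ℂ H] [CompleteSpace H]

variable (E) in
/-- The canonical map from the algebraic tensor product `E ⊗ H` to `E ⊗_σ H`. -/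
def of (σ : A →⋆ₙₐ[ℂ] (H →L[ℂ] H)) : E ⊗[ℂ] H →ₗ[ℂ] InteriorTensor E σ :=
  (UniformSpace.Completion.toComplₗᵢ (𝕜 := ℂ) (E := PreSpace E σ)).toLinearMap

lemma denseRange_of (σ : A →⋆ₙₐ[ℂ] (H →L[ℂ] H)) : DenseRange (of E σ) :=
  UniformSpace.Completion.denseRange_coe (α := PreSpace E σ)

lemma inner_of (σ : A →⋆ₙₐ[ℂ] (H →L[ℂ] H)) (z w : E ⊗[ℂ] H) :
    inner ℂ (of E σ z) (of E σ w) = form E σ z w :=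
  UniformSpace.Completion.inner_coe (𝕜 := ℂ) (E := PreSpace E σ) z w

lemma norm_sq_of (σ : A →⋆ₙₐ[ℂ] (H →L[ℂ] H)) (z : E ⊗[ℂ] H) :
    ‖of E σ z‖ ^ 2 = (form E σ z z).re := by
  rw [← inner_of]
  exact norm_sq_eq_re_inner (𝕜 := ℂ) _

/-- If `‖Rⁿ x‖` grows at most like `rⁿ` along the orbit of a symmetric map, then `‖R x‖ ≤ r ‖x‖`. -/
lemma norm_le_of_orbit (a : ℕ → ℝ) (ha : ∀ n, 0 ≤ a n)
    (hconv : ∀ n, a (n + 1) ^ 2 ≤ a n * a (n + 2)) (r C : ℝ) (hr : 0 ≤ r)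
    (hC : ∀ n, a n ≤ C * r ^ n) : a 1 ≤ r * a 0 := by
  by_contra! hlt
  rcases (ha 0).eq_or_lt with h0 | h0
  · have := hconv 0
    rw [← h0] at this hlt
    nlinarith [ha 1]
  set q := a 1 / a 0 with hq
  have hrq : r < q := (lt_div_iff₀ h0).2 hlt
  have hstep : ∀ n, 0 < a n ∧ q * a n ≤ a (n + 1) := by
    intro n
    induction n with
    | zero => exact ⟨h0, by rw [hq, div_mul_cancel₀ _ h0.ne']⟩
    | succ n ih =>
      have hpos : 0 < a (n + 1) := lt_of_lt_of_le (mul_pos (hr.trans_lt hrq) ih.1) ih.2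
      refine ⟨hpos, ?_⟩
      have h2 := hconv n
      by_contra! hlt'
      have : a n * a (n + 2) < a n * (q * a (n + 1)) := mul_lt_mul_of_pos_left hlt' ih.1
      nlinarith [mul_le_mul_of_nonneg_right ih.2 hpos.le]
  have hge : ∀ n, a 0 * q ^ n ≤ a n := by
    intro n
    induction n with
    | zero => simp
    | succ n ih =>
      calc a 0 * q ^ (n + 1) = q * (a 0 * q ^ n) := by ring
        _ ≤ q * a n := mul_le_mul_of_nonneg_left ih (hr.trans hrq.le)
        _ ≤ a (n + 1) := (hstep n).2
  rcases hr.eq_or_lt with hr0 | hr0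
  · have h1 := hC 1
    rw [← hr0] at h1
    have := (hstep 1).1
    simp at h1
    linarith
  have hbd : ∀ n : ℕ, (q / r) ^ n ≤ C / a 0 := by
    intro n
    rw [div_pow, div_le_div_iff₀ (pow_pos hr0 n) h0]
    calc q ^ n * a 0 = a 0 * q ^ n := mul_comm _ _
      _ ≤ C * r ^ n := (hge n).trans (hC n)
  obtain ⟨n, hn⟩ := ((tendsto_pow_atTop_atTop_of_one_lt ((one_lt_div hr0).2 hrq)).eventually_gt_atTop
    (C / a 0)).exists
  exact absurd (hbd n) (not_le.2 hn)

variable (E) in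
/-- The left action `a ⊗ I` on the algebraic tensor product. -/
def preLeft (H : Type*) [NormedAddCommGroup H] [InnerProductSpace ℂ H] :
    A →ₗ[ℂ] E ⊗[ℂ] H →ₗ[ℂ] E ⊗[ℂ] H :=
  LinearMap.rTensorHom H ∘ₗ ((left : A →ₙₐ[ℂ] Module.End ℂ E) : A →ₗ[ℂ] Module.End ℂ E)

@[simp] lemma preLeft_tmul (a : A) (x : E) (h : H) :
    preLeft E H a (x ⊗ₜ h) = (left a x) ⊗ₜ h := rfl

lemma preLeft_mul (a b : A) (z : E ⊗[ℂ] H) :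
    preLeft E H (a * b) z = preLeft E H a (preLeft E H b z) := by
  induction z with
  | zero => simp
  | add z₁ z₂ h₁ h₂ => simp [h₁, h₂]
  | tmul x h => simp

lemma form_preLeft (σ : A →⋆ₙₐ[ℂ] (H →L[ℂ] H)) (a : A) (z w : E ⊗[ℂ] H) :
    form E σ (preLeft E H a z) w = form E σ z (preLeft E H (star a) w) := by
  induction z with
  | zero => simp
  | add z₁ z₂ h₁ h₂ => simp [h₁, h₂]
  | tmul x h =>
    induction w with
    | zero => simp
    | add w₁ w₂ h₁ h₂ => simp only [map_add, h₁, h₂]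
    | tmul y g => simp only [preLeft_tmul, form_tmul, ip_left]

lemma norm_form_le (σ : A →⋆ₙₐ[ℂ] (H →L[ℂ] H)) (z w : E ⊗[ℂ] H) :
    ‖form E σ z w‖ ≤ ‖of E σ z‖ * ‖of E σ w‖ := by
  rw [← inner_of]
  exact norm_inner_le_norm _ _

lemma exists_norm_form_preLeft_le (σ : A →⋆ₙₐ[ℂ] (H →L[ℂ] H)) (z : E ⊗[ℂ] H) :
    ∃ M : ℝ, 0 ≤ M ∧ ∀ c : A, ‖form E σ z (preLeft E H c z)‖ ≤ M * ‖c‖ := by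
  let ω : A →ₗ[ℂ] ℂ := (form E σ z) ∘ₗ (preLeft E H).flip z
  have hω : ∀ c : A, 0 ≤ c → 0 ≤ ω c := by
    intro c hc
    obtain ⟨d, rfl⟩ := CStarAlgebra.nonneg_iff_eq_star_mul_self.mp hc
    change 0 ≤ form E σ z (preLeft E H (star d * d) z)
    rw [preLeft_mul, ← form_preLeft, ← inner_of]
    rw [inner_self_eq_norm_sq_to_K]
    rw [← RCLike.ofReal_pow]
    exact Complex.zero_le_real.2 (sq_nonneg _)
  obtain ⟨M, hM⟩ := PositiveLinearMap.exists_norm_apply_le (PositiveLinearMap.mk₀ ω hω)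
  exact ⟨M, M.2, hM⟩

lemma norm_preLeft_le_of_isSelfAdjoint (σ : A →⋆ₙₐ[ℂ] (H →L[ℂ] H)) (b : A)
    (hb : IsSelfAdjoint b) (z : E ⊗[ℂ] H) :
    ‖of E σ (preLeft E H b z)‖ ≤ ‖b‖ * ‖of E σ z‖ := by
  obtain ⟨M, hM0, hM⟩ := exists_norm_form_preLeft_le σ z
  set R := preLeft E H b with hR
  have hsymm : ∀ z w, form E σ (R z) w = form E σ z (R w) := by
    intro z w
    rw [hR, form_preLeft, hb.star_eq]
  have hsymm' : ∀ n z w, form E σ ((R ^ n) z) w = form E σ z ((R ^ n) w) := by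
    intro n
    induction n with
    | zero => simp
    | succ n ih =>
      intro z w
      rw [pow_succ', Module.End.mul_apply, hsymm, ih, ← Module.End.mul_apply, ← pow_succ, pow_succ']
  have hpow : ∀ n : ℕ, ∃ c : A, ‖c‖ ≤ ‖b‖ ^ (n + 1) ∧ R ^ (n + 1) = preLeft E H c := by
    intro n
    induction n with
    | zero => exact ⟨b, by simp, by simp [hR]⟩
    | succ n ih =>
      obtain ⟨c, hc, hRc⟩ := ih
      refine ⟨b * c, ?_, ?_⟩
      · calc ‖b * c‖ ≤ ‖b‖ * ‖c‖ := norm_mul_le _ _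
          _ ≤ ‖b‖ * ‖b‖ ^ (n + 1) := mul_le_mul_of_nonneg_left hc (norm_nonneg _)
          _ = ‖b‖ ^ (n + 1 + 1) := by ring
      · rw [pow_succ', hRc]
        exact LinearMap.ext fun w => (preLeft_mul b c w).symm
  have := norm_le_of_orbit (fun n => ‖of E σ ((R ^ n) z)‖) (fun n => norm_nonneg _) ?_ ‖b‖
    (√(M + ‖of E σ z‖ ^ 2)) (norm_nonneg _) ?_
  · simpa using this
  · intro n
    have h1 : ‖of E σ ((R ^ (n + 1)) z)‖ ^ 2 = (form E σ ((R ^ n) z) ((R ^ (n + 2)) z)).re := by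
      rw [norm_sq_of]
      congr 1
      rw [pow_succ', Module.End.mul_apply, hsymm, ← Module.End.mul_apply, ← Module.End.mul_apply,
        mul_assoc, ← pow_succ', ← pow_succ']
    rw [h1]
    exact (Complex.re_le_norm _).trans (norm_form_le σ _ _)
  · intro n
    refine le_of_sq_le_sq ?_ (by positivity)
    rw [mul_pow, Real.sq_sqrt (by positivity)]
    rcases n with _ | n
    · simp [hM0]
    · have h1 : ‖of E σ ((R ^ (n + 1)) z)‖ ^ 2 = (form E σ z ((R ^ (2 * n + 1 + 1)) z)).re := by
        rw [norm_sq_of, hsymm', ← Module.End.mul_apply, ← pow_add]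
        rw [show n + 1 + (n + 1) = 2 * n + 1 + 1 by ring]
      obtain ⟨c, hc, hRc⟩ := hpow (2 * n + 1)
      rw [h1, hRc]
      calc (form E σ z (preLeft E H c z)).re ≤ ‖form E σ z (preLeft E H c z)‖ :=
            Complex.re_le_norm _
        _ ≤ M * ‖c‖ := hM c
        _ ≤ M * ‖b‖ ^ (2 * n + 1 + 1) := mul_le_mul_of_nonneg_left hc hM0
        _ = M * (‖b‖ ^ (n + 1)) ^ 2 := by ring
        _ ≤ (M + ‖of E σ z‖ ^ 2) * (‖b‖ ^ (n + 1)) ^ 2 := by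
            have := sq_nonneg (‖of E σ z‖)
            gcongr
            linarith

/-- `S ⊗ I` is bounded when `S* S` is the left action of some element of `A`. -/
lemma norm_rTensor_le (σ : A →⋆ₙₐ[ℂ] (H →L[ℂ] H)) (S : E →ₗ[ℂ] F) (b : A)
    (hS : ∀ x y, (ip (S x) (S y) : A) = ip x (left b y)) (hb : IsSelfAdjoint b) (z : E ⊗[ℂ] H) :
    ‖of F σ (S.rTensor H z)‖ ≤ √‖b‖ * ‖of E σ z‖ := by
  have h1 : ∀ z w : E ⊗[ℂ] H,
      form F σ (S.rTensor H z) (S.rTensor H w) = form E σ z (preLeft E H b w) := by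
    intro z w
    induction z with
    | zero => simp
    | add z₁ z₂ h₁ h₂ => simp [h₁, h₂]
    | tmul x h =>
      induction w with
      | zero => simp
      | add w₁ w₂ h₁ h₂ => simp only [map_add, h₁, h₂]
      | tmul y g => simp only [preLeft_tmul, form_tmul, LinearMap.rTensor_tmul, hS]
  refine le_of_sq_le_sq ?_ (by positivity)
  rw [norm_sq_of, h1, mul_pow, Real.sq_sqrt (norm_nonneg _)]
  calc _ ≤ ‖form E σ z (preLeft E H b z)‖ := Complex.re_le_norm _
    _ ≤ ‖of E σ z‖ * ‖of E σ (preLeft E H b z)‖ := norm_form_le σ _ _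
    _ ≤ ‖of E σ z‖ * (‖b‖ * ‖of E σ z‖) :=
        mul_le_mul_of_nonneg_left (norm_preLeft_le_of_isSelfAdjoint σ b hb z) (norm_nonneg _)
    _ = _ := by ring

/-- The operator `S ⊗ I : E ⊗_σ H → F ⊗_σ H`, the continuous extension of `x ⊗ h ↦ S x ⊗ h`
(see `map_of` for the maps `S` to which it is applied). -/
def map (σ : A →⋆ₙₐ[ℂ] (H →L[ℂ] H)) (S : E →ₗ[ℂ] F) :
    InteriorTensor E σ →L[ℂ] InteriorTensor F σ :=
  (of F σ ∘ₗ S.rTensor H).extendOfNorm (of E σ)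

lemma map_of (σ : A →⋆ₙₐ[ℂ] (H →L[ℂ] H)) (S : E →ₗ[ℂ] F) (b : A)
    (hS : ∀ x y, (ip (S x) (S y) : A) = ip x (left b y)) (hb : IsSelfAdjoint b) (z : E ⊗[ℂ] H) :
    map σ S (of E σ z) = of F σ (S.rTensor H z) :=
  LinearMap.extendOfNorm_eq (denseRange_of σ) ⟨_, norm_rTensor_le σ S b hS hb⟩ z

lemma norm_map_le (σ : A →⋆ₙₐ[ℂ] (H →L[ℂ] H)) (S : E →ₗ[ℂ] F) (b : A)
    (hS : ∀ x y, (ip (S x) (S y) : A) = ip x (left b y)) (hb : IsSelfAdjoint b)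
    (z : InteriorTensor E σ) : ‖map σ S z‖ ≤ √‖b‖ * ‖z‖ :=
  LinearMap.norm_extendOfNorm_apply_le (denseRange_of σ) _ (norm_rTensor_le σ S b hS hb) z

lemma map_left_of (σ : A →⋆ₙₐ[ℂ] (H →L[ℂ] H)) (a : A) (z : E ⊗[ℂ] H) :
    map σ (left a : Module.End ℂ E) (of E σ z) = of E σ (preLeft E H a z) :=
  map_of σ (left a : Module.End ℂ E) (star a * a)
    (fun x y => by rw [ip_left, map_mul, Module.End.mul_apply]) (.star_mul_self a) z

variable (E) in
/-- The representation `a ↦ φ(a) ⊗ I` of `A` on `E ⊗_σ H`. -/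
def leftRep (σ : A →⋆ₙₐ[ℂ] (H →L[ℂ] H)) :
    A →⋆ₙₐ[ℂ] (InteriorTensor E σ →L[ℂ] InteriorTensor E σ) :=
  have ext' : ∀ {f g : InteriorTensor E σ →L[ℂ] InteriorTensor E σ},
      (∀ z, f (of E σ z) = g (of E σ z)) → f = g := fun {f g} h =>
    DFunLike.coe_injective
      ((denseRange_of σ).equalizer f.continuous g.continuous (funext fun z => h z))
  { toFun := fun a => map σ (left a : Module.End ℂ E)
    map_smul' := fun c a => ext' fun z => by
      have := map_left_of σ (c • a) z
      rw [this, map_smul, LinearMap.smul_apply, map_smul, ← map_left_of]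
      rfl
    map_zero' := ext' fun z => by
      rw [map_left_of, map_zero, LinearMap.zero_apply, map_zero]
      rfl
    map_add' := fun a b => ext' fun z => by
      rw [map_left_of, map_add, LinearMap.add_apply, map_add, ← map_left_of, ← map_left_of]
      rfl
    map_mul' := fun a b => ext' fun z => by
      rw [map_left_of, preLeft_mul, ← map_left_of, ← map_left_of]
      rfl
    map_star' := fun a => by
      rw [ContinuousLinearMap.star_eq_adjoint, ContinuousLinearMap.eq_adjoint_iff]
      intro u v
      have hcl : ∀ u : InteriorTensor E σ, IsClosed {v : InteriorTensor E σ |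
          inner ℂ (map σ (left (star a) : Module.End ℂ E) u) v
            = inner ℂ u (map σ (left a : Module.End ℂ E) v)} := fun u =>
        isClosed_eq (by fun_prop) (by fun_prop)
      have hcl' : ∀ v : InteriorTensor E σ, IsClosed {u : InteriorTensor E σ |
          inner ℂ (map σ (left (star a) : Module.End ℂ E) u) v
            = inner ℂ u (map σ (left a : Module.End ℂ E) v)} := fun v =>
        isClosed_eq (by fun_prop) (by fun_prop)
      refine (denseRange_of σ).induction_on (p := fun u => inner ℂ (map σ (left (star a) : Module.End ℂ E) u) v
            = inner ℂ u (map σ (left a : Module.End ℂ E) v)) u (hcl' v) fun z => ?_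
      refine (denseRange_of σ).induction_on (p := fun v => inner ℂ (map σ (left (star a) : Module.End ℂ E) (of E σ z)) v
            = inner ℂ (of E σ z) (map σ (left a : Module.End ℂ E) v)) v (hcl _) fun w => ?_
      rw [map_left_of, map_left_of, inner_of, inner_of, form_preLeft, star_star] }

lemma leftRep_of (σ : A →⋆ₙₐ[ℂ] (H →L[ℂ] H)) (a : A) (z : E ⊗[ℂ] H) :
    leftRep E σ a (of E σ z) = of E σ (preLeft E H a z) := map_left_of σ a z

variable {K : Type*} [NormedAddCommGroup K] [InnerProductSpace ℂ K] [CompleteSpace K]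

variable (E) in
/-- `I_E ⊗ L : E ⊗_σ H → E ⊗_ρ K` for a bounded operator `L : H → K` intertwining the
representations `σ` and `ρ`: the continuous extension of `x ⊗ h ↦ x ⊗ L h` (see `idTensor_of`). -/
def idTensor (σ : A →⋆ₙₐ[ℂ] (H →L[ℂ] H)) (ρ : A →⋆ₙₐ[ℂ] (K →L[ℂ] K)) (L : H →L[ℂ] K) :
    InteriorTensor E σ →L[ℂ] InteriorTensor E ρ :=
  (of E ρ ∘ₗ (L : H →ₗ[ℂ] K).lTensor E).extendOfNorm (of E σ)

lemma norm_of_tmul_le (σ : A →⋆ₙₐ[ℂ] (H →L[ℂ] H)) (x : E) (h : H) :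
    ‖of E σ (x ⊗ₜ h)‖ ≤ ‖x‖ * ‖h‖ := by
  refine le_of_sq_le_sq ?_ (by positivity)
  rw [norm_sq_of, form_tmul, mul_pow, norm_sq (A := A) x]
  calc _ ≤ ‖inner ℂ h (σ (ip x x : A) h)‖ := Complex.re_le_norm _
    _ ≤ ‖h‖ * ‖σ (ip x x : A) h‖ := norm_inner_le_norm _ _
    _ ≤ ‖h‖ * (‖(ip x x : A)‖ * ‖h‖) := by
        gcongr
        exact (ContinuousLinearMap.le_opNorm _ _).trans
          (mul_le_mul_of_nonneg_right (NonUnitalStarAlgHom.norm_apply_le σ _) (norm_nonneg _))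
    _ = _ := by ring

lemma norm_lTensor_le (σ : A →⋆ₙₐ[ℂ] (H →L[ℂ] H)) (ρ : A →⋆ₙₐ[ℂ] (K →L[ℂ] K)) (L : H →L[ℂ] K)
    (hL : ∀ a h, L (σ a h) = ρ a (L h)) (z : E ⊗[ℂ] H) :
    ‖of E ρ ((L : H →ₗ[ℂ] K).lTensor E z)‖ ≤ ‖L‖ * ‖of E σ z‖ := by
  set B : H →L[ℂ] H := L.adjoint ∘L L with hB
  set R : E ⊗[ℂ] H →ₗ[ℂ] E ⊗[ℂ] H := (B : H →ₗ[ℂ] H).lTensor E with hR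
  have h1 : ∀ z w : E ⊗[ℂ] H, form E ρ ((L : H →ₗ[ℂ] K).lTensor E z)
      ((L : H →ₗ[ℂ] K).lTensor E w) = form E σ z (R w) := by
    intro z w
    induction z with
    | zero => simp
    | add z₁ z₂ h₁ h₂ => simp [h₁, h₂]
    | tmul x h =>
      induction w with
      | zero => simp
      | add w₁ w₂ h₁ h₂ => simp only [map_add, h₁, h₂]
      | tmul y g =>
        have hs : ∀ (a : A) g', inner ℂ (σ a h) (L.adjoint g') = inner ℂ h (L.adjoint (ρ (star a) g')) := by
          intro a g'
          rw [ContinuousLinearMap.adjoint_inner_right, hL, inner_rep,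
            ContinuousLinearMap.adjoint_inner_right]
        simp only [hR, LinearMap.lTensor_tmul, form_tmul, ContinuousLinearMap.coe_coe, hB,
          ContinuousLinearMap.comp_apply]
        rw [← star_star (ip x y : A), ← inner_rep σ, hs, star_star,
          ContinuousLinearMap.adjoint_inner_right]
  have hsymm : ∀ z w, form E σ (R z) w = form E σ z (R w) := by
    intro z w
    rw [← form_conj_symm, ← h1, form_conj_symm, h1]
  have hBn : ‖B‖ ≤ ‖L‖ ^ 2 := by
    calc ‖B‖ ≤ ‖L.adjoint‖ * ‖L‖ := ContinuousLinearMap.opNorm_comp_le _ _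
      _ = ‖L‖ ^ 2 := by rw [LinearIsometryEquiv.norm_map, sq]
  have hgrow : ∀ w : E ⊗[ℂ] H, ∃ C : ℝ, ∀ n : ℕ, ‖of E σ ((R ^ n) w)‖ ≤ C * (‖L‖ ^ 2) ^ n := by
    intro w
    induction w with
    | zero => exact ⟨0, by simp⟩
    | add w₁ w₂ h₁ h₂ =>
      obtain ⟨C₁, h₁⟩ := h₁
      obtain ⟨C₂, h₂⟩ := h₂
      refine ⟨C₁ + C₂, fun n => ?_⟩
      rw [map_add, map_add, add_mul]
      exact (norm_add_le _ _).trans (add_le_add (h₁ n) (h₂ n))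
    | tmul x h =>
      refine ⟨‖x‖ * ‖h‖, fun n => ?_⟩
      have : ∃ g : H, (R ^ n) (x ⊗ₜ h) = x ⊗ₜ g ∧ ‖g‖ ≤ (‖L‖ ^ 2) ^ n * ‖h‖ := by
        induction n with
        | zero => exact ⟨h, by simp⟩
        | succ n ih =>
          obtain ⟨g, hg, hgn⟩ := ih
          refine ⟨B g, ?_, ?_⟩
          · rw [pow_succ', Module.End.mul_apply, hg]
            rfl
          · calc ‖B g‖ ≤ ‖B‖ * ‖g‖ := B.le_opNorm g
              _ ≤ ‖L‖ ^ 2 * ((‖L‖ ^ 2) ^ n * ‖h‖) := by gcongr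
              _ = _ := by ring
      obtain ⟨g, hg, hgn⟩ := this
      rw [hg]
      calc _ ≤ ‖x‖ * ‖g‖ := norm_of_tmul_le σ x g
        _ ≤ ‖x‖ * ((‖L‖ ^ 2) ^ n * ‖h‖) := by gcongr
        _ = _ := by ring
  obtain ⟨C, hC⟩ := hgrow z
  have hRz : ‖of E σ (R z)‖ ≤ ‖L‖ ^ 2 * ‖of E σ z‖ := by
    have := norm_le_of_orbit (fun n => ‖of E σ ((R ^ n) z)‖) (fun n => norm_nonneg _) ?_ (‖L‖ ^ 2)
      C (by positivity) hC
    · simpa using this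
    · intro n
      have h1 : ‖of E σ ((R ^ (n + 1)) z)‖ ^ 2 = (form E σ ((R ^ n) z) ((R ^ (n + 2)) z)).re := by
        rw [norm_sq_of]
        congr 1
        rw [pow_succ', Module.End.mul_apply, hsymm, ← Module.End.mul_apply, ← Module.End.mul_apply,
          mul_assoc, ← pow_succ', ← pow_succ']
      rw [h1]
      exact (Complex.re_le_norm _).trans (norm_form_le σ _ _)
  refine le_of_sq_le_sq ?_ (by positivity)
  rw [norm_sq_of, h1]
  calc _ ≤ ‖form E σ z (R z)‖ := Complex.re_le_norm _
    _ ≤ ‖of E σ z‖ * ‖of E σ (R z)‖ := norm_form_le σ _ _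
    _ ≤ ‖of E σ z‖ * (‖L‖ ^ 2 * ‖of E σ z‖) := by gcongr
    _ = _ := by ring

lemma idTensor_of (σ : A →⋆ₙₐ[ℂ] (H →L[ℂ] H)) (ρ : A →⋆ₙₐ[ℂ] (K →L[ℂ] K)) (L : H →L[ℂ] K)
    (hL : ∀ a h, L (σ a h) = ρ a (L h)) (z : E ⊗[ℂ] H) :
    idTensor E σ ρ L (of E σ z) = of E ρ ((L : H →ₗ[ℂ] K).lTensor E z) :=
  LinearMap.extendOfNorm_eq (denseRange_of σ) ⟨_, norm_lTensor_le σ ρ L hL⟩ z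

end InteriorTensor

/-- A product system of `C*`-correspondences over `ℕ^k`: correspondences `E(n)` for `n ∈ ℕ^k`, with
`E(0) = A` (via `unit`) and an associative bilinear multiplication `E(m) × E(n) → E(m + n)` which
induces an isomorphism of the interior tensor product `E(m) ⊗_A E(n)` onto `E(m + n)` (that is, it
carries `⟨y, ⟨x, x'⟩ y'⟩` to the inner product of the products, and its range is total), and which
for `E(0)` is the left, respectively right, action of `A`. To avoid casts, the multiplication has
its target index as an argument. -/
structure ProductSystem (A : Type*) [NonUnitalCStarAlgebra A] [PartialOrder A]
    [StarOrderedRing A] (k : ℕ) where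
  /-- the correspondence `E(n)` -/
  fiber : (Fin k → ℕ) → Type*
  [normedAddCommGroup : ∀ n, NormedAddCommGroup (fiber n)]
  [normedSpace : ∀ n, NormedSpace ℂ (fiber n)]
  [completeSpace : ∀ n, CompleteSpace (fiber n)]
  [correspondence : ∀ n, CStarCorrespondence A (fiber n)]
  mul : ∀ {m n p : Fin k → ℕ}, m + n = p → fiber m →ₗ[ℂ] fiber n →ₗ[ℂ] fiber p
  mul_assoc : ∀ {l m n lm mn p : Fin k → ℕ} (h₁ : l + m = lm) (h₂ : lm + n = p) (h₃ : m + n = mn)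
    (h₄ : l + mn = p) (x : fiber l) (y : fiber m) (z : fiber n),
    mul h₂ (mul h₁ x y) z = mul h₄ x (mul h₃ y z)
  ip_mul : ∀ {m n p : Fin k → ℕ} (h : m + n = p) (x x' : fiber m) (y y' : fiber n),
    (CStarCorrespondence.ip (mul h x y) (mul h x' y') : A)
      = CStarCorrespondence.ip y (CStarCorrespondence.left (CStarCorrespondence.ip x x' : A) y')
  mul_total : ∀ {m n p : Fin k → ℕ} (h : m + n = p),
    (Submodule.span ℂ {z : fiber p | ∃ x y, mul h x y = z}).topologicalClosure = ⊤
  /-- the identification of `A` with `E(0)` -/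
  unit : A ≃ₗ[ℂ] fiber 0
  ip_unit : ∀ a b : A, (CStarCorrespondence.ip (unit a) (unit b) : A) = star a * b
  unit_mul : ∀ {n : Fin k → ℕ} (a : A) (x : fiber n),
    mul (zero_add n) (unit a) x = CStarCorrespondence.left a x
  mul_unit : ∀ {n : Fin k → ℕ} (a : A) (x : fiber n),
    mul (add_zero n) x (unit a) = CStarCorrespondence.right a x

namespace ProductSystem

attribute [instance] normedAddCommGroup normedSpace completeSpace correspondence

open CStarCorrespondence

variable {A : Type*} [NonUnitalCStarAlgebra A] [PartialOrder A] [StarOrderedRing A] {k : ℕ}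
  {H K : Type*} [NormedAddCommGroup H] [InnerProductSpace ℂ H] [CompleteSpace H]
  [NormedAddCommGroup K] [InnerProductSpace ℂ K] [CompleteSpace K]

/-- The basis element `e_i` of `ℕ^k`. -/
abbrev e (i : Fin k) : Fin k → ℕ := Pi.single i 1

variable (P : ProductSystem A k)

section creation

variable (σ : A →⋆ₙₐ[ℂ] (H →L[ℂ] H)) {m n p : Fin k → ℕ} (h : m + n = p)

lemma ip_mul_self (x : P.fiber m) (y y' : P.fiber n) :
    (ip (P.mul h x y) (P.mul h x y') : A) = ip y (left (ip x x : A) y') := P.ip_mul h x x y y'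

/-- The operator `T_x ⊗ I : E(n) ⊗_σ H → E(m + n) ⊗_σ H`, `y ⊗ h ↦ x y ⊗ h`, for `x ∈ E(m)`. -/
def create : P.fiber m →ₗ[ℂ]
    (InteriorTensor (P.fiber n) σ →L[ℂ] InteriorTensor (P.fiber p) σ) :=
  have ext' : ∀ {f g : InteriorTensor (P.fiber n) σ →L[ℂ] InteriorTensor (P.fiber p) σ},
      (∀ z, f (InteriorTensor.of _ σ z) = g (InteriorTensor.of _ σ z)) → f = g := fun {f g} h =>
    DFunLike.coe_injective
      ((InteriorTensor.denseRange_of σ).equalizer f.continuous g.continuous (funext fun z => h z))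
  have map_of' : ∀ x z, InteriorTensor.map σ (P.mul h x) (InteriorTensor.of _ σ z)
      = InteriorTensor.of _ σ ((P.mul h x).rTensor H z) := fun x z =>
    InteriorTensor.map_of σ _ (ip x x : A) (P.ip_mul_self h x) (star_ip x x) z
  { toFun := fun x => InteriorTensor.map σ (P.mul h x)
    map_add' := fun x x' => ext' fun z => by
      rw [map_of', map_add, LinearMap.rTensor_add, LinearMap.add_apply, map_add, ← map_of',
        ← map_of']
      rfl
    map_smul' := fun c x => ext' fun z => by
      rw [map_of', map_smul, LinearMap.rTensor_smul, LinearMap.smul_apply, map_smul, ← map_of']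
      rfl }

lemma create_of (x : P.fiber m) (z : P.fiber n ⊗[ℂ] H) :
    P.create σ h x (InteriorTensor.of _ σ z)
      = InteriorTensor.of _ σ ((P.mul h x).rTensor H z) :=
  InteriorTensor.map_of σ _ (ip x x : A) (P.ip_mul_self h x) (star_ip x x) z

lemma norm_create_le (x : P.fiber m) (z : InteriorTensor (P.fiber n) σ) :
    ‖P.create σ h x z‖ ≤ √‖(ip x x : A)‖ * ‖z‖ :=
  InteriorTensor.norm_map_le σ _ (ip x x : A) (P.ip_mul_self h x) (star_ip x x) z

/-- The map `E(m) ⊗ (E(n) ⊗_σ H) → E(m + n) ⊗_σ H`, `x ⊗ z ↦ (T_x ⊗ I) z`, on the algebraic tensor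
product. -/
def preAssoc : P.fiber m ⊗[ℂ] InteriorTensor (P.fiber n) σ →ₗ[ℂ] InteriorTensor (P.fiber p) σ :=
  TensorProduct.lift (ContinuousLinearMap.coeLM ℂ ∘ₗ P.create σ h)

lemma inner_create (x x' : P.fiber m) (z z' : InteriorTensor (P.fiber n) σ) :
    inner ℂ (P.create σ h x z) (P.create σ h x' z')
      = inner ℂ z (InteriorTensor.leftRep (P.fiber n) σ (ip x x' : A) z') := by
  refine (InteriorTensor.denseRange_of σ).induction_on
    (p := fun z => inner ℂ (P.create σ h x z) (P.create σ h x' z')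
      = inner ℂ z (InteriorTensor.leftRep (P.fiber n) σ (ip x x' : A) z')) z
    (isClosed_eq (by fun_prop) (by fun_prop)) fun z => ?_
  refine (InteriorTensor.denseRange_of σ).induction_on
    (p := fun z' => inner ℂ (P.create σ h x (InteriorTensor.of _ σ z)) (P.create σ h x' z')
      = inner ℂ (InteriorTensor.of _ σ z)
          (InteriorTensor.leftRep (P.fiber n) σ (ip x x' : A) z')) z'
    (isClosed_eq (by fun_prop) (by fun_prop)) fun w => ?_
  rw [create_of, create_of, InteriorTensor.leftRep_of, InteriorTensor.inner_of,
    InteriorTensor.inner_of]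
  induction z with
  | zero => simp
  | add z₁ z₂ h₁ h₂ => simp [h₁, h₂]
  | tmul y g =>
    induction w with
    | zero => simp
    | add w₁ w₂ h₁ h₂ => simp only [map_add, h₁, h₂]
    | tmul y' g' =>
      simp only [InteriorTensor.preLeft_tmul, InteriorTensor.form_tmul, LinearMap.rTensor_tmul,
        P.ip_mul]

lemma norm_preAssoc (z : P.fiber m ⊗[ℂ] InteriorTensor (P.fiber n) σ) :
    ‖P.preAssoc σ h z‖
      = ‖InteriorTensor.of (P.fiber m) (InteriorTensor.leftRep (P.fiber n) σ) z‖ := by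
  have key : ∀ z w : P.fiber m ⊗[ℂ] InteriorTensor (P.fiber n) σ,
      inner ℂ (P.preAssoc σ h z) (P.preAssoc σ h w)
        = InteriorTensor.form (P.fiber m) (InteriorTensor.leftRep (P.fiber n) σ) z w := by
    intro z w
    induction z with
    | zero => simp
    | add z₁ z₂ h₁ h₂ => simp [h₁, h₂]
    | tmul x g =>
      induction w with
      | zero => simp
      | add w₁ w₂ h₁ h₂ => simp only [map_add, inner_add_right, h₁, h₂]
      | tmul x' g' => exact P.inner_create σ h x x' g g'
  have : ‖P.preAssoc σ h z‖ ^ 2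
      = ‖InteriorTensor.of (P.fiber m) (InteriorTensor.leftRep (P.fiber n) σ) z‖ ^ 2 := by
    rw [InteriorTensor.norm_sq_of, ← key]
    exact norm_sq_eq_re_inner (𝕜 := ℂ) _
  exact (sq_eq_sq₀ (norm_nonneg _) (norm_nonneg _)).1 this

/-- The unitary `E(m) ⊗ (E(n) ⊗_σ H) → E(m + n) ⊗_σ H`, `x ⊗ y ⊗ h ↦ x y ⊗ h`, by which these
spaces are identified. -/
def assoc : InteriorTensor (P.fiber m) (InteriorTensor.leftRep (P.fiber n) σ) →L[ℂ]
    InteriorTensor (P.fiber p) σ :=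
  (P.preAssoc σ h).extendOfNorm
    (InteriorTensor.of (P.fiber m) (InteriorTensor.leftRep (P.fiber n) σ))

lemma assoc_of (z : P.fiber m ⊗[ℂ] InteriorTensor (P.fiber n) σ) :
    P.assoc σ h (InteriorTensor.of _ _ z) = P.preAssoc σ h z :=
  LinearMap.extendOfNorm_eq (InteriorTensor.denseRange_of _)
    ⟨1, fun z => by rw [norm_preAssoc, one_mul]⟩ z

end creation

/-- The unitary `t_{i,j} ⊗ I : E_i ⊗ (E_j ⊗_σ H) → E_j ⊗ (E_i ⊗_σ H)`, where `E_i = E(e_i)` and the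
isomorphism `t_{i,j} : E_i ⊗ E_j → E_j ⊗ E_i` is given by the identification of both sides with
`E(e_i + e_j)`. -/
def flip (σ : A →⋆ₙₐ[ℂ] (H →L[ℂ] H)) (i j : Fin k) :
    InteriorTensor (P.fiber (e i)) (InteriorTensor.leftRep (P.fiber (e j)) σ) →L[ℂ]
      InteriorTensor (P.fiber (e j)) (InteriorTensor.leftRep (P.fiber (e i)) σ) :=
  (P.assoc σ (add_comm (e j) (e i))).adjoint ∘L P.assoc σ rfl

/-- A tuple `(σ, T⁽¹⁾, …, T⁽ᵏ⁾)` of a `*`-homomorphism `σ : A → B(H)` and linear maps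
`T⁽ⁱ⁾ : E_i → B(H)`, where `E_i = E(e_i)`. -/
structure Tuple (H : Type*) [NormedAddCommGroup H] [InnerProductSpace ℂ H] [CompleteSpace H] where
  σ : A →⋆ₙₐ[ℂ] (H →L[ℂ] H)
  T : ∀ i : Fin k, P.fiber (e i) →ₗ[ℂ] (H →L[ℂ] H)

/-- Non-degeneracy of a representation of `A`. -/
def Nondegenerate (σ : A →⋆ₙₐ[ℂ] (H →L[ℂ] H)) : Prop :=
  (Submodule.span ℂ {h : H | ∃ a g, σ a g = h}).topologicalClosure = ⊤

/-- Complete contractivity of a linear map `T : E → B(H)`: for all `N` and all `N × N`-matrices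
`(x_ij)` over `E`, the operator `(T(x_ij))` on `H^N` has norm at most that of `(x_ij)`, where the
square of the norm of `(x_ij)` is the norm of the matrix `(∑ₗ ⟨x_li, x_lj⟩)` in `M_N(A)`. -/
def CompletelyContractive {E : Type*} [NormedAddCommGroup E] [NormedSpace ℂ E]
    [CStarCorrespondence A E] (T : E →ₗ[ℂ] (H →L[ℂ] H)) : Prop :=
  ∀ (N : ℕ) (x : Fin N → Fin N → E) (h : Fin N → H),
    ∑ i, ‖∑ j, T (x i j) (h j)‖ ^ 2 ≤
      ‖CStarMatrix.ofMatrix (Matrix.of fun i j => ∑ l, (ip (x l i) (x l j) : A))‖ * ∑ j, ‖h j‖ ^ 2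

namespace Tuple

variable {P} (R : P.Tuple H)

/-- The operator `T̃⁽ⁱ⁾ : E_i ⊗_σ H → H`, the continuous extension of `x ⊗ h ↦ T⁽ⁱ⁾(x) h`. (For
completely contractive covariant `T⁽ⁱ⁾` this map is a contraction, hence extends.) -/
def tildeE (i : Fin k) : InteriorTensor (P.fiber (e i)) R.σ →L[ℂ] H :=
  (TensorProduct.lift (ContinuousLinearMap.coeLM ℂ ∘ₗ R.T i)).extendOfNorm
    (InteriorTensor.of (P.fiber (e i)) R.σ)

/-- `I_{E_j} ⊗ T̃⁽ⁱ⁾ : E_j ⊗ (E_i ⊗_σ H) → E_j ⊗_σ H`. -/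
def idTilde (j i : Fin k) :
    InteriorTensor (P.fiber (e j)) (InteriorTensor.leftRep (P.fiber (e i)) R.σ) →L[ℂ]
      InteriorTensor (P.fiber (e j)) R.σ :=
  InteriorTensor.idTensor (P.fiber (e j)) _ _ (R.tildeE i)

/-- The tuple is a (completely contractive covariant) representation of the product system. -/
structure IsRepresentation : Prop where
  nondegenerate : Nondegenerate R.σ
  completelyContractive : ∀ i, CompletelyContractive (A := A) (R.T i)
  covariant : ∀ i (a b : A) (x : P.fiber (e i)),
    R.T i (left a (right b x)) = R.σ a * R.T i x * R.σ b
  commute : ∀ i j, R.tildeE i ∘L R.idTilde i j = R.tildeE j ∘L R.idTilde j i ∘L P.flip R.σ i j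

/-- The tuple is isometric: `T⁽ⁱ⁾(x)* T⁽ⁱ⁾(y) = σ(⟨x, y⟩)`. -/
def IsIsometric : Prop :=
  ∀ i (x y : P.fiber (e i)), (R.T i x).adjoint ∘L R.T i y = R.σ (ip x y : A)

/-- The tuple is doubly commuting:
`T̃⁽ʲ⁾* T̃⁽ⁱ⁾ = (I_{E_j} ⊗ T̃⁽ⁱ⁾) (t_{i,j} ⊗ I) (I_{E_i} ⊗ T̃⁽ʲ⁾*)` for `i ≠ j`. -/
def IsDoublyCommuting : Prop :=
  ∀ i j, i ≠ j → (R.tildeE j).adjoint ∘L R.tildeE i =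
    R.idTilde j i ∘L P.flip R.σ i j ∘L
      InteriorTensor.idTensor (P.fiber (e i)) _ _ (R.tildeE j).adjoint

/-- Isomorphism of tuples, implemented by a unitary operator. -/
def Isomorphic (S : P.Tuple K) : Prop :=
  ∃ U : H ≃ₗᵢ[ℂ] K, (∀ a h, S.σ a (U h) = U (R.σ a h)) ∧
    ∀ i (x : P.fiber (e i)) h, S.T i x (U h) = U (R.T i x h)

/-- The degree in `ℕ^k` of a word in the letters `1, …, k`. -/
def deg : List (Fin k) → (Fin k → ℕ)
  | [] => 0
  | i :: w => e i + deg w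

/-- The operator `E(n) ⊗_σ H → H`, for `n` the degree of the word `i₁ … i_l`, given by
`x₁ ⋯ x_l ⊗ h ↦ T⁽ⁱ¹⁾(x₁) ⋯ T⁽ⁱˡ⁾(x_l) h`, i.e. by `a ⊗ h ↦ σ(a) h` on `E(0) ⊗_σ H` for the
empty word, and by `T̃⁽ⁱ⁾ (I_{E_i} ⊗ T̃_w)` on `E_i ⊗ (E(deg w) ⊗_σ H)` for the word `i w`. -/
def tildeWord : (w : List (Fin k)) → {n : Fin k → ℕ} → deg w = n →
    (InteriorTensor (P.fiber n) R.σ →L[ℂ] H)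
  | [], _, rfl => (TensorProduct.lift (ContinuousLinearMap.coeLM ℂ ∘ₗ (R.σ : A →ₗ[ℂ] (H →L[ℂ] H))
      ∘ₗ (P.unit.symm : P.fiber 0 →ₗ[ℂ] A))).extendOfNorm (InteriorTensor.of (P.fiber 0) R.σ)
  | i :: w, _, h => R.tildeE i ∘L
      InteriorTensor.idTensor (P.fiber (e i)) _ _ (tildeWord w rfl) ∘L (P.assoc R.σ h).adjoint

/-- The word `1^{n₁} 2^{n₂} ⋯ k^{n_k}`. -/
def word (n : Fin k → ℕ) : List (Fin k) :=
  (List.finRange k).flatMap fun i => List.replicate (n i) i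

lemma deg_apply (w : List (Fin k)) (i : Fin k) : deg w i = w.count i := by
  induction w with
  | nil => rfl
  | cons j w ih =>
    rw [deg, Pi.add_apply, ih, List.count_cons, add_comm]
    congr 1
    by_cases hij : j = i
    · subst hij; simp
    · simp [hij, Ne.symm hij]

lemma deg_word (n : Fin k → ℕ) : deg (word n) = n := by
  funext i
  rw [deg_apply, word, List.count_flatMap]
  have : (List.count i ∘ fun j => List.replicate (n j) j) = fun j => if j = i then n i else 0 := by
    funext j
    simp only [Function.comp_apply, List.count_replicate, beq_iff_eq]
    split_ifs with h <;> simp [h]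
  rw [this, ← List.ofFn_eq_map, List.sum_ofFn]
  simp

/-- The operator `T̃(n) : E(n) ⊗_σ H → H`, where
`E(n) = E_1^{⊗ n₁} ⊗ ⋯ ⊗ E_k^{⊗ n_k}`. -/
def tilde (n : Fin k → ℕ) : InteriorTensor (P.fiber n) R.σ →L[ℂ] H :=
  R.tildeWord (word n) (deg_word n)

/-- `V`, on the Hilbert space `K`, is a minimal (regular) isometric dilation of `R`, on `H`, with
respect to the isometric embedding `ι` of `H` in `K`. -/
structure IsMinimalIsometricDilation (R : P.Tuple H) (V : P.Tuple K) (ι : H →ₗᵢ[ℂ] K) : Prop where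
  isRepresentation : V.IsRepresentation
  isIsometric : V.IsIsometric
  /-- `H` is reducing for `σ'`, with restriction `σ` -/
  restrict : ∀ a h, V.σ a (ι h) = ι (R.σ a h)
  /-- `H` is invariant under the adjoints of the operators `V⁽ⁱ⁾(x)` -/
  coinvariant : ∀ i (x : P.fiber (e i)) h, (V.T i x).adjoint (ι h) ∈ LinearMap.range ι.toLinearMap
  /-- `(I ⊗ P_H) Ṽ(m)* Ṽ(n)|_{E(n) ⊗ H} = T̃(m)* T̃(n)` whenever `m ∧ n = 0`; the inclusion of
  `E(n) ⊗_σ H` in `E(n) ⊗_σ' K` is `I ⊗ ι`, and `I ⊗ P_H` is its adjoint -/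
  regular : ∀ m n : Fin k → ℕ, m ⊓ n = 0 →
    (InteriorTensor.idTensor (P.fiber m) R.σ V.σ ι.toContinuousLinearMap).adjoint ∘L
        (V.tilde m).adjoint ∘L V.tilde n ∘L
          InteriorTensor.idTensor (P.fiber n) R.σ V.σ ι.toContinuousLinearMap
      = (R.tilde m).adjoint ∘L R.tilde n
  /-- no proper closed subspace contains `H` and is invariant under the operators `V⁽ⁱ⁾(x)` -/
  minimal : ∀ W : Submodule ℂ K, IsClosed (W : Set K) → (∀ h, ι h ∈ W) →
    (∀ i (x : P.fiber (e i)), ∀ w ∈ W, V.T i x w ∈ W) → W = ⊤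

end Tuple

section Fock

variable (π : A →⋆ₙₐ[ℂ] (K →L[ℂ] K))

/-- The Hilbert space `F(E) ⊗_π K = ⨁ₙ E(n) ⊗_π K`, for the Fock module `F(E) = ⨁ₙ E(n)`. -/
abbrev Fock : Type _ := lp (fun n : Fin k → ℕ => InteriorTensor (P.fiber n) π) 2

lemma summable_norm_sq (f : P.Fock π) : Summable fun n => ‖f n‖ ^ 2 := by
  have := (lp.memℓp f).summable (by norm_num)
  simpa using this

lemma memℓp_of_summable {f : ∀ n, InteriorTensor (P.fiber n) π}
    (hf : Summable fun n => ‖f n‖ ^ 2) : Memℓp f 2 :=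
  memℓp_gen (by simpa using hf)

lemma norm_sq_fock (f : P.Fock π) : ‖f‖ ^ 2 = ∑' n, ‖f n‖ ^ 2 := by
  have := lp.norm_rpow_eq_tsum (p := 2) (by norm_num) f
  simpa using this

lemma norm_leftRep_le (n : Fin k → ℕ) (a : A) (z : InteriorTensor (P.fiber n) π) :
    ‖InteriorTensor.leftRep (P.fiber n) π a z‖ ≤ ‖a‖ * ‖z‖ :=
  (ContinuousLinearMap.le_opNorm _ _).trans
    (mul_le_mul_of_nonneg_right (NonUnitalStarAlgHom.norm_apply_le _ _) (norm_nonneg _))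

/-- `φ_∞(a) ⊗ I_K`, acting as `a ⊗ I` on each `E(n) ⊗_π K`. -/
def fockLeft (a : A) : P.Fock π →L[ℂ] P.Fock π :=
  have hle : ∀ f : P.Fock π, ∀ n,
      ‖InteriorTensor.leftRep (P.fiber n) π a (f n)‖ ^ 2 ≤ ‖a‖ ^ 2 * ‖f n‖ ^ 2 := fun f n => by
    rw [← mul_pow]
    exact pow_le_pow_left₀ (norm_nonneg _) (P.norm_leftRep_le π n a _) 2
  have hs : ∀ f : P.Fock π,
      Summable fun n => ‖InteriorTensor.leftRep (P.fiber n) π a (f n)‖ ^ 2 := fun f =>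
    Summable.of_nonneg_of_le (fun _ => sq_nonneg _) (hle f)
      ((P.summable_norm_sq π f).mul_left _)
  LinearMap.mkContinuous
    { toFun := fun f => ⟨fun n => InteriorTensor.leftRep (P.fiber n) π a (f n),
        P.memℓp_of_summable π (hs f)⟩
      map_add' := fun f g => lp.ext (funext fun n => map_add _ _ _)
      map_smul' := fun c f => lp.ext (funext fun n => map_smul (InteriorTensor.leftRep (P.fiber n) π a) c (f n)) }
    ‖a‖ fun f => by
      refine le_of_sq_le_sq ?_ (by positivity)
      rw [mul_pow, norm_sq_fock, norm_sq_fock, ← tsum_mul_left]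
      exact (hs f).tsum_le_tsum (hle f) ((P.summable_norm_sq π f).mul_left _)

lemma fockLeft_apply (a : A) (f : P.Fock π) (n : Fin k → ℕ) :
    P.fockLeft π a f n = InteriorTensor.leftRep (P.fiber n) π a (f n) := rfl

/-- The representation `a ↦ φ_∞(a) ⊗ I_K` of `A` on `F(E) ⊗_π K`. -/
def fockRep : A →⋆ₙₐ[ℂ] (P.Fock π →L[ℂ] P.Fock π) where
  toFun := P.fockLeft π
  map_smul' c a := by
    ext1 f
    refine lp.ext (funext fun n => ?_)
    exact congrArg (fun L => L (f n)) (map_smul (InteriorTensor.leftRep (P.fiber n) π) c a)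
  map_zero' := by
    ext1 f
    refine lp.ext (funext fun n => ?_)
    exact congrArg (fun L => L (f n)) (map_zero (InteriorTensor.leftRep (P.fiber n) π))
  map_add' a b := by
    ext1 f
    refine lp.ext (funext fun n => ?_)
    exact congrArg (fun L => L (f n)) (map_add (InteriorTensor.leftRep (P.fiber n) π) a b)
  map_mul' a b := by
    ext1 f
    refine lp.ext (funext fun n => ?_)
    exact congrArg (fun L => L (f n)) (map_mul (InteriorTensor.leftRep (P.fiber n) π) a b)
  map_star' a := by
    rw [ContinuousLinearMap.star_eq_adjoint, ContinuousLinearMap.eq_adjoint_iff]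
    intro f g
    rw [lp.inner_eq_tsum, lp.inner_eq_tsum]
    refine tsum_congr fun n => ?_
    rw [fockLeft_apply, fockLeft_apply, InteriorTensor.inner_rep, star_star]

variable {P} in
/-- The components of `(T_x ⊗ I) f`: the component of degree `p` is `(T_x ⊗ I) f(p - e_i)` if
`e_i ≤ p`, and `0` otherwise. -/
def shiftFun (i : Fin k) (x : P.fiber (e i)) (f : P.Fock π) (p : Fin k → ℕ) :
    InteriorTensor (P.fiber p) π :=
  if h : e i + (p - e i) = p then P.create π h x (f (p - e i)) else 0

lemma shiftFun_add (i : Fin k) (x : P.fiber (e i)) (f : P.Fock π) (n : Fin k → ℕ) :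
    shiftFun π i x f (e i + n) = P.create π rfl x (f n) := by
  have key : ∀ n', n' = n → ∀ h : e i + n' = e i + n,
      P.create π h x (f n') = P.create π rfl x (f n) := by
    rintro n' rfl h
    rfl
  have h : e i + (e i + n - e i) = e i + n := by rw [add_tsub_cancel_left]
  rw [shiftFun, dif_pos h]
  exact key _ (add_tsub_cancel_left _ _) h

lemma shiftFun_of_notMem (i : Fin k) (x : P.fiber (e i)) (f : P.Fock π) (p : Fin k → ℕ)
    (hp : p ∉ Set.range fun n => e i + n) : shiftFun π i x f p = 0 :=
  dif_neg fun h => hp ⟨_, h⟩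

lemma shift_le (i : Fin k) (x : P.fiber (e i)) (f : P.Fock π) :
    (Summable fun p => ‖shiftFun π i x f p‖ ^ 2) ∧
      ∑' p, ‖shiftFun π i x f p‖ ^ 2 ≤ ‖(ip x x : A)‖ * ‖f‖ ^ 2 := by
  have hinj : Function.Injective fun n : Fin k → ℕ => e i + n := add_right_injective _
  have hz : ∀ p ∉ Set.range (fun n : Fin k → ℕ => e i + n), ‖shiftFun π i x f p‖ ^ 2 = 0 := by
    intro p hp
    rw [P.shiftFun_of_notMem π i x f p hp]
    simp
  have hle : ∀ n, ‖shiftFun π i x f (e i + n)‖ ^ 2 ≤ ‖(ip x x : A)‖ * ‖f n‖ ^ 2 := by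
    intro n
    rw [shiftFun_add]
    have := pow_le_pow_left₀ (norm_nonneg _) (P.norm_create_le π (rfl : e i + n = _) x (f n)) 2
    rwa [mul_pow, Real.sq_sqrt (norm_nonneg _)] at this
  have hs' := (P.summable_norm_sq π f).mul_left ‖(ip x x : A)‖
  have hs : Summable fun n => ‖shiftFun π i x f (e i + n)‖ ^ 2 :=
    Summable.of_nonneg_of_le (fun _ => sq_nonneg _) hle hs'
  refine ⟨(hinj.summable_iff hz).1 hs, ?_⟩
  rw [← hinj.tsum_eq (Function.support_subset_iff'.2 hz), norm_sq_fock, ← tsum_mul_left]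
  exact hs.tsum_le_tsum hle hs'

/-- `T_x ⊗ I_K` on `F(E) ⊗_π K`, for the Toeplitz creation operator `T_x` determined by
`x ∈ E_i`. -/
def fockCreate (i : Fin k) (x : P.fiber (e i)) : P.Fock π →L[ℂ] P.Fock π :=
  LinearMap.mkContinuous
    { toFun := fun f => ⟨shiftFun π i x f, P.memℓp_of_summable π (P.shift_le π i x f).1⟩
      map_add' := fun f g => lp.ext (funext fun p => by
        change shiftFun π i x (f + g) p = shiftFun π i x f p + shiftFun π i x g p
        unfold shiftFun
        split_ifs <;> simp)
      map_smul' := fun c f => lp.ext (funext fun p => by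
        change shiftFun π i x (c • f) p = c • shiftFun π i x f p
        unfold shiftFun
        split_ifs <;> simp) }
    √‖(ip x x : A)‖ fun f => by
      refine le_of_sq_le_sq ?_ (by positivity)
      rw [mul_pow, Real.sq_sqrt (norm_nonneg _), norm_sq_fock]
      exact (P.shift_le π i x f).2

/-- The representation of the product system induced by the representation `π` of `A`. -/
def induced : P.Tuple (P.Fock π) where
  σ := P.fockRep π
  T i :=
    { toFun := fun x => P.fockCreate π i x
      map_add' := fun x y => by
        ext1 f
        refine lp.ext (funext fun p => ?_)
        change shiftFun π i (x + y) f p = shiftFun π i x f p + shiftFun π i y f p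
        unfold shiftFun
        split_ifs <;> simp
      map_smul' := fun c x => by
        ext1 f
        refine lp.ext (funext fun p => ?_)
        change shiftFun π i (c • x) f p = c • shiftFun π i x f p
        unfold shiftFun
        split_ifs <;> simp }

end Fock

/-- The tuple is isomorphic to a representation induced by a (non-degenerate) representation `π` of
`A` on some Hilbert space `G`. (Since `G` embeds isometrically in the carrier space of the induced
representation, it may be taken in the universe of `K`.) -/
def Tuple.IsIsomorphicToInduced {K : Type w} [NormedAddCommGroup K] [InnerProductSpace ℂ K]
    [CompleteSpace K] {P : ProductSystem A k} (V : P.Tuple K) : Prop :=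
  ∃ (G : Type w) (_ : NormedAddCommGroup G) (_ : InnerProductSpace ℂ G) (_ : CompleteSpace G)
    (π : A →⋆ₙₐ[ℂ] (G →L[ℂ] G)), Nondegenerate π ∧ V.Isomorphic (P.induced π)

end ProductSystem

end

/-!
Write `Ṽ(n)` and `T̃(n)` for the operators on `E(n) ⊗ K` and `E(n) ⊗ H`, and `e_i` for the degree of
the `i`-th generator.

The proof is a Wold decomposition. The point at which double commutation enters is that the minimal
isometric dilation `V` of a doubly commuting `T` is again doubly commuting: regularity determines
the inner products of `Ṽ(m) z` and `Ṽ(n) w` for `z, w` over `H`, and double commutation of `T`,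
extended from generators to arbitrary degrees (`IsDoublyCommuting.adjoint_comp_tilde`), then shows
that the projection `Q_i` onto the range of `Ṽ(e_i)` maps `Ṽ(m) z` to `Ṽ(m + e_i) (I ⊗ T̃(e_i)*) z`
whenever `m_i = 0` (`starProjection_dil`). As the vectors `Ṽ(m) z` span `K`, it follows that `Q_i`
commutes with `V⁽ʲ⁾(y)` for `j ≠ i` (`starProjection_comm`).

Let `W = ⋂ ker Ṽ(e_i)*` be the wandering subspace. Because of the commutation relations, the maps
`E(n) ⊗ W → K` are isometries with pairwise orthogonal ranges (`RangesCommute.orthogonalFamily`), so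
`V` is induced by the representation of `A` on `W` as soon as these ranges span
(`RangesCommute.isIsomorphicToInduced`). Let `N` be the orthogonal complement of their span. For a
set `s` of indices let `N_s` consist of the vectors of `N` in the kernels of `Ṽ(e_i)*` for `i ∉ s`.
Then `N_∅ = 0`, and `N_s = 0` implies that `N_{s ∪ {j}}` lies in `⋂ₗ Ṽ(l e_j) K`. If
`‖T̃(l e_j)* h‖ → 0` for all `h ∈ H`, the latter space is orthogonal to `H` (`inner_ι_eq_zero`),
because `‖Ṽ(l e_j)* h‖ = ‖T̃(l e_j)* h‖`. Since `N_{s ∪ {j}}` is invariant under the adjoints of all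
`V⁽ⁱ⁾(x)`, minimality gives `N_{s ∪ {j}} = 0` (`RangesCommute.eq_zero_of_orthogonal_wandering`).
Conversely, in an induced representation `Ṽ(l e_j)*` kills the components of degree `n` with
`n_j < l`, so that it tends to zero strongly (`tendsto_adjoint_tilde`); again
`‖Ṽ(l e_j)* h‖ = ‖T̃(l e_j)* h‖` for `h ∈ H`.

A preliminary fact, needed to know that `T̃⁽ⁱ⁾` is given by `x ⊗ h ↦ T⁽ⁱ⁾(x) h`, is that complete
contractivity of `T⁽ⁱ⁾` makes this map a contraction (`CompletelyContractive.norm_sum_le`). It is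
obtained by functional calculus in the matrix algebras over `A`.
-/

noncomputable section

/-! ### Interior tensor products and creation operators -/

namespace InteriorTensor

open CStarCorrespondence

variable {A E F H K : Type*} [NonUnitalCStarAlgebra A] [PartialOrder A] [StarOrderedRing A]
  [NormedAddCommGroup E] [NormedSpace ℂ E] [CStarCorrespondence A E]
  [NormedAddCommGroup H] [InnerProductSpace ℂ H] [CompleteSpace H]
  [NormedAddCommGroup K] [InnerProductSpace ℂ K] [CompleteSpace K]
  (σ : A →⋆ₙₐ[ℂ] (H →L[ℂ] H)) (ρ : A →⋆ₙₐ[ℂ] (K →L[ℂ] K))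

/-- A closed subspace of `E ⊗_σ H` containing all `x ⊗ h` is everything. -/
lemma eq_top_of_tmul_mem (M : Submodule ℂ (InteriorTensor E σ))
    (hM : IsClosed (M : Set (InteriorTensor E σ))) (h : ∀ x h, of E σ (x ⊗ₜ h) ∈ M) : M = ⊤ := by
  rw [eq_top_iff]
  rintro u -
  refine (denseRange_of σ).induction_on (p := fun u => u ∈ M) u hM fun z => ?_
  induction z with
  | zero => simp
  | add z₁ z₂ h₁ h₂ => rw [map_add]; exact M.add_mem h₁ h₂
  | tmul x g => exact h x g

variable {σ} in
lemma clm_ext {X : Type*} [NormedAddCommGroup X] [NormedSpace ℂ X]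
    {f g : InteriorTensor E σ →L[ℂ] X} (h : ∀ x h, f (of E σ (x ⊗ₜ h)) = g (of E σ (x ⊗ₜ h))) :
    f = g := by
  have := eq_top_of_tmul_mem σ (LinearMap.eqLocus f.toLinearMap g.toLinearMap)
    (isClosed_eq f.continuous g.continuous) h
  ext u
  have hu : u ∈ LinearMap.eqLocus f.toLinearMap g.toLinearMap := this ▸ Submodule.mem_top
  exact hu

lemma inner_of_tmul (x y : E) (h g : H) :
    inner ℂ (of E σ (x ⊗ₜ h)) (of E σ (y ⊗ₜ g)) = inner ℂ h (σ (ip x y : A) g) := by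
  rw [inner_of, form_tmul]

variable {σ} in
lemma ext_inner_tmul {u v : InteriorTensor E σ}
    (h : ∀ x h, inner ℂ (of E σ (x ⊗ₜ h)) u = inner ℂ (of E σ (x ⊗ₜ h)) v) : u = v := by
  refine ext_inner_left ℂ fun w => ?_
  have := eq_top_of_tmul_mem σ (ℂ ∙ (u - v))ᗮ (Submodule.isClosed_orthogonal _) fun x h' => by
    rw [Submodule.mem_orthogonal_singleton_iff_inner_left, inner_sub_right, h, sub_self]
  have hw : w ∈ (ℂ ∙ (u - v))ᗮ := this ▸ Submodule.mem_top
  rwa [Submodule.mem_orthogonal_singleton_iff_inner_left, inner_sub_right, sub_eq_zero] at hw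

lemma leftRep_tmul (a : A) (x : E) (h : H) :
    leftRep E σ a (of E σ (x ⊗ₜ h)) = of E σ (left a x ⊗ₜ h) := by
  rw [leftRep_of, preLeft_tmul]

variable (E) in
/-- The operator `h ↦ x ⊗ h` from `H` to `E ⊗_σ H`. -/
def ket (x : E) : H →L[ℂ] InteriorTensor E σ :=
  LinearMap.mkContinuous (of E σ ∘ₗ TensorProduct.mk ℂ E H x) ‖x‖ fun h => norm_of_tmul_le σ x h

lemma ket_apply (x : E) (h : H) : ket E σ x h = of E σ (x ⊗ₜ h) := rfl

variable (E) in
/-- The bounded linear map `x ↦ x ⊗ h` from `E` to `E ⊗_σ H`. -/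
def tmulAt (h : H) : E →L[ℂ] InteriorTensor E σ :=
  LinearMap.mkContinuous (of E σ ∘ₗ (TensorProduct.mk ℂ E H).flip h) ‖h‖ fun x => by
    rw [mul_comm]
    exact norm_of_tmul_le σ x h

lemma tmulAt_apply (h : H) (x : E) : tmulAt E σ h x = of E σ (x ⊗ₜ h) := rfl

lemma of_right_tmul (a : A) (x : E) (h : H) :
    of E σ (right a x ⊗ₜ h) = of E σ (x ⊗ₜ σ a h) := by
  refine ext_inner_tmul fun y g => ?_
  rw [inner_of_tmul, inner_of_tmul, ip_right, map_mul]
  rfl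

section idTensor

variable {σ ρ} {L : H →L[ℂ] K} (hL : ∀ a h, L (σ a h) = ρ a (L h))
include hL

lemma idTensor_tmul (x : E) (h : H) :
    idTensor E σ ρ L (of E σ (x ⊗ₜ h)) = of E ρ (x ⊗ₜ L h) := by
  rw [idTensor_of σ ρ L hL, LinearMap.lTensor_tmul]
  rfl

lemma adjoint_intertwines (a : A) (g : K) : L.adjoint (ρ a g) = σ a (L.adjoint g) := by
  refine ext_inner_left ℂ fun v => ?_
  have h1 : inner ℂ v (σ a (L.adjoint g)) = inner ℂ (σ (star a) v) (L.adjoint g) := by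
    rw [inner_rep, star_star]
  rw [h1, ContinuousLinearMap.adjoint_inner_right, ContinuousLinearMap.adjoint_inner_right, hL,
    inner_rep, star_star]

lemma idTensor_adjoint : (idTensor E σ ρ L).adjoint = idTensor E ρ σ L.adjoint := by
  refine clm_ext fun x g => ext_inner_tmul fun y h => ?_
  rw [ContinuousLinearMap.adjoint_inner_right, idTensor_tmul hL,
    idTensor_tmul (adjoint_intertwines hL), inner_of_tmul, inner_of_tmul,
    ← adjoint_intertwines hL, ContinuousLinearMap.adjoint_inner_right]

/-- `I ⊗ L` is isometric if `L` is. -/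
lemma norm_idTensor (hiso : L.adjoint ∘L L = 1) (u : InteriorTensor E σ) :
    ‖idTensor E σ ρ L u‖ = ‖u‖ := by
  have h1 : (idTensor E σ ρ L).adjoint ∘L idTensor E σ ρ L = 1 := by
    rw [idTensor_adjoint hL]
    refine clm_ext fun x h => ?_
    rw [ContinuousLinearMap.comp_apply, idTensor_tmul hL,
      idTensor_tmul (adjoint_intertwines hL), ← ContinuousLinearMap.comp_apply, hiso]
    rfl
  have h2 : inner ℂ (idTensor E σ ρ L u) (idTensor E σ ρ L u) = inner ℂ u u := by
    rw [← ContinuousLinearMap.adjoint_inner_right, ← ContinuousLinearMap.comp_apply, h1]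
    rfl
  rw [@norm_eq_sqrt_re_inner ℂ, @norm_eq_sqrt_re_inner ℂ _ _ _ _ u, h2]

end idTensor

end InteriorTensor

namespace ProductSystem

open CStarCorrespondence InteriorTensor

variable {A : Type*} [NonUnitalCStarAlgebra A] [PartialOrder A] [StarOrderedRing A] {k : ℕ}
  {H K : Type*} [NormedAddCommGroup H] [InnerProductSpace ℂ H] [CompleteSpace H]
  [NormedAddCommGroup K] [InnerProductSpace ℂ K] [CompleteSpace K]
  (P : ProductSystem A k) {σ : A →⋆ₙₐ[ℂ] (H →L[ℂ] H)} {ρ : A →⋆ₙₐ[ℂ] (K →L[ℂ] K)}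
  {l m n p q : Fin k → ℕ}

lemma left_mul (h : m + n = p) (a : A) (x : P.fiber m) (y : P.fiber n) :
    left a (P.mul h x y) = P.mul h (left a x) y := by
  rw [← P.unit_mul, ← P.unit_mul, ← P.mul_assoc (zero_add m) h]

lemma left_right (a b : A) (x : P.fiber m) :
    (left a (right b x) : P.fiber m) = right b (left a x) := by
  rw [← P.mul_unit, ← P.mul_unit, left_mul]

lemma norm_create_le' (h : m + n = p) (x : P.fiber m) (z : InteriorTensor (P.fiber n) σ) :
    ‖P.create σ h x z‖ ≤ ‖x‖ * ‖z‖ := by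
  have := P.norm_create_le σ h x z
  rwa [← norm_sq, Real.sqrt_sq (norm_nonneg _)] at this

variable (σ) in
lemma create_tmul (h : m + n = p) (x : P.fiber m) (y : P.fiber n) (g : H) :
    P.create σ h x (of _ σ (y ⊗ₜ g)) = of _ σ (P.mul h x y ⊗ₜ g) := by
  rw [create_of, LinearMap.rTensor_tmul]

/-- A closed subspace of `E(p)` containing all products is everything. -/
lemma eq_top_of_mul_mem (h : m + n = p) (M : Submodule ℂ (P.fiber p))
    (hM : IsClosed (M : Set (P.fiber p))) (hmem : ∀ x y, P.mul h x y ∈ M) : M = ⊤ := by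
  rw [eq_top_iff, ← P.mul_total h]
  refine Submodule.topologicalClosure_minimal _ ?_ hM
  rw [Submodule.span_le]
  rintro _ ⟨x, y, rfl⟩
  exact hmem x y

/-- Two bounded linear maps on `E(p)` which agree on products are equal. -/
lemma clm_ext_mul {X : Type*} [NormedAddCommGroup X] [NormedSpace ℂ X] (h : m + n = p)
    {f g : P.fiber p →L[ℂ] X} (hfg : ∀ x y, f (P.mul h x y) = g (P.mul h x y)) : f = g := by
  have := P.eq_top_of_mul_mem h (LinearMap.eqLocus f.toLinearMap g.toLinearMap)
    (isClosed_eq f.continuous g.continuous) hfg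
  ext u
  have hu : u ∈ LinearMap.eqLocus f.toLinearMap g.toLinearMap := this ▸ Submodule.mem_top
  exact hu

/-- The bounded linear map `x ↦ (T_x ⊗ I) z`. -/
def createAt (h : m + n = p) (z : InteriorTensor (P.fiber n) σ) :
    P.fiber m →L[ℂ] InteriorTensor (P.fiber p) σ :=
  LinearMap.mkContinuous
    ((ContinuousLinearMap.coeLM ℂ ∘ₗ P.create σ h : P.fiber m →ₗ[ℂ] _ →ₗ[ℂ] _).flip z) ‖z‖
    fun x => by
      rw [mul_comm]
      exact P.norm_create_le' h x z

lemma createAt_apply (h : m + n = p) (z : InteriorTensor (P.fiber n) σ) (x : P.fiber m) :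
    P.createAt h z x = P.create σ h x z := rfl

/-- A closed subspace of `E(m + n) ⊗_σ H` containing all `(T_x ⊗ I) z` is everything. -/
lemma eq_top_of_create_mem (h : m + n = p) (M : Submodule ℂ (InteriorTensor (P.fiber p) σ))
    (hM : IsClosed (M : Set (InteriorTensor (P.fiber p) σ)))
    (hmem : ∀ x z, P.create σ h x z ∈ M) : M = ⊤ := by
  refine eq_top_of_tmul_mem σ M hM fun y g => ?_
  have := P.eq_top_of_mul_mem h (M.comap (tmulAt (P.fiber p) σ g).toLinearMap)
    (hM.preimage (tmulAt (P.fiber p) σ g).continuous) fun x y => by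
      rw [Submodule.mem_comap]
      have := hmem x (of _ σ (y ⊗ₜ g))
      rwa [create_tmul] at this
  have hy : y ∈ M.comap (tmulAt (P.fiber p) σ g).toLinearMap :=
    this ▸ Submodule.mem_top
  exact hy

lemma clm_ext_create {X : Type*} [NormedAddCommGroup X] [NormedSpace ℂ X] (h : m + n = p)
    {f g : InteriorTensor (P.fiber p) σ →L[ℂ] X}
    (hfg : ∀ x z, f (P.create σ h x z) = g (P.create σ h x z)) : f = g := by
  have := P.eq_top_of_create_mem h (LinearMap.eqLocus f.toLinearMap g.toLinearMap)
    (isClosed_eq f.continuous g.continuous) hfg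
  ext u
  have hu : u ∈ LinearMap.eqLocus f.toLinearMap g.toLinearMap := this ▸ Submodule.mem_top
  exact hu

lemma ext_inner_create (h : m + n = p) {u v : InteriorTensor (P.fiber p) σ}
    (huv : ∀ x z, inner ℂ (P.create σ h x z) u = inner ℂ (P.create σ h x z) v) : u = v := by
  refine ext_inner_left ℂ fun w => ?_
  have := P.eq_top_of_create_mem h (ℂ ∙ (u - v))ᗮ (Submodule.isClosed_orthogonal _) fun x z => by
    rw [Submodule.mem_orthogonal_singleton_iff_inner_left, inner_sub_right, huv, sub_self]
  have hw : w ∈ (ℂ ∙ (u - v))ᗮ := this ▸ Submodule.mem_top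
  rwa [Submodule.mem_orthogonal_singleton_iff_inner_left, inner_sub_right, sub_eq_zero] at hw

lemma create_mul {lm mn : Fin k → ℕ} (h₁ : l + m = lm) (h₂ : lm + n = p) (h₃ : m + n = mn)
    (h₄ : l + mn = p) (x : P.fiber l) (y : P.fiber m) (z : InteriorTensor (P.fiber n) σ) :
    P.create σ h₂ (P.mul h₁ x y) z = P.create σ h₄ x (P.create σ h₃ y z) := by
  have : P.create σ h₂ (P.mul h₁ x y) = P.create σ h₄ x ∘L P.create σ h₃ y :=
    clm_ext fun w g => by
      rw [ContinuousLinearMap.comp_apply, create_tmul, create_tmul, create_tmul,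
        P.mul_assoc h₁ h₂ h₃ h₄]
  rw [this]
  rfl

lemma create_unit (a : A) (z : InteriorTensor (P.fiber n) σ) :
    P.create σ (zero_add n) (P.unit a) z = leftRep (P.fiber n) σ a z := by
  have : P.create σ (zero_add n) (P.unit a) = leftRep (P.fiber n) σ a :=
    clm_ext fun w g => by rw [create_tmul, leftRep_tmul, P.unit_mul]
  rw [this]

lemma leftRep_create (h : m + n = p) (a : A) (x : P.fiber m)
    (z : InteriorTensor (P.fiber n) σ) :
    leftRep (P.fiber p) σ a (P.create σ h x z) = P.create σ h (left a x) z := by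
  rw [← create_unit, ← P.create_mul (zero_add m) h, P.unit_mul]

lemma create_zero_tmul (x : P.fiber m) (a : A) (g : H) :
    P.create σ (add_zero m) x (of _ σ (P.unit a ⊗ₜ g)) = of _ σ (x ⊗ₜ σ a g) := by
  rw [create_tmul, P.mul_unit, of_right_tmul]

lemma assoc_tmul (h : m + n = p) (x : P.fiber m) (z : InteriorTensor (P.fiber n) σ) :
    P.assoc σ h (of _ _ (x ⊗ₜ z)) = P.create σ h x z := by
  rw [assoc_of]
  rfl

lemma assoc_adjoint_create (h : m + n = p) (x : P.fiber m) (z : InteriorTensor (P.fiber n) σ) :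
    (P.assoc σ h).adjoint (P.create σ h x z) = of _ _ (x ⊗ₜ z) := by
  refine ext_inner_tmul fun y w => ?_
  rw [ContinuousLinearMap.adjoint_inner_right, assoc_tmul, inner_create, inner_of_tmul]

/-- `E(m) ⊗ (E(n) ⊗ H) → E(m + n) ⊗ H` is a co-isometry, since its range is dense. -/
lemma assoc_assoc_adjoint (h : m + n = p) : P.assoc σ h ∘L (P.assoc σ h).adjoint = 1 :=
  P.clm_ext_create h fun x z => by
    rw [ContinuousLinearMap.comp_apply, assoc_adjoint_create, assoc_tmul]
    rfl

lemma idTensor_create {L : H →L[ℂ] K} (hL : ∀ a h, L (σ a h) = ρ a (L h)) (h : m + n = p)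
    (x : P.fiber m) (z : InteriorTensor (P.fiber n) σ) :
    idTensor (P.fiber p) σ ρ L (P.create σ h x z)
      = P.create ρ h x (idTensor (P.fiber n) σ ρ L z) := by
  have : idTensor (P.fiber p) σ ρ L ∘L P.create σ h x
      = P.create ρ h x ∘L idTensor (P.fiber n) σ ρ L :=
    clm_ext fun w g => by
      simp only [ContinuousLinearMap.comp_apply, create_tmul, idTensor_tmul hL]
  exact DFunLike.congr_fun this z

end ProductSystem

/-! ### Functional calculus, Gram matrices and complete contractivity -/

section FunctionalCalculus

variable {B : Type*} [NonUnitalCStarAlgebra B]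

lemma star_cfcₙ_real (f : ℝ → ℝ) (a : B) : star (cfcₙ f a) = cfcₙ f a :=
  (cfcₙ_predicate f a : IsSelfAdjoint _).star_eq

/-- A compression of a self-adjoint element onto its negative part. -/
lemma IsSelfAdjoint.exists_compression_eq_neg {a : B} (ha : IsSelfAdjoint a) :
    ∃ c d : B, star c = c ∧ star d = d ∧ c * a * c = -(d * d) ∧
      (d = 0 → cfcₙ (fun t : ℝ => max t 0) a = a) := by
  refine ⟨cfcₙ (fun t : ℝ => √(max (-t) 0)) a, cfcₙ (fun t : ℝ => max (-t) 0) a,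
    star_cfcₙ_real _ a, star_cfcₙ_real _ a, ?_, fun hd => ?_⟩
  · have h1 : cfcₙ (fun t : ℝ => √(max (-t) 0) * t * √(max (-t) 0)) a
        = cfcₙ (fun t : ℝ => √(max (-t) 0)) a * a * cfcₙ (fun t : ℝ => √(max (-t) 0)) a := by
      rw [cfcₙ_mul (fun t : ℝ => √(max (-t) 0) * t) (fun t : ℝ => √(max (-t) 0)) a,
        cfcₙ_mul (fun t : ℝ => √(max (-t) 0)) (fun t : ℝ => t) a, cfcₙ_id' ℝ a]
    rw [← h1, ← cfcₙ_mul _ _ a, ← cfcₙ_neg]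
    refine cfcₙ_congr fun t _ => ?_
    have h1 : √(max (-t) 0) * √(max (-t) 0) = max (-t) 0 := Real.mul_self_sqrt (le_max_right _ _)
    rcases le_total t 0 with ht | ht
    · rw [max_eq_left (by linarith)] at h1 ⊢
      linear_combination t * h1
    · rw [max_eq_right (by linarith)]
      simp
  · have h1 : cfcₙ (fun t : ℝ => max t 0 - max (-t) 0) a = a := by
      conv_rhs => rw [← cfcₙ_id ℝ a]
      refine cfcₙ_congr fun t _ => ?_
      rcases le_total t 0 with ht | ht <;> simp [ht]
    rw [cfcₙ_sub _ _ a, hd, sub_zero] at h1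
    exact h1

/-- An approximate polar decomposition: `f * s` acts almost as a unit on the positive element
`a = s * s`, while `f * a * f` has norm at most one. -/
lemma exists_approx_sqrt_factorization {a : B} (ha : cfcₙ (fun t : ℝ => max t 0) a = a) :
    ∃ s : B, star s = s ∧ s * s = a ∧ ∀ ε : ℝ, 0 < ε → ∃ f : B, star f = f ∧ star (f * s) = f * s ∧
      ‖f * a * f‖ ≤ 1 ∧ ‖a - f * s * a - (a * (f * s) - f * s * a * (f * s))‖ ≤ ε := by
  obtain ⟨m, hm⟩ : ∃ m : ℝ → ℝ, m = fun t => max t 0 := ⟨_, rfl⟩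
  have hm0 : m 0 = 0 := by simp [hm]
  have hmpos : ∀ t, 0 ≤ m t := fun t => by rw [hm]; exact le_max_right _ _
  have hmc : Continuous m := by rw [hm]; fun_prop
  rw [← hm] at ha
  -- `s(t) = √t` and `f(t) = √t / (t + ε)` on the positive half-line, so that `f s = t / (t + ε)`.
  obtain ⟨s, hs⟩ : ∃ s : ℝ → ℝ, s = fun t => √(m t) := ⟨_, rfl⟩
  have hs0 : s 0 = 0 := by simp [hs, hm0]
  have hsc : Continuous s := by rw [hs]; fun_prop
  have hss : ∀ t, s t * s t = m t := fun t => by rw [hs]; exact Real.mul_self_sqrt (hmpos t)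
  refine ⟨cfcₙ s a, star_cfcₙ_real _ a, ?_, fun ε hε => ?_⟩
  · conv_rhs => rw [← ha]
    rw [← cfcₙ_mul s s a hsc.continuousOn hs0 hsc.continuousOn hs0]
    exact cfcₙ_congr fun t _ => hss t
  have hpos : ∀ t : ℝ, 0 < m t + ε := fun t => by
    have := hmpos t
    linarith
  obtain ⟨f, hf⟩ : ∃ f : ℝ → ℝ, f = fun t => s t / (m t + ε) := ⟨_, rfl⟩
  have hf0 : f 0 = 0 := by simp [hf, hs0]
  have hfc : Continuous f := by
    rw [hf]
    exact hsc.div (by fun_prop) fun t => (hpos t).ne'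
  obtain ⟨r, hr⟩ : ∃ r : ℝ → ℝ, r = fun t => f t * s t := ⟨_, rfl⟩
  have hr0 : r 0 = 0 := by simp [hr, hs0]
  have hrc : Continuous r := by rw [hr]; fun_prop
  have hrfs : cfcₙ f a * cfcₙ s a = cfcₙ r a := by
    rw [hr, cfcₙ_mul f s a hfc.continuousOn hf0 hsc.continuousOn hs0]
  refine ⟨cfcₙ f a, star_cfcₙ_real _ a, by rw [hrfs, star_cfcₙ_real], ?_, ?_⟩
  · have e : cfcₙ (fun t => f t * m t * f t) a = cfcₙ f a * a * cfcₙ f a := by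
      rw [cfcₙ_mul (fun t => f t * m t) f a (by fun_prop) (by simp [hf0]) (by fun_prop) hf0,
        cfcₙ_mul f m a (by fun_prop) hf0 (by fun_prop) hm0, ha]
    rw [← e]
    refine norm_cfcₙ_le fun t _ => ?_
    have h2 : f t * m t * f t = (m t / (m t + ε)) ^ 2 := by
      have := (hpos t).ne'
      rw [hf]
      field_simp
      linear_combination m t * hss t
    have h3 : 0 ≤ m t / (m t + ε) := div_nonneg (hmpos t) (hpos t).le
    have h4 : m t / (m t + ε) ≤ 1 := (div_le_one (hpos t)).2 (by linarith)
    rw [h2, Real.norm_of_nonneg (sq_nonneg _)]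
    nlinarith
  · have e : cfcₙ (fun t => m t - r t * m t - (m t * r t - r t * m t * r t)) a
        = a - cfcₙ r a * a - (a * cfcₙ r a - cfcₙ r a * a * cfcₙ r a) := by
      rw [cfcₙ_sub (fun t => m t - r t * m t) (fun t => m t * r t - r t * m t * r t) a
          (by fun_prop) (by simp [hm0]) (by fun_prop) (by simp [hm0, hr0]),
        cfcₙ_sub m (fun t => r t * m t) a (by fun_prop) hm0 (by fun_prop) (by simp [hm0]),
        cfcₙ_sub (fun t => m t * r t) (fun t => r t * m t * r t) a (by fun_prop) (by simp [hm0])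
          (by fun_prop) (by simp [hm0]),
        cfcₙ_mul (fun t => r t * m t) r a (by fun_prop) (by simp [hm0]) (by fun_prop) hr0,
        cfcₙ_mul m r a (by fun_prop) hm0 (by fun_prop) hr0,
        cfcₙ_mul r m a (by fun_prop) hr0 (by fun_prop) hm0, ha]
    rw [hrfs, ← e]
    refine norm_cfcₙ_le fun t _ => ?_
    have hne := (hpos t).ne'
    have h2 : r t = m t / (m t + ε) := by
      rw [hr, hf]
      dsimp only
      rw [div_mul_eq_mul_div, hss]
    have h0 := hmpos t
    have h3 : m t - r t * m t - (m t * r t - r t * m t * r t) = m t * ε ^ 2 / (m t + ε) ^ 2 := by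
      rw [h2]
      field_simp
      ring
    rw [h3, Real.norm_of_nonneg (by positivity), div_le_iff₀ (pow_pos (hpos t) 2)]
    nlinarith [mul_nonneg h0 hε.le, mul_nonneg (mul_nonneg h0 hε.le) hε.le,
      mul_nonneg (mul_nonneg h0 h0) hε.le, pow_pos hε 3]

/-- A self-adjoint element all of whose compressions of the form `-(d * d)` vanish has approximate
polar decompositions. -/
lemma IsSelfAdjoint.exists_approx_sqrt_factorization {a : B} (ha : IsSelfAdjoint a)
    (hneg : ∀ c d : B, star c = c → star d = d → c * a * c = -(d * d) → d = 0) :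
    ∃ s : B, star s = s ∧ s * s = a ∧ ∀ ε : ℝ, 0 < ε → ∃ f : B, star f = f ∧ star (f * s) = f * s ∧
      ‖f * a * f‖ ≤ 1 ∧ ‖a - f * s * a - (a * (f * s) - f * s * a * (f * s))‖ ≤ ε := by
  obtain ⟨c, d, hc, hd, hcd, h0⟩ := ha.exists_compression_eq_neg
  exact _root_.exists_approx_sqrt_factorization (h0 (hneg c d hc hd hcd))

end FunctionalCalculus

namespace CStarCorrespondence

variable {A E H : Type*} [NonUnitalCStarAlgebra A] [PartialOrder A] [StarOrderedRing A]
  [NormedAddCommGroup E] [NormedSpace ℂ E] [CStarCorrespondence A E]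
  [NormedAddCommGroup H] [InnerProductSpace ℂ H] [CompleteSpace H] {N : ℕ}

lemma right_ip (x y : E) (a : A) : (ip (right a x) y : A) = star a * ip x y := by
  rw [← star_ip, ip_right, star_mul, star_ip]

variable (A) in
/-- The Gram matrix `(⟨x_i, x_j⟩)`. -/
def gram (x : Fin N → E) : CStarMatrix (Fin N) (Fin N) A :=
  CStarMatrix.ofMatrix (Matrix.of fun i j => (ip (x i) (x j) : A))

lemma gram_apply (x : Fin N → E) (i j : Fin N) : gram A x i j = ip (x i) (x j) := rfl

/-- The row `x · b` for a row `x` over `E` and a matrix `b` over `A`. -/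
def rowMul (x : Fin N → E) (b : CStarMatrix (Fin N) (Fin N) A) (j : Fin N) : E :=
  ∑ i, right (b i j) (x i)

lemma ip_rowMul (x y : Fin N → E) (b : CStarMatrix (Fin N) (Fin N) A) (i j : Fin N) :
    (ip (y i) (rowMul x b j) : A) = ∑ l, ip (y i) (x l) * b l j := by
  rw [rowMul, map_sum]
  exact Finset.sum_congr rfl fun l _ => ip_right _ _ _

lemma rowMul_ip (x y : Fin N → E) (b : CStarMatrix (Fin N) (Fin N) A) (i j : Fin N) :
    (ip (rowMul x b i) (y j) : A) = ∑ l, star (b l i) * ip (x l) (y j) := by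
  rw [rowMul, map_sum, LinearMap.sum_apply]
  exact Finset.sum_congr rfl fun l _ => right_ip _ _ _

lemma gram_rowMul (x : Fin N → E) (b : CStarMatrix (Fin N) (Fin N) A) :
    gram A (rowMul x b) = star b * gram A x * b := by
  ext i j
  rw [gram_apply, ip_rowMul, CStarMatrix.mul_apply]
  refine Finset.sum_congr rfl fun l _ => ?_
  rw [rowMul_ip, CStarMatrix.mul_apply]
  rfl

lemma gram_sub_rowMul (x : Fin N → E) (b : CStarMatrix (Fin N) (Fin N) A) :
    gram A (x - rowMul x b)
      = gram A x - star b * gram A x - (gram A x * b - star b * gram A x * b) := by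
  rw [← gram_rowMul]
  ext i j
  have h1 : (star b * gram A x) i j = ip (rowMul x b i) (x j) := by
    rw [rowMul_ip, CStarMatrix.mul_apply]
    rfl
  have h2 : (gram A x * b) i j = ip (x i) (rowMul x b j) := by
    rw [ip_rowMul, CStarMatrix.mul_apply]
    rfl
  rw [CStarMatrix.sub_apply, CStarMatrix.sub_apply, CStarMatrix.sub_apply, h1, h2, gram_apply,
    gram_apply, gram_apply, Pi.sub_apply, Pi.sub_apply, map_sub, map_sub, LinearMap.sub_apply,
    LinearMap.sub_apply]

lemma isSelfAdjoint_gram (x : Fin N → E) : IsSelfAdjoint (gram A x) := by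
  ext i j
  rw [CStarMatrix.star_apply, gram_apply, gram_apply, star_ip]

/-- The Gram matrix has no negative part, since its compressions are Gram matrices and hence have
non-negative diagonal. -/
lemma eq_zero_of_compression_gram (x : Fin N → E) (c d : CStarMatrix (Fin N) (Fin N) A)
    (hc : star c = c) (hd : star d = d) (hcd : c * gram A x * c = -(d * d)) : d = 0 := by
  ext l i
  have h1 : (ip (rowMul x c i) (rowMul x c i) : A) = -∑ l, star (d l i) * d l i := by
    rw [← gram_apply, gram_rowMul, hc, hcd]
    conv_lhs => rw [← hd]
    rw [hd, CStarMatrix.neg_apply, CStarMatrix.mul_apply]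
    congr 1
    refine Finset.sum_congr rfl fun l _ => ?_
    congr 1
    conv_lhs => rw [← hd]
    rfl
  have h2 : ∑ l, star (d l i) * d l i = 0 := by
    refine le_antisymm ?_ (Finset.sum_nonneg fun l _ => star_mul_self_nonneg _)
    have := ip_self_nonneg (A := A) (rowMul x c i)
    rwa [h1, Left.nonneg_neg_iff] at this
  have h3 := (Finset.sum_eq_zero_iff_of_nonneg fun l _ => star_mul_self_nonneg _).1 h2 l
    (Finset.mem_univ _)
  exact CStarRing.star_mul_self_eq_zero_iff _ |>.1 h3

/-- The row operator `(h_j) ↦ ∑ T(x_j) h_j` has norm at most that of the row `x`. -/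
lemma _root_.ProductSystem.CompletelyContractive.norm_sum_sq_le {T : E →ₗ[ℂ] (H →L[ℂ] H)}
    (hT : ProductSystem.CompletelyContractive (A := A) T) (x : Fin N → E) (h : Fin N → H) :
    ‖∑ j, T (x j) (h j)‖ ^ 2 ≤ ‖gram A x‖ * ∑ j, ‖h j‖ ^ 2 := by
  rcases N with _ | N
  · simp
  -- The row is viewed as the first row of a square matrix with zeros elsewhere.
  have := hT (N + 1) (fun i j => if i = 0 then x j else 0) h
  have e1 : (CStarMatrix.ofMatrix (Matrix.of fun i j => ∑ l : Fin (N + 1),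
      (ip (if l = 0 then x i else 0) (if l = 0 then x j else 0) : A))) = gram A x := by
    ext i j
    rw [gram_apply]
    change ∑ l : Fin (N + 1), (ip (if l = 0 then x i else 0) (if l = 0 then x j else 0) : A) = _
    rw [Finset.sum_eq_single 0 (fun l _ hl => by simp [hl]) (by simp)]
    simp
  rw [e1] at this
  refine le_trans ?_ this
  refine le_trans ?_ (Finset.single_le_sum (fun i _ => sq_nonneg _) (Finset.mem_univ 0))
  simp

/-- `σ_N(s) h` for a matrix `s` over `A` and `h ∈ H^N`. -/
def matAct (σ : A →⋆ₙₐ[ℂ] (H →L[ℂ] H)) (s : CStarMatrix (Fin N) (Fin N) A) (h : Fin N → H)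
    (i : Fin N) : H := ∑ j, σ (s i j) (h j)

variable {σ : A →⋆ₙₐ[ℂ] (H →L[ℂ] H)}

lemma matAct_mul (s t : CStarMatrix (Fin N) (Fin N) A) (h : Fin N → H) :
    matAct σ (s * t) h = matAct σ s (matAct σ t h) := by
  funext i
  simp only [matAct, CStarMatrix.mul_apply, map_sum, sum_apply, map_mul]
  rw [Finset.sum_comm]
  rfl

lemma sum_norm_sq_matAct (s : CStarMatrix (Fin N) (Fin N) A) (h : Fin N → H) :
    ((∑ i, ‖matAct σ s h i‖ ^ 2 : ℝ) : ℂ)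
      = ∑ i, inner ℂ (h i) (matAct σ (star s * s) h i) := by
  have h1 : ∀ i, ((‖matAct σ s h i‖ ^ 2 : ℝ) : ℂ)
      = ∑ j, inner ℂ (h j) (σ (star (s i j)) (matAct σ s h i)) := fun i => by
    rw [Complex.ofReal_pow, ← Complex.coe_algebraMap, ← inner_self_eq_norm_sq_to_K]
    conv_lhs =>
      enter [2]
      rw [matAct]
    rw [sum_inner]
    exact Finset.sum_congr rfl fun j _ => InteriorTensor.inner_rep σ _ _ _
  rw [Complex.ofReal_sum, Finset.sum_congr rfl fun i _ => h1 i, Finset.sum_comm]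
  refine Finset.sum_congr rfl fun i _ => ?_
  rw [matAct_mul, matAct, inner_sum]
  rfl

lemma sum_apply_rowMul {T : E →ₗ[ℂ] (H →L[ℂ] H)}
    (hr : ∀ (b : A) (x : E) (h : H), T (right b x) h = T x (σ b h))
    (x : Fin N → E) (b : CStarMatrix (Fin N) (Fin N) A) (h : Fin N → H) :
    ∑ j, T (rowMul x b j) (h j) = ∑ i, T (x i) (matAct σ b h i) := by
  have h1 : ∀ j, T (rowMul x b j) (h j) = ∑ i, T (x i) (σ (b i j) (h j)) := fun j => by
    rw [rowMul, map_sum, sum_apply]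
    exact Finset.sum_congr rfl fun i _ => hr _ _ _
  rw [Finset.sum_congr rfl fun j _ => h1 j, Finset.sum_comm]
  refine Finset.sum_congr rfl fun i _ => ?_
  rw [matAct, map_sum]

/-- The contractivity of `x ⊗ h ↦ T(x) h` for a completely contractive right covariant map `T`:
writing the Gram matrix of `x` as `s * s`, the row `x` is approximately `(x · f) · s` with `x · f`
of norm at most one, and `‖σ_N(s) h‖` is the norm of `∑ x_j ⊗ h_j`. -/
lemma _root_.ProductSystem.CompletelyContractive.norm_sum_le {T : E →ₗ[ℂ] (H →L[ℂ] H)}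
    (hT : ProductSystem.CompletelyContractive (A := A) T)
    (hr : ∀ (b : A) (x : E) (h : H), T (right b x) h = T x (σ b h))
    (x : Fin N → E) (h : Fin N → H) :
    ‖∑ j, T (x j) (h j)‖ ≤ ‖InteriorTensor.of E σ (∑ j, x j ⊗ₜ h j)‖ := by
  obtain ⟨s, hs, hss, hf⟩ := (isSelfAdjoint_gram (A := A) x).exists_approx_sqrt_factorization
    (eq_zero_of_compression_gram x)
  have hnorm : ‖InteriorTensor.of E σ (∑ j, x j ⊗ₜ h j)‖ ^ 2 = ∑ i, ‖matAct σ s h i‖ ^ 2 := by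
    rw [InteriorTensor.norm_sq_of, map_sum (InteriorTensor.form E σ), LinearMap.sum_apply]
    have h1 := sum_norm_sq_matAct (σ := σ) s h
    rw [hs, hss] at h1
    rw [← Complex.ofReal_re (∑ i, ‖matAct σ s h i‖ ^ 2), h1]
    congr 1
    refine Finset.sum_congr rfl fun i _ => ?_
    rw [map_sum, matAct, inner_sum]
    rfl
  set C := ∑ j, ‖h j‖ ^ 2 with hC
  have hC0 : 0 ≤ C := Finset.sum_nonneg fun j _ => sq_nonneg _
  have key : ∀ δ : ℝ, 0 < δ → ‖∑ j, T (x j) (h j)‖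
      ≤ ‖InteriorTensor.of E σ (∑ j, x j ⊗ₜ h j)‖ + δ * √C := by
    intro δ hδ
    obtain ⟨f, hfs, hfss, hf1, hf2⟩ := hf (δ ^ 2) (by positivity)
    -- `x = (x - x · (f s)) + (x · f) · s`, where the first row has norm at most `δ`.
    have hsplit : ∑ j, T (x j) (h j) = ∑ j, T ((x - rowMul x (f * s)) j) (h j)
        + ∑ j, T (rowMul x f j) (matAct σ s h j) := by
      rw [sum_apply_rowMul hr x f, ← matAct_mul, ← sum_apply_rowMul hr x (f * s),
        ← Finset.sum_add_distrib]
      refine Finset.sum_congr rfl fun j _ => ?_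
      rw [Pi.sub_apply, map_sub, sub_apply, sub_add_cancel]
    rw [hsplit, add_comm]
    refine (norm_add_le _ _).trans (add_le_add ?_ ?_)
    · refine le_of_sq_le_sq ?_ (norm_nonneg _)
      refine (hT.norm_sum_sq_le _ _).trans ?_
      rw [hnorm, gram_rowMul, hfs]
      exact mul_le_of_le_one_left (Finset.sum_nonneg fun _ _ => sq_nonneg _) hf1
    · refine le_of_sq_le_sq ?_ (by positivity)
      refine (hT.norm_sum_sq_le _ _).trans ?_
      rw [mul_pow, Real.sq_sqrt hC0, gram_sub_rowMul, hfss]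
      exact mul_le_mul_of_nonneg_right hf2 hC0
  refine le_of_forall_pos_le_add fun ε hε => ?_
  have hpos : 0 < √C + 1 := by positivity
  refine (key (ε / (√C + 1)) (by positivity)).trans ?_
  have : ε / (√C + 1) * √C ≤ ε := by
    rw [div_mul_eq_mul_div, div_le_iff₀ hpos]
    nlinarith [Real.sqrt_nonneg C]
  linarith

end CStarCorrespondence

/-! ### Boundedness and covariance of representations -/

namespace ProductSystem

open CStarCorrespondence InteriorTensor

variable {A : Type*} [NonUnitalCStarAlgebra A] [PartialOrder A] [StarOrderedRing A] {k : ℕ}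
  {H K : Type*} [NormedAddCommGroup H] [InnerProductSpace ℂ H] [CompleteSpace H]
  [NormedAddCommGroup K] [InnerProductSpace ℂ K] [CompleteSpace K]
  {P : ProductSystem A k} {l m n p q : Fin k → ℕ}

lemma eq_of_ip_eq {x y : P.fiber n} (h : ∀ z : P.fiber n, (ip x z : A) = ip y z) : x = y := by
  have h1 : (ip (x - y) (x - y) : A) = 0 := by
    rw [map_sub ip, LinearMap.sub_apply, h, sub_self]
  have h2 := norm_sq (A := A) (x - y)
  rwa [h1, norm_zero, sq_eq_zero_iff, norm_eq_zero, sub_eq_zero] at h2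

variable (P) in
/-- The left action of `A` on `E(0) = A` is left multiplication. -/
lemma left_unit (a b : A) : left a (P.unit b) = P.unit (a * b) := by
  have h : P.mul (zero_add 0) (P.unit a) (P.unit b) = right b (P.unit a) := P.mul_unit b _
  rw [← P.unit_mul, h]
  refine eq_of_ip_eq fun z => ?_
  obtain ⟨c, rfl⟩ := P.unit.surjective z
  rw [right_ip, P.ip_unit, P.ip_unit, star_mul, _root_.mul_assoc]

variable (P) in
/-- The right action of an element of `A`, as a bounded operator. -/
def rightL (n : Fin k → ℕ) (b : A) : P.fiber n →L[ℂ] P.fiber n :=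
  LinearMap.mkContinuous (right b) ‖b‖ fun x => by
    refine le_of_sq_le_sq ?_ (by positivity)
    rw [norm_sq (A := A), ip_right, right_ip, mul_pow, norm_sq (A := A) x]
    calc _ ≤ ‖star b‖ * ‖(ip x x : A)‖ * ‖b‖ :=
          (norm_mul_le _ _).trans (mul_le_mul_of_nonneg_right (norm_mul_le _ _) (norm_nonneg _))
      _ = _ := by rw [norm_star]; ring

lemma rightL_apply (b : A) (x : P.fiber n) : P.rightL n b x = right b x := rfl

lemma Nondegenerate.ext {σ : A →⋆ₙₐ[ℂ] (H →L[ℂ] H)} (hσ : Nondegenerate σ)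
    {X : Type*} [NormedAddCommGroup X] [NormedSpace ℂ X] {f g : H →L[ℂ] X}
    (hfg : ∀ a h, f (σ a h) = g (σ a h)) : f = g := by
  have : (⊤ : Submodule ℂ H) ≤ LinearMap.eqLocus f.toLinearMap g.toLinearMap := by
    rw [← hσ]
    refine Submodule.topologicalClosure_minimal _ ?_ (isClosed_eq f.continuous g.continuous)
    rw [Submodule.span_le]
    rintro _ ⟨a, h, rfl⟩
    exact hfg a h
  ext u
  exact this (Submodule.mem_top (x := u))

lemma Nondegenerate.ext_inner {σ : A →⋆ₙₐ[ℂ] (H →L[ℂ] H)} (hσ : Nondegenerate σ) {u v : H}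
    (huv : ∀ a, σ a u = σ a v) : u = v := by
  have : innerSL ℂ u = innerSL ℂ v := hσ.ext fun a h => by
    rw [innerSL_apply_apply, innerSL_apply_apply, ← star_star a, ← inner_rep, ← inner_rep, huv]
  refine ext_inner_right ℂ fun w => ?_
  have := DFunLike.congr_fun this w
  rwa [innerSL_apply_apply, innerSL_apply_apply] at this

namespace Tuple

variable {R : P.Tuple H}

namespace IsRepresentation

/-- `‖T⁽ⁱ⁾(x)‖ ≤ ‖x‖`. The norm of `⟨x, x⟩` as a `1 × 1` matrix is compared with its norm in `A`
by the contractivity of `*`-homomorphisms. -/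
lemma norm_T_le (hR : R.IsRepresentation) (i : Fin k) (x : P.fiber (e i)) (h : H) :
    ‖R.T i x h‖ ≤ ‖x‖ * ‖h‖ := by
  let φ : A →⋆ₙₐ[ℂ] CStarMatrix (Fin 1) (Fin 1) A :=
    { toFun := fun a => CStarMatrix.ofMatrix (Matrix.of fun _ _ => a)
      map_smul' := fun _ _ => rfl
      map_zero' := rfl
      map_add' := fun _ _ => rfl
      map_mul' := fun a b => by
        ext i j
        rw [CStarMatrix.mul_apply, Fin.sum_univ_one]
        rfl
      map_star' := fun _ => rfl }
  have h1 := (hR.completelyContractive i).norm_sum_sq_le (fun _ : Fin 1 => x) fun _ => h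
  have h2 : gram A (fun _ : Fin 1 => x) = φ (ip x x) := rfl
  have h3 : ‖φ (ip x x)‖ ≤ ‖(ip x x : A)‖ := NonUnitalStarAlgHom.norm_apply_le φ _
  rw [h2] at h1
  refine le_of_sq_le_sq ?_ (by positivity)
  rw [mul_pow, norm_sq (A := A) x]
  simp only [Finset.univ_unique, Finset.sum_singleton] at h1
  exact h1.trans (mul_le_mul_of_nonneg_right h3 (sq_nonneg _))

end IsRepresentation

/-- The bounded linear map `x ↦ T⁽ⁱ⁾(x) h`. -/
def applyL (hR : R.IsRepresentation) (i : Fin k) (h : H) : P.fiber (e i) →L[ℂ] H :=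
  LinearMap.mkContinuous ((ContinuousLinearMap.coeLM ℂ ∘ₗ R.T i : _ →ₗ[ℂ] H →ₗ[ℂ] H).flip h) ‖h‖
    fun x => by
      rw [mul_comm]
      exact hR.norm_T_le i x h

lemma applyL_apply (hR : R.IsRepresentation) (i : Fin k) (h : H) (x : P.fiber (e i)) :
    applyL hR i h x = R.T i x h := rfl

/-- Bounded linear maps on `E(n)` which agree on all `a · x · b` are equal. -/
lemma clm_ext_left_right {X : Type*} [NormedAddCommGroup X] [NormedSpace ℂ X]
    {f g : P.fiber n →L[ℂ] X}
    (hfg : ∀ (a b : A) x, f (left a (right b x)) = g (left a (right b x))) : f = g := by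
  refine P.clm_ext_mul (add_zero n) fun x y => ?_
  obtain ⟨b, rfl⟩ := P.unit.surjective y
  rw [P.mul_unit]
  have : f ∘L P.rightL n b = g ∘L P.rightL n b := P.clm_ext_mul (zero_add n) fun y x => by
    obtain ⟨a, rfl⟩ := P.unit.surjective y
    rw [P.unit_mul, ContinuousLinearMap.comp_apply, ContinuousLinearMap.comp_apply, rightL_apply,
      ← left_right, hfg]
  exact DFunLike.congr_fun this x

namespace IsRepresentation

/-- Covariance on the right alone: the defining relation `T⁽ⁱ⁾(a x b) = σ(a) T⁽ⁱ⁾(x) σ(b)` gives it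
on the dense set of all `a · x · b`. -/
lemma T_right (hR : R.IsRepresentation) (i : Fin k) (b : A) (x : P.fiber (e i)) (h : H) :
    R.T i (right b x) h = R.T i x (R.σ b h) := by
  have : applyL hR i h ∘L P.rightL (e i) b = applyL hR i (R.σ b h) :=
    clm_ext_left_right fun a c y => by
      rw [ContinuousLinearMap.comp_apply, rightL_apply, applyL_apply, applyL_apply, ← left_right,
        ← right_mul, hR.covariant, hR.covariant, map_mul]
      rfl
  exact DFunLike.congr_fun this x

lemma T_left (hR : R.IsRepresentation) (i : Fin k) (a : A) (x : P.fiber (e i)) (h : H) :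
    R.T i (left a x) h = R.σ a (R.T i x h) := by
  have : R.T i (left a x) = R.σ a * R.T i x := hR.nondegenerate.ext fun b g => by
    rw [← hR.T_right, ← left_right, hR.covariant]
    rfl
  rw [this]
  rfl

/-- Complete contractivity makes `x ⊗ h ↦ T⁽ⁱ⁾(x) h` a contraction, so that `T̃⁽ⁱ⁾` is its genuine
extension and not a junk value. -/
lemma norm_lift_T_le (hR : R.IsRepresentation) (i : Fin k) (z : P.fiber (e i) ⊗[ℂ] H) :
    ‖TensorProduct.lift (ContinuousLinearMap.coeLM ℂ ∘ₗ R.T i) z‖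
      ≤ 1 * ‖of (P.fiber (e i)) R.σ z‖ := by
  obtain ⟨n, x, h, rfl⟩ : ∃ (n : ℕ) (x : Fin n → P.fiber (e i)) (h : Fin n → H),
      z = ∑ j, x j ⊗ₜ[ℂ] h j := by
    obtain ⟨S, hS⟩ := TensorProduct.exists_finset z
    refine ⟨S.card, fun j => (S.equivFin.symm j).1.1, fun j => (S.equivFin.symm j).1.2, ?_⟩
    rw [hS, ← Finset.sum_coe_sort S, ← S.equivFin.symm.sum_comp]
  rw [one_mul, map_sum]
  exact (hR.completelyContractive i).norm_sum_le (fun b x h => hR.T_right i b x h) x h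

lemma tildeE_tmul (hR : R.IsRepresentation) (i : Fin k) (x : P.fiber (e i)) (h : H) :
    R.tildeE i (of _ R.σ (x ⊗ₜ h)) = R.T i x h :=
  LinearMap.extendOfNorm_eq (denseRange_of _) ⟨1, hR.norm_lift_T_le i⟩ _

lemma tildeE_leftRep (hR : R.IsRepresentation) (i : Fin k) (a : A)
    (u : InteriorTensor (P.fiber (e i)) R.σ) :
    R.tildeE i (leftRep _ R.σ a u) = R.σ a (R.tildeE i u) := by
  have : R.tildeE i ∘L leftRep _ R.σ a = R.σ a ∘L R.tildeE i := clm_ext fun x h => by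
    rw [ContinuousLinearMap.comp_apply, ContinuousLinearMap.comp_apply, leftRep_tmul,
      hR.tildeE_tmul, hR.tildeE_tmul, hR.T_left]
  exact DFunLike.congr_fun this u

end IsRepresentation

section tildeWord

variable (R) in
/-- `a ⊗ h ↦ σ(a) h` is isometric. -/
lemma inner_lift_σ_unit (z w : P.fiber 0 ⊗[ℂ] H) :
    inner ℂ (TensorProduct.lift (ContinuousLinearMap.coeLM ℂ ∘ₗ (R.σ : A →ₗ[ℂ] (H →L[ℂ] H))
      ∘ₗ (P.unit.symm : P.fiber 0 →ₗ[ℂ] A)) z)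
      (TensorProduct.lift (ContinuousLinearMap.coeLM ℂ ∘ₗ (R.σ : A →ₗ[ℂ] (H →L[ℂ] H))
      ∘ₗ (P.unit.symm : P.fiber 0 →ₗ[ℂ] A)) w) = form _ R.σ z w := by
  induction z with
  | zero => simp
  | add z₁ z₂ h₁ h₂ => simp only [map_add, inner_add_left, LinearMap.add_apply, h₁, h₂]
  | tmul x g =>
    induction w with
    | zero => simp
    | add w₁ w₂ h₁ h₂ => simp only [map_add, inner_add_right, h₁, h₂]
    | tmul y f =>
      obtain ⟨a, rfl⟩ := P.unit.surjective x
      obtain ⟨b, rfl⟩ := P.unit.surjective y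
      rw [form_tmul, P.ip_unit, map_mul, TensorProduct.lift.tmul, TensorProduct.lift.tmul]
      simp [inner_rep]

/-- `T̃` of the empty word is `a ⊗ h ↦ σ(a) h`. -/
lemma tildeWord_nil_tmul (h : deg [] = n) (h0 : n = 0) (a : A) (g : H) :
    R.tildeWord [] h (of _ R.σ ((h0 ▸ P.unit a : P.fiber n) ⊗ₜ g)) = R.σ a g := by
  subst h0
  have := LinearMap.extendOfNorm_eq (denseRange_of (E := P.fiber 0) R.σ)
    (f := TensorProduct.lift (ContinuousLinearMap.coeLM ℂ ∘ₗ (R.σ : A →ₗ[ℂ] (H →L[ℂ] H))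
      ∘ₗ (P.unit.symm : P.fiber 0 →ₗ[ℂ] A))) ⟨1, fun z => by
        rw [one_mul, @norm_eq_sqrt_re_inner ℂ, inner_lift_σ_unit, @norm_eq_sqrt_re_inner ℂ,
          inner_of]⟩ (P.unit a ⊗ₜ g)
  refine this.trans ?_
  simp

/-- The recursive description of `T̃` of a word, assuming that the operator of the shorter word
intertwines the left actions (which the definition of `I ⊗ ·` requires). -/
lemma tildeWord_cons_create_of (i : Fin k) (w : List (Fin k)) (h : deg (i :: w) = p)
    (h' : deg w = n) (hp : e i + n = p) (hR : R.IsRepresentation)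
    (hw : ∀ a u, R.tildeWord w h' (leftRep _ R.σ a u) = R.σ a (R.tildeWord w h' u))
    (x : P.fiber (e i)) (z : InteriorTensor (P.fiber n) R.σ) :
    R.tildeWord (i :: w) h (P.create R.σ hp x z) = R.T i x (R.tildeWord w h' z) := by
  subst h'
  change R.tildeE i (idTensor _ _ _ (R.tildeWord w rfl) ((P.assoc R.σ hp).adjoint _)) = _
  rw [assoc_adjoint_create, idTensor_tmul hw, hR.tildeE_tmul]

namespace IsRepresentation

lemma tildeWord_leftRep (hR : R.IsRepresentation) (w : List (Fin k)) (h : deg w = n) (a : A)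
    (u : InteriorTensor (P.fiber n) R.σ) :
    R.tildeWord w h (leftRep _ R.σ a u) = R.σ a (R.tildeWord w h u) := by
  suffices h : R.tildeWord w h ∘L leftRep _ R.σ a = R.σ a ∘L R.tildeWord w h from
    DFunLike.congr_fun h u
  clear u
  induction w generalizing n a with
  | nil =>
    have h0 : n = 0 := h.symm
    subst h0
    refine clm_ext fun x g => ?_
    obtain ⟨b, rfl⟩ := P.unit.surjective x
    have h1 := tildeWord_nil_tmul (R := R) h rfl b g
    have h2 := tildeWord_nil_tmul (R := R) h rfl (a * b) g
    rw [ContinuousLinearMap.comp_apply, ContinuousLinearMap.comp_apply, leftRep_tmul,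
      P.left_unit]
    exact h2.trans (by rw [map_mul]; exact congrArg _ h1.symm)
  | cons i w ih =>
    have hp : e i + deg w = n := h
    refine P.clm_ext_create hp fun x z => ?_
    have hw : ∀ a u, R.tildeWord w rfl (leftRep _ R.σ a u) = R.σ a (R.tildeWord w rfl u) :=
      fun a u => DFunLike.congr_fun (ih rfl a) u
    rw [ContinuousLinearMap.comp_apply, ContinuousLinearMap.comp_apply, leftRep_create,
      tildeWord_cons_create_of i w h rfl hp hR hw, tildeWord_cons_create_of i w h rfl hp hR hw,
      hR.T_left]

lemma tildeWord_cons_create (hR : R.IsRepresentation) (i : Fin k) (w : List (Fin k))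
    (h : deg (i :: w) = p) (h' : deg w = n) (hp : e i + n = p) (x : P.fiber (e i))
    (z : InteriorTensor (P.fiber n) R.σ) :
    R.tildeWord (i :: w) h (P.create R.σ hp x z) = R.T i x (R.tildeWord w h' z) :=
  tildeWord_cons_create_of i w h h' hp hR (hR.tildeWord_leftRep w h') x z

end IsRepresentation

end tildeWord

end Tuple
end ProductSystem

/-! ### The operators of higher degree -/

namespace ProductSystem

open CStarCorrespondence InteriorTensor

variable {A : Type*} [NonUnitalCStarAlgebra A] [PartialOrder A] [StarOrderedRing A] {k : ℕ}
  {H K : Type*} [NormedAddCommGroup H] [InnerProductSpace ℂ H] [CompleteSpace H]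
  [NormedAddCommGroup K] [InnerProductSpace ℂ K] [CompleteSpace K]
  {P : ProductSystem A k} {l m n p q : Fin k → ℕ}

/-- Induction on `ℕ^k` by adding basis elements. -/
lemma multiindex_induction {motive : (Fin k → ℕ) → Prop} (zero : motive 0)
    (add : ∀ i n, motive n → motive (e i + n)) (n : Fin k → ℕ) : motive n := by
  have : ∀ w : List (Fin k), motive (Tuple.deg w) := fun w => by
    induction w with
    | nil => exact zero
    | cons i w ih => exact add i _ ih
  rw [← Tuple.deg_word n]
  exact this _

namespace Tuple

lemma deg_cons (i : Fin k) (w : List (Fin k)) : deg (i :: w) = e i + deg w := rfl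

variable {R : P.Tuple H}

namespace IsRepresentation

lemma idTilde_create (hR : R.IsRepresentation) (i j : Fin k) (h : e i + e j = p)
    (x : P.fiber (e i)) (u : InteriorTensor (P.fiber (e j)) R.σ) :
    R.idTilde i j ((P.assoc R.σ h).adjoint (P.create R.σ h x u))
      = of _ R.σ (x ⊗ₜ R.tildeE j u) := by
  rw [assoc_adjoint_create, idTilde, idTensor_tmul (hR.tildeE_leftRep j)]

/-- The products `T⁽ⁱ⁾(x) T⁽ʲ⁾(y)` and `T⁽ʲ⁾(y) T⁽ⁱ⁾(x)` are the values of one and the same map at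
`x y`, respectively `y x`, in `E(e_i + e_j)`. -/
lemma exists_common_extension (hR : R.IsRepresentation) (i j : Fin k) :
    ∃ S : InteriorTensor (P.fiber (e i + e j)) R.σ →L[ℂ] H,
      (∀ x y h, S (of _ R.σ (P.mul rfl x y ⊗ₜ h)) = R.T i x (R.T j y h)) ∧
      ∀ x y h, S (of _ R.σ (P.mul (add_comm _ _) y x ⊗ₜ h)) = R.T j y (R.T i x h) := by
  have h1 : R.tildeE i ∘L R.idTilde i j ∘L (P.assoc R.σ rfl).adjoint
      = R.tildeE j ∘L R.idTilde j i ∘L (P.assoc R.σ (add_comm (e j) (e i))).adjoint := by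
    rw [← ContinuousLinearMap.comp_assoc, hR.commute, flip, ContinuousLinearMap.comp_assoc,
      ContinuousLinearMap.comp_assoc, ContinuousLinearMap.comp_assoc, assoc_assoc_adjoint]
    rfl
  refine ⟨R.tildeE i ∘L R.idTilde i j ∘L (P.assoc R.σ rfl).adjoint, fun x y h => ?_,
    fun x y h => ?_⟩
  · rw [← create_tmul, ContinuousLinearMap.comp_apply, ContinuousLinearMap.comp_apply,
      hR.idTilde_create, hR.tildeE_tmul, hR.tildeE_tmul]
  · rw [h1, ← create_tmul, ContinuousLinearMap.comp_apply, ContinuousLinearMap.comp_apply,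
      hR.idTilde_create, hR.tildeE_tmul, hR.tildeE_tmul]

/-- Two letters at the beginning of a word may be exchanged, by the commutation relation. -/
lemma tildeWord_swap (hR : R.IsRepresentation) (i j : Fin k) (w : List (Fin k))
    (h : deg (i :: j :: w) = n) (h' : deg (j :: i :: w) = n) :
    R.tildeWord (i :: j :: w) h = R.tildeWord (j :: i :: w) h' := by
  obtain ⟨S, hS1, hS2⟩ := hR.exists_common_extension i j
  have h1 : e i + (e j + deg w) = n := h
  have h2 : e j + (e i + deg w) = n := h'
  have h3 : e i + e j + deg w = n := by rw [add_assoc, h1]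
  have key1 : ∀ ξ z, R.tildeWord (i :: j :: w) h (P.create R.σ h3 ξ z)
      = S (of _ R.σ (ξ ⊗ₜ R.tildeWord w rfl z)) := fun ξ z => by
    have : R.tildeWord (i :: j :: w) h ∘L P.createAt h3 z
        = S ∘L tmulAt _ R.σ (R.tildeWord w rfl z) := P.clm_ext_mul rfl fun x y => by
      rw [ContinuousLinearMap.comp_apply, ContinuousLinearMap.comp_apply, createAt_apply,
        tmulAt_apply, hS1, P.create_mul rfl h3 rfl h1,
        hR.tildeWord_cons_create i _ h (deg_cons j w),
        hR.tildeWord_cons_create j _ (deg_cons j w) rfl]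
    exact DFunLike.congr_fun this ξ
  have key2 : ∀ ξ z, R.tildeWord (j :: i :: w) h' (P.create R.σ h3 ξ z)
      = S (of _ R.σ (ξ ⊗ₜ R.tildeWord w rfl z)) := fun ξ z => by
    have : R.tildeWord (j :: i :: w) h' ∘L P.createAt h3 z
        = S ∘L tmulAt _ R.σ (R.tildeWord w rfl z) :=
      P.clm_ext_mul (add_comm (e j) (e i)) fun y x => by
        rw [ContinuousLinearMap.comp_apply, ContinuousLinearMap.comp_apply, createAt_apply,
          tmulAt_apply, hS2, P.create_mul (add_comm (e j) (e i)) h3 rfl h2,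
          hR.tildeWord_cons_create j _ h' (deg_cons i w),
          hR.tildeWord_cons_create i _ (deg_cons i w) rfl]
    exact DFunLike.congr_fun this ξ
  exact P.clm_ext_create h3 fun ξ z => by rw [key1, key2]

/-- `T̃` of a word depends only on the number of occurrences of each letter. -/
lemma tildeWord_perm (hR : R.IsRepresentation) {v w : List (Fin k)} (hp : v.Perm w)
    (hv : deg v = n) (hw : deg w = n) : R.tildeWord v hv = R.tildeWord w hw := by
  induction hp generalizing n with
  | nil => rfl
  | cons i hvw ih =>
    rename_i v w
    have hdeg : deg v = deg w := funext fun j => by rw [deg_apply, deg_apply, hvw.count_eq]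
    have h1 : e i + deg v = n := hv
    refine P.clm_ext_create h1 fun x z => ?_
    rw [hR.tildeWord_cons_create i v hv rfl, hR.tildeWord_cons_create i w hw hdeg.symm,
      ih rfl hdeg.symm]
  | swap i j w => exact hR.tildeWord_swap j i w hv hw
  | trans h1 h2 ih1 ih2 =>
    rename_i u v w
    have hdeg : deg v = n := by
      rw [← hv]
      exact funext fun j => by rw [deg_apply, deg_apply, h1.count_eq]
    exact (ih1 hv hdeg).trans (ih2 hdeg hw)

lemma tildeWord_eq_tilde (hR : R.IsRepresentation) (w : List (Fin k)) (h : deg w = n) :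
    R.tildeWord w h = R.tilde n := by
  refine hR.tildeWord_perm ?_ h (deg_word n)
  rw [List.perm_iff_count]
  intro i
  rw [← deg_apply, ← deg_apply, h, deg_word]

lemma tilde_leftRep (hR : R.IsRepresentation) (n : Fin k → ℕ) (a : A)
    (u : InteriorTensor (P.fiber n) R.σ) :
    R.tilde n (leftRep _ R.σ a u) = R.σ a (R.tilde n u) :=
  hR.tildeWord_leftRep _ _ a u

lemma tilde_zero_tmul (hR : R.IsRepresentation) (a : A) (h : H) :
    R.tilde 0 (of _ R.σ (P.unit a ⊗ₜ h)) = R.σ a h := by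
  have h0 := hR.tildeWord_eq_tilde (n := 0) [] rfl
  rw [← h0]
  exact tildeWord_nil_tmul rfl rfl a h

lemma tilde_add_create (hR : R.IsRepresentation) (i : Fin k) (h : e i + n = p)
    (x : P.fiber (e i)) (z : InteriorTensor (P.fiber n) R.σ) :
    R.tilde p (P.create R.σ h x z) = R.T i x (R.tilde n z) := by
  have h1 : deg (i :: word n) = p := by rw [deg, deg_word, h]
  rw [← hR.tildeWord_eq_tilde (i :: word n) h1,
    hR.tildeWord_cons_create i (word n) h1 (deg_word n)]
  rfl

end IsRepresentation

variable (R) in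
/-- The operator `T(x) h = T̃(n)(x ⊗ h)` for `x ∈ E(n)`. -/
def op (n : Fin k → ℕ) (x : P.fiber n) : H →L[ℂ] H := R.tilde n ∘L ket _ R.σ x

variable (R) in
lemma op_apply (x : P.fiber n) (h : H) : R.op n x h = R.tilde n (of _ R.σ (x ⊗ₜ h)) := rfl

namespace IsRepresentation

/-- `T̃(m + n)(x y ⊗ h) = T(x) T̃(n)(y ⊗ h)`. -/
lemma tilde_create (hR : R.IsRepresentation) (h : m + n = p) (x : P.fiber m)
    (z : InteriorTensor (P.fiber n) R.σ) :
    R.tilde p (P.create R.σ h x z) = R.op m x (R.tilde n z) := by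
  suffices R.tilde p ∘L P.createAt h z = R.tilde m ∘L tmulAt _ R.σ (R.tilde n z) from
    DFunLike.congr_fun this x
  clear x
  induction m using multiindex_induction generalizing p with
  | zero =>
    obtain rfl : n = p := by rw [← h, zero_add]
    ext x
    obtain ⟨a, rfl⟩ := P.unit.surjective x
    rw [ContinuousLinearMap.comp_apply, ContinuousLinearMap.comp_apply, createAt_apply,
      tmulAt_apply, hR.tilde_zero_tmul, create_unit, hR.tilde_leftRep]
  | add i m ih =>
    refine P.clm_ext_mul rfl fun x y => ?_
    have h1 : e i + (m + n) = p := by rw [← h, add_assoc]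
    have h2 := DFunLike.congr_fun (ih rfl) y
    rw [ContinuousLinearMap.comp_apply, ContinuousLinearMap.comp_apply, createAt_apply,
      tmulAt_apply] at h2 ⊢
    rw [P.create_mul rfl h rfl h1, hR.tilde_add_create i, ← create_tmul, hR.tilde_add_create i, h2]

lemma op_mul (hR : R.IsRepresentation) (h : m + n = p) (x : P.fiber m) (y : P.fiber n) :
    R.op p (P.mul h x y) = R.op m x ∘L R.op n y := by
  ext g
  rw [op_apply, ← create_tmul, hR.tilde_create]
  rfl

lemma op_unit (hR : R.IsRepresentation) (a : A) : R.op 0 (P.unit a) = R.σ a := by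
  ext g
  rw [op_apply, hR.tilde_zero_tmul]

/-- In degree `e_i`, the operators are those of the tuple; nondegeneracy of `σ` is needed because
the word of `e_i` also involves a factor from `E(0) = A`. -/
lemma op_single (hR : R.IsRepresentation) (i : Fin k) (x : P.fiber (e i)) :
    R.op (e i) x = R.T i x := by
  refine hR.nondegenerate.ext fun a g => ?_
  rw [op_apply, ← create_zero_tmul, hR.tilde_add_create, hR.tilde_zero_tmul]

lemma tilde_single (hR : R.IsRepresentation) (i : Fin k) : R.tilde (e i) = R.tildeE i :=
  clm_ext fun x h => by rw [← op_apply, hR.op_single, hR.tildeE_tmul]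

lemma op_left (hR : R.IsRepresentation) (a : A) (x : P.fiber n) :
    R.op n (left a x) = R.σ a ∘L R.op n x := by
  rw [← P.unit_mul, hR.op_mul, hR.op_unit]

/-- `T̃(0)` is an isometry. -/
lemma tilde_zero_adjoint_comp (hR : R.IsRepresentation) :
    (R.tilde 0).adjoint ∘L R.tilde 0 = 1 :=
  clm_ext fun x h => ext_inner_tmul fun y g => by
    obtain ⟨a, rfl⟩ := P.unit.surjective x
    obtain ⟨b, rfl⟩ := P.unit.surjective y
    rw [ContinuousLinearMap.comp_apply, ContinuousLinearMap.adjoint_inner_right,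
      hR.tilde_zero_tmul, hR.tilde_zero_tmul, one_apply_eq_self, inner_of_tmul,
      P.ip_unit, inner_rep, map_mul]
    rfl

/-- For an isometric representation, `Ṽ(n)` is an isometry. -/
lemma inner_tilde (hR : R.IsRepresentation) (hi : R.IsIsometric)
    (u v : InteriorTensor (P.fiber n) R.σ) :
    inner ℂ (R.tilde n u) (R.tilde n v) = inner ℂ u v := by
  suffices (R.tilde n).adjoint ∘L R.tilde n = 1 by
    rw [← ContinuousLinearMap.adjoint_inner_right, ← ContinuousLinearMap.comp_apply, this]
    rfl
  clear u v
  induction n using multiindex_induction with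
  | zero => exact hR.tilde_zero_adjoint_comp
  | add i n ih =>
    refine P.clm_ext_create rfl fun x z => P.ext_inner_create rfl fun y w => ?_
    rw [ContinuousLinearMap.comp_apply, ContinuousLinearMap.adjoint_inner_right,
      hR.tilde_add_create i, hR.tilde_add_create i, ← ContinuousLinearMap.adjoint_inner_right,
      ← ContinuousLinearMap.comp_apply, hi, ← hR.tilde_leftRep,
      ← ContinuousLinearMap.adjoint_inner_right, ← ContinuousLinearMap.comp_apply, ih,
      one_apply_eq_self, one_apply_eq_self, inner_create]

lemma norm_tilde (hR : R.IsRepresentation) (hi : R.IsIsometric)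
    (u : InteriorTensor (P.fiber n) R.σ) : ‖R.tilde n u‖ = ‖u‖ := by
  rw [@norm_eq_sqrt_re_inner ℂ, hR.inner_tilde hi, ← @norm_eq_sqrt_re_inner ℂ]

lemma inner_op (hR : R.IsRepresentation) (hi : R.IsIsometric) (x y : P.fiber n) (g h : H) :
    inner ℂ (R.op n x g) (R.op n y h) = inner ℂ g (R.σ (ip x y) h) := by
  rw [op_apply, op_apply, hR.inner_tilde hi, inner_of_tmul]

end IsRepresentation

end Tuple
end ProductSystem

/-! ### Double commutation in higher degrees -/

namespace ProductSystem

open CStarCorrespondence InteriorTensor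

variable {A : Type*} [NonUnitalCStarAlgebra A] [PartialOrder A] [StarOrderedRing A] {k : ℕ}
  {H K : Type*} [NormedAddCommGroup H] [InnerProductSpace ℂ H] [CompleteSpace H]
  [NormedAddCommGroup K] [InnerProductSpace ℂ K] [CompleteSpace K]
  {P : ProductSystem A k} {l m n p q r : Fin k → ℕ}

namespace Tuple

variable {R : P.Tuple H}

variable (R) in
/-- The operator `I ⊗ T̃(m) : E(p + m) ⊗_σ H → E(p) ⊗_σ H`, `x y ⊗ h ↦ x ⊗ T̃(m)(y ⊗ h)`. -/
def lower (h : p + m = q) : InteriorTensor (P.fiber q) R.σ →L[ℂ] InteriorTensor (P.fiber p) R.σ :=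
  idTensor (P.fiber p) _ _ (R.tilde m) ∘L (P.assoc R.σ h).adjoint

namespace IsRepresentation

lemma lower_create (hR : R.IsRepresentation) (h : p + m = q) (x : P.fiber p)
    (z : InteriorTensor (P.fiber m) R.σ) :
    R.lower h (P.create R.σ h x z) = of _ R.σ (x ⊗ₜ R.tilde m z) := by
  rw [lower, ContinuousLinearMap.comp_apply, assoc_adjoint_create,
    idTensor_tmul (hR.tilde_leftRep m)]

/-- `T̃(p + m) = T̃(p) (I ⊗ T̃(m))`. -/
lemma tilde_lower (hR : R.IsRepresentation) (h : p + m = q)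
    (u : InteriorTensor (P.fiber q) R.σ) : R.tilde p (R.lower h u) = R.tilde q u := by
  have : R.tilde p ∘L R.lower h = R.tilde q := P.clm_ext_create h fun x z => by
    rw [ContinuousLinearMap.comp_apply, hR.lower_create, hR.tilde_create]
    rfl
  exact DFunLike.congr_fun this u

lemma lower_leftRep (hR : R.IsRepresentation) (h : p + m = q) (a : A)
    (u : InteriorTensor (P.fiber q) R.σ) :
    R.lower h (leftRep _ R.σ a u) = leftRep _ R.σ a (R.lower h u) := by
  have : R.lower h ∘L leftRep _ R.σ a = leftRep _ R.σ a ∘L R.lower h :=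
    P.clm_ext_create h fun x z => by
      rw [ContinuousLinearMap.comp_apply, ContinuousLinearMap.comp_apply, leftRep_create,
        hR.lower_create, hR.lower_create, leftRep_tmul]
  exact DFunLike.congr_fun this u

/-- `I ⊗ T̃(m)` commutes with creation operators from the left. -/
lemma lower_create_left (hR : R.IsRepresentation) {p' q' : Fin k → ℕ} (h : p + m = q)
    (h₁ : l + p = p') (h₂ : l + q = q') (h₃ : p' + m = q') (x : P.fiber l)
    (u : InteriorTensor (P.fiber q) R.σ) :
    R.lower h₃ (P.create R.σ h₂ x u) = P.create R.σ h₁ x (R.lower h u) := by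
  have : R.lower h₃ ∘L P.create R.σ h₂ x = P.create R.σ h₁ x ∘L R.lower h :=
    P.clm_ext_create h fun y z => by
      rw [ContinuousLinearMap.comp_apply, ContinuousLinearMap.comp_apply, hR.lower_create,
        ← P.create_mul h₁ h₃, hR.lower_create, create_tmul]
  exact DFunLike.congr_fun this u

/-- The adjoint of `I ⊗ T̃(m)` also commutes with creation operators from the left. -/
lemma lower_adjoint_create_left (hR : R.IsRepresentation) {p' q' : Fin k → ℕ} (h : p + m = q)
    (h₁ : l + p = p') (h₂ : l + q = q') (h₃ : p' + m = q') (x : P.fiber l)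
    (v : InteriorTensor (P.fiber p) R.σ) :
    (R.lower h₃).adjoint (P.create R.σ h₁ x v) = P.create R.σ h₂ x ((R.lower h).adjoint v) := by
  refine P.ext_inner_create h₂ fun y z => ?_
  rw [ContinuousLinearMap.adjoint_inner_right, hR.lower_create_left h h₁ h₂ h₃, inner_create,
    inner_create, ← adjoint_intertwines (hR.lower_leftRep h),
    ContinuousLinearMap.adjoint_inner_right]

lemma lower_adjoint_tmul (hR : R.IsRepresentation) (h : p + m = q) (x : P.fiber p) (g : H) :
    (R.lower h).adjoint (of _ R.σ (x ⊗ₜ g)) = P.create R.σ h x ((R.tilde m).adjoint g) := by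
  refine P.ext_inner_create h fun y z => ?_
  rw [ContinuousLinearMap.adjoint_inner_right, hR.lower_create, inner_create, inner_of_tmul,
    ← adjoint_intertwines (hR.tilde_leftRep m), ContinuousLinearMap.adjoint_inner_right]

lemma lower_lower (hR : R.IsRepresentation) {m' m'' : Fin k → ℕ} (h : p + m = q)
    (h' : q + m' = r) (h'' : p + m'' = r) (hm : m + m' = m'')
    (u : InteriorTensor (P.fiber r) R.σ) : R.lower h (R.lower h' u) = R.lower h'' u := by
  have : R.lower h ∘L R.lower h' = R.lower h'' := P.clm_ext_create h'' fun x z => by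
    rw [ContinuousLinearMap.comp_apply, hR.lower_create_left hm h h'' h', hR.lower_create,
      hR.lower_create, hR.tilde_lower]
  exact DFunLike.congr_fun this u

lemma lower_add_zero (hR : R.IsRepresentation) : R.lower (add_zero p) = 1 :=
  clm_ext fun x h => by
    have h1 : R.lower (add_zero p) ∘L ket _ R.σ x = ket _ R.σ x :=
      hR.nondegenerate.ext fun a g => by
        rw [ContinuousLinearMap.comp_apply, ket_apply, ← create_zero_tmul, hR.lower_create,
          hR.tilde_zero_tmul, create_zero_tmul]
    exact DFunLike.congr_fun h1 h

end IsRepresentation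

/-- The defining relation of double commutation in terms of the operators `lower`. -/
lemma IsDoublyCommuting.adjoint_comp_single (hdc : R.IsDoublyCommuting)
    (hR : R.IsRepresentation) {i j : Fin k} (hij : i ≠ j) (h₁ : e i + e j = q)
    (h₂ : e j + e i = q) :
    (R.tilde (e i)).adjoint ∘L R.tilde (e j) = R.lower h₁ ∘L (R.lower h₂).adjoint := by
  subst h₂
  rw [hR.tilde_single, hR.tilde_single, hdc j i hij.symm]
  have h1 : (R.lower (rfl : e j + e i = _)).adjoint
      = P.assoc R.σ rfl ∘L idTensor (P.fiber (e j)) _ _ (R.tildeE i).adjoint := by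
    rw [lower, ContinuousLinearMap.adjoint_comp, ContinuousLinearMap.adjoint_adjoint,
      idTensor_adjoint (hR.tilde_leftRep (e i)), hR.tilde_single]
  rw [h1, lower, hR.tilde_single, flip]
  rfl

/-- Double commutation of `T̃⁽ⁱ⁾` with `T̃(m)` when the `i`-th component of `m` is zero:
`T̃⁽ⁱ⁾* T̃(m) = (I ⊗ T̃(m)) (t ⊗ I) (I ⊗ T̃⁽ⁱ⁾*)`. -/
lemma IsDoublyCommuting.adjoint_comp_tilde (hdc : R.IsDoublyCommuting)
    (hR : R.IsRepresentation) (i : Fin k) (hm : m i = 0) (h₁ : e i + m = q) (h₂ : m + e i = q) :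
    (R.tilde (e i)).adjoint ∘L R.tilde m = R.lower h₁ ∘L (R.lower h₂).adjoint := by
  induction m using multiindex_induction generalizing q with
  | zero =>
    obtain rfl : e i = q := by rw [← h₁, add_zero]
    rw [hR.lower_add_zero]
    refine clm_ext fun x h => ?_
    obtain ⟨a, rfl⟩ := P.unit.surjective x
    rw [ContinuousLinearMap.comp_apply, hR.tilde_zero_tmul, ContinuousLinearMap.comp_apply,
      hR.lower_adjoint_tmul, create_unit, adjoint_intertwines (hR.tilde_leftRep (e i))]
    rfl
  | add j m ih =>
    have hj : j ≠ i := by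
      rintro rfl
      simp at hm
    have hm' : m i = 0 := by
      simp only [Pi.add_apply] at hm
      omega
    refine P.clm_ext_create rfl fun y z => ?_
    have hji : e i + e j + m = q := by rw [add_assoc, h₁]
    have hjmi : e j + (m + e i) = q := by rw [← add_assoc, h₂]
    have ih' := DFunLike.congr_fun (ih hm' (add_comm (e i) m) rfl) z
    rw [ContinuousLinearMap.comp_apply, ContinuousLinearMap.comp_apply] at ih'
    have h3 := DFunLike.congr_fun
      (hdc.adjoint_comp_single hR hj.symm rfl (add_comm (e j) (e i))) (of _ R.σ (y ⊗ₜ R.tilde m z))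
    rw [ContinuousLinearMap.comp_apply, ContinuousLinearMap.comp_apply, hR.lower_adjoint_tmul,
      ih', ← op_apply, hR.op_single] at h3
    rw [ContinuousLinearMap.comp_apply, ContinuousLinearMap.comp_apply, hR.tilde_add_create, h3,
      ← hR.lower_create_left (add_comm (e i) m) (add_comm (e j) (e i)) hjmi hji,
      hR.lower_lower _ hji h₁ rfl, hR.lower_adjoint_create_left rfl rfl hjmi h₂]

end Tuple
end ProductSystem

/-! ### The dilation of a doubly commuting representation -/

namespace ProductSystem

open CStarCorrespondence InteriorTensor

variable {A : Type*} [NonUnitalCStarAlgebra A] [PartialOrder A] [StarOrderedRing A] {k : ℕ}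
  {H K : Type*} [NormedAddCommGroup H] [InnerProductSpace ℂ H] [CompleteSpace H]
  [NormedAddCommGroup K] [InnerProductSpace ℂ K] [CompleteSpace K]
  {P : ProductSystem A k} {l m n p q r : Fin k → ℕ}

namespace Tuple

section rangeL

variable {R : P.Tuple H}

variable (R) in
/-- The closure of the range of `T̃(n)`. -/
def rangeL (n : Fin k → ℕ) : Submodule ℂ H :=
  (LinearMap.range (R.tilde n).toLinearMap).topologicalClosure

variable (R) in
lemma isClosed_rangeL (n : Fin k → ℕ) : IsClosed (R.rangeL n : Set H) :=
  Submodule.isClosed_topologicalClosure _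

instance : CompleteSpace (R.rangeL n) := (R.isClosed_rangeL n).completeSpace_coe

variable (R) in
lemma tilde_mem_rangeL (n : Fin k → ℕ) (u : InteriorTensor (P.fiber n) R.σ) :
    R.tilde n u ∈ R.rangeL n :=
  Submodule.le_topologicalClosure _ ⟨u, rfl⟩

variable (R) in
lemma op_mem_rangeL (x : P.fiber n) (h : H) : R.op n x h ∈ R.rangeL n := R.tilde_mem_rangeL n _

lemma rangeL_le {M : Submodule ℂ H} (hM : IsClosed (M : Set H))
    (h : ∀ (x : P.fiber n) (h : H), R.op n x h ∈ M) : R.rangeL n ≤ M := by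
  refine Submodule.topologicalClosure_minimal _ ?_ hM
  have := eq_top_of_tmul_mem R.σ (M.comap (R.tilde n).toLinearMap)
    (hM.preimage (R.tilde n).continuous) h
  rintro _ ⟨u, rfl⟩
  have hu : u ∈ M.comap (R.tilde n).toLinearMap := this ▸ Submodule.mem_top
  exact hu

lemma mem_rangeL_orthogonal {v : H} :
    v ∈ (R.rangeL n)ᗮ ↔ ∀ (x : P.fiber n) (h : H), inner ℂ (R.op n x h) v = 0 := by
  refine ⟨fun hv x h => hv _ (R.op_mem_rangeL x h), fun hv => ?_⟩
  have : R.rangeL n ≤ (ℂ ∙ v)ᗮ := rangeL_le (Submodule.isClosed_orthogonal _) fun x h => by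
    rw [Submodule.mem_orthogonal_singleton_iff_inner_left, hv]
  intro u hu
  exact Submodule.mem_orthogonal_singleton_iff_inner_left.1 (this hu)

lemma IsRepresentation.rangeL_anti (hR : R.IsRepresentation) (h : m + n = p) :
    R.rangeL p ≤ R.rangeL m := by
  refine Submodule.topologicalClosure_minimal _ ?_ (R.isClosed_rangeL m)
  rintro _ ⟨u, rfl⟩
  rw [ContinuousLinearMap.coe_coe, ← hR.tilde_lower h]
  exact R.tilde_mem_rangeL m _

end rangeL

/-- The operator `Ṽ(n)|_{E(n) ⊗ H} : E(n) ⊗_σ H → K`. -/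
def dil (T : P.Tuple H) (V : P.Tuple K) (ι : H →ₗᵢ[ℂ] K) (n : Fin k → ℕ) :
    InteriorTensor (P.fiber n) T.σ →L[ℂ] K :=
  V.tilde n ∘L idTensor (P.fiber n) T.σ V.σ ι.toContinuousLinearMap

namespace IsMinimalIsometricDilation

variable {T : P.Tuple H} {V : P.Tuple K} {ι : H →ₗᵢ[ℂ] K}

lemma ι_intertwines (hD : T.IsMinimalIsometricDilation V ι) (a : A) (h : H) :
    ι.toContinuousLinearMap (T.σ a h) = V.σ a (ι.toContinuousLinearMap h) :=
  (hD.restrict a h).symm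

lemma dil_tmul (hD : T.IsMinimalIsometricDilation V ι) (x : P.fiber n) (h : H) :
    T.dil V ι n (of _ T.σ (x ⊗ₜ h)) = V.op n x (ι h) := by
  rw [dil, ContinuousLinearMap.comp_apply, idTensor_tmul hD.ι_intertwines]
  rfl

lemma dil_create (hD : T.IsMinimalIsometricDilation V ι) (h : m + n = p) (x : P.fiber m)
    (z : InteriorTensor (P.fiber n) T.σ) :
    T.dil V ι p (P.create T.σ h x z) = V.op m x (T.dil V ι n z) := by
  rw [dil, ContinuousLinearMap.comp_apply, P.idTensor_create hD.ι_intertwines,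
    hD.isRepresentation.tilde_create]
  rfl

lemma dil_leftRep (hD : T.IsMinimalIsometricDilation V ι) (a : A)
    (z : InteriorTensor (P.fiber n) T.σ) :
    T.dil V ι n (leftRep _ T.σ a z) = V.σ a (T.dil V ι n z) := by
  rw [← create_unit, hD.dil_create, hD.isRepresentation.op_unit]

/-- Regularity of the dilation, as an equality of inner products. -/
lemma inner_dil (hD : T.IsMinimalIsometricDilation V ι) (h : m ⊓ n = 0)
    (z : InteriorTensor (P.fiber m) T.σ) (w : InteriorTensor (P.fiber n) T.σ) :
    inner ℂ (T.dil V ι m z) (T.dil V ι n w) = inner ℂ (T.tilde m z) (T.tilde n w) := by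
  have h1 := congrArg (fun L => inner ℂ z (L w)) (hD.regular m n h)
  simp only [ContinuousLinearMap.comp_apply, ContinuousLinearMap.adjoint_inner_right] at h1
  exact h1

/-- Minimality: a closed subspace containing all `Ṽ(n)(E(n) ⊗ H)` is everything. -/
lemma eq_top_of_dil_mem (hD : T.IsMinimalIsometricDilation V ι) (hT : T.IsRepresentation)
    {M : Submodule ℂ K} (hM : IsClosed (M : Set K)) (h : ∀ n z, T.dil V ι n z ∈ M) : M = ⊤ := by
  set W : Submodule ℂ K := (⨆ n, LinearMap.range (T.dil V ι n).toLinearMap).topologicalClosure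
    with hW
  have hWc : IsClosed (W : Set K) := Submodule.isClosed_topologicalClosure _
  have hmem : ∀ n z, T.dil V ι n z ∈ W := fun n z =>
    Submodule.le_topologicalClosure _ (Submodule.mem_iSup_of_mem n ⟨z, rfl⟩)
  have hle : ∀ N : Submodule ℂ K, IsClosed (N : Set K) → (∀ n z, T.dil V ι n z ∈ N) → W ≤ N :=
    fun N hN hN' => Submodule.topologicalClosure_minimal _ (iSup_le fun n => by
      rintro _ ⟨z, rfl⟩
      exact hN' n z) hN
  have htop : W = ⊤ := by
    refine hD.minimal W hWc (fun h => ?_) fun i x => ?_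
    · have h1 : (⊤ : Submodule ℂ H) ≤ W.comap ι.toLinearMap := by
        rw [← hT.nondegenerate]
        refine Submodule.topologicalClosure_minimal _ ?_ (hWc.preimage ι.continuous)
        rw [Submodule.span_le]
        rintro _ ⟨a, g, rfl⟩
        have h2 := hmem 0 (of _ T.σ (P.unit a ⊗ₜ g))
        rwa [hD.dil_tmul, hD.isRepresentation.op_unit, hD.restrict] at h2
      exact h1 (Submodule.mem_top (x := h))
    · refine hle (W.comap (V.T i x).toLinearMap) (hWc.preimage (V.T i x).continuous)
        fun n z => ?_
      have h2 := hmem (e i + n) (P.create T.σ rfl x z)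
      rwa [hD.dil_create, hD.isRepresentation.op_single] at h2
  rw [eq_top_iff, ← htop]
  exact hle M hM h

/-- Two bounded operators on `K` agreeing on all `Ṽ(n)(E(n) ⊗ H)` are equal. -/
lemma clm_ext_dil (hD : T.IsMinimalIsometricDilation V ι) (hT : T.IsRepresentation)
    {X : Type*} [NormedAddCommGroup X] [NormedSpace ℂ X] {f g : K →L[ℂ] X}
    (h : ∀ n z, f (T.dil V ι n z) = g (T.dil V ι n z)) : f = g := by
  have := hD.eq_top_of_dil_mem hT (M := LinearMap.eqLocus f.toLinearMap g.toLinearMap)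
    (isClosed_eq f.continuous g.continuous) h
  ext u
  have hu : u ∈ LinearMap.eqLocus f.toLinearMap g.toLinearMap := this ▸ Submodule.mem_top
  exact hu

/-- On relatively prime degrees, the component of `Ṽ(m) z` in the range of `Ṽ⁽ⁱ⁾` is determined by
regularity and the double commutation of the original tuple. -/
lemma dil_adjoint_comp_of_inf_eq_zero (hD : T.IsMinimalIsometricDilation V ι)
    (hT : T.IsRepresentation) (hdc : T.IsDoublyCommuting) (i : Fin k) (hm : m i = 0)
    (hnm : n ⊓ m = 0) (hp : e i + n = p) (hq : m + e i = q) :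
    (T.dil V ι p).adjoint ∘L T.dil V ι m
      = (T.dil V ι p).adjoint ∘L T.dil V ι q ∘L (T.lower hq).adjoint := by
  have hq' : e i + m = q := by rw [add_comm, hq]
  have hpm : p ⊓ m = 0 := by
    funext j
    have := congrFun hnm j
    rw [← hp]
    simp only [Pi.inf_apply, Pi.zero_apply, Pi.add_apply] at this ⊢
    rcases eq_or_ne j i with rfl | hj
    · simp [hm]
    · simpa [Pi.single_eq_of_ne hj] using this
  ext z
  refine P.ext_inner_create hp fun x ζ => ?_
  have key : innerSL ℂ (T.dil V ι p (P.create T.σ hp x ζ)) ∘L T.dil V ι q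
      = innerSL ℂ (of _ T.σ (x ⊗ₜ T.tilde n ζ)) ∘L T.lower hq' :=
    P.clm_ext_create hq' fun y u => by
      rw [ContinuousLinearMap.comp_apply, ContinuousLinearMap.comp_apply, innerSL_apply_apply,
        innerSL_apply_apply, hD.dil_create, hD.dil_create, hT.lower_create, inner_of_tmul,
        hD.isRepresentation.inner_op hD.isIsometric, ← hD.dil_leftRep, hD.inner_dil hnm,
        hT.tilde_leftRep]
  have key' := DFunLike.congr_fun key ((T.lower hq).adjoint z)
  rw [ContinuousLinearMap.comp_apply, ContinuousLinearMap.comp_apply, innerSL_apply_apply,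
    innerSL_apply_apply] at key'
  have h2 := DFunLike.congr_fun (hdc.adjoint_comp_tilde hT i hm hq' hq) z
  rw [ContinuousLinearMap.comp_apply, ContinuousLinearMap.comp_apply] at h2
  rw [ContinuousLinearMap.comp_apply, ContinuousLinearMap.comp_apply,
    ContinuousLinearMap.adjoint_inner_right, ContinuousLinearMap.adjoint_inner_right,
    ContinuousLinearMap.comp_apply, key', hD.inner_dil hpm, ← h2,
    ContinuousLinearMap.adjoint_inner_right, hT.tilde_create, op_apply]

/-- The same relation without the assumption of relatively prime degrees: a common factor `E(r)` of
the two degrees is cancelled, as `V(y)* V(x) = σ'(⟨y, x⟩)` for `x, y ∈ E(r)`. -/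
lemma dil_adjoint_comp (hD : T.IsMinimalIsometricDilation V ι)
    (hT : T.IsRepresentation) (hdc : T.IsDoublyCommuting) (i : Fin k) (hm : m i = 0)
    (hp : p i ≠ 0) (hq : m + e i = q) :
    (T.dil V ι p).adjoint ∘L T.dil V ι m
      = (T.dil V ι p).adjoint ∘L T.dil V ι q ∘L (T.lower hq).adjoint := by
  obtain ⟨r, m', n', hrm, hrp, hmi, hnm⟩ : ∃ r m' n' : Fin k → ℕ, r + m' = m ∧
      r + (e i + n') = p ∧ m' i = 0 ∧ n' ⊓ m' = 0 := by
    -- The common factor is the infimum of the degrees; it does not involve `e_i` as `m i = 0`.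
    refine ⟨p ⊓ m, m - p ⊓ m, p - p ⊓ m - e i, ?_, ?_, by simp [hm], ?_⟩
    · exact add_tsub_cancel_of_le inf_le_right
    · rw [add_tsub_cancel_of_le, add_tsub_cancel_of_le inf_le_left]
      intro j
      rcases eq_or_ne j i with rfl | hj
      · simp only [Pi.single_eq_same, Pi.sub_apply, Pi.inf_apply, hm]
        omega
      · simp [Pi.single_eq_of_ne hj]
    · funext j
      simp only [Pi.inf_apply, Pi.sub_apply, Pi.zero_apply]
      omega
  have hq' : r + (m' + e i) = q := by rw [← add_assoc, hrm, hq]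
  have h1 := hD.dil_adjoint_comp_of_inf_eq_zero hT hdc i hmi hnm rfl rfl
  refine P.clm_ext_create hrm fun x z => P.ext_inner_create hrp fun y ζ => ?_
  have h2 := congrArg (fun L => inner ℂ ζ (L (leftRep _ T.σ (ip y x) z))) h1
  simp only [ContinuousLinearMap.comp_apply, ContinuousLinearMap.adjoint_inner_right] at h2 ⊢
  rw [hT.lower_adjoint_create_left rfl hrm hq' hq, hD.dil_create, hD.dil_create, hD.dil_create,
    hD.isRepresentation.inner_op hD.isIsometric, hD.isRepresentation.inner_op hD.isIsometric,
    ← hD.dil_leftRep, ← hD.dil_leftRep, ← adjoint_intertwines (hT.lower_leftRep rfl)]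
  exact h2

/-- The projection `Q_i` onto the closed range of `Ṽ⁽ⁱ⁾` maps `Ṽ(m) z` to
`Ṽ(m + e_i) (I ⊗ T̃⁽ⁱ⁾*) z` when the `i`-th component of `m` is zero. -/
lemma starProjection_dil (hD : T.IsMinimalIsometricDilation V ι)
    (hT : T.IsRepresentation) (hdc : T.IsDoublyCommuting) (i : Fin k) (hm : m i = 0)
    (hq : m + e i = q) (z : InteriorTensor (P.fiber m) T.σ) :
    (V.rangeL (e i)).starProjection (T.dil V ι m z)
      = T.dil V ι q ((T.lower hq).adjoint z) := by
  refine Submodule.eq_starProjection_of_mem_orthogonal ?_ ?_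
  · exact hD.isRepresentation.rangeL_anti (by rw [add_comm, hq]) (V.tilde_mem_rangeL q _)
  · rw [mem_rangeL_orthogonal]
    intro x v
    have h1 := hD.clm_ext_dil hT (f := innerSL ℂ (T.dil V ι m z - T.dil V ι q
        ((T.lower hq).adjoint z)) ∘L V.op (e i) x) (g := 0) fun n ζ => by
      rw [ContinuousLinearMap.comp_apply, innerSL_apply_apply, ← hD.dil_create rfl, zero_apply,
        inner_eq_zero_symm, inner_sub_right, sub_eq_zero]
      have h2 := congrArg (fun L => inner ℂ (P.create T.σ rfl x ζ) (L z))
        (hD.dil_adjoint_comp hT hdc i hm (p := e i + n) (by simp) hq)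
      simp only [ContinuousLinearMap.comp_apply, ContinuousLinearMap.adjoint_inner_right] at h2
      exact h2
    rw [inner_eq_zero_symm]
    exact DFunLike.congr_fun h1 v

/-- The isometric dilation of a doubly commuting tuple is again doubly commuting: the projection
onto the closed range of `Ṽ⁽ⁱ⁾` commutes with the operators `V⁽ʲ⁾(y)` for `j ≠ i`. -/
theorem starProjection_comm (hD : T.IsMinimalIsometricDilation V ι)
    (hT : T.IsRepresentation) (hdc : T.IsDoublyCommuting) {i j : Fin k} (hij : i ≠ j)
    (y : P.fiber (e j)) :
    (V.rangeL (e i)).starProjection ∘L V.T j y = V.T j y ∘L (V.rangeL (e i)).starProjection := by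
  have hV := hD.isRepresentation
  refine hD.clm_ext_dil hT fun n z => ?_
  rw [← hV.op_single, ContinuousLinearMap.comp_apply, ContinuousLinearMap.comp_apply,
    ← hD.dil_create rfl]
  by_cases hn : n i = 0
  · have hq : e j + (n + e i) = e j + n + e i := (add_assoc _ _ _).symm
    rw [hD.starProjection_dil hT hdc i hn rfl, hD.starProjection_dil hT hdc i (q := e j + n + e i)
      (by simp [hn, Pi.single_eq_of_ne hij]) rfl, ← hD.dil_create hq,
      hT.lower_adjoint_create_left rfl rfl hq]
  · have hmem : ∀ (n : Fin k → ℕ) (z : InteriorTensor (P.fiber n) T.σ), n i ≠ 0 →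
        T.dil V ι n z ∈ V.rangeL (e i) := fun n z hn => by
      refine hV.rangeL_anti (n := n - e i) (add_tsub_cancel_of_le fun l => ?_)
        (V.tilde_mem_rangeL n _)
      rcases eq_or_ne l i with rfl | hl
      · simp only [Pi.single_eq_same]
        omega
      · simp [Pi.single_eq_of_ne hl]
    rw [Submodule.starProjection_eq_self_iff.2 (hmem _ _ (by simp [hn])),
      Submodule.starProjection_eq_self_iff.2 (hmem _ _ hn), hD.dil_create]

end IsMinimalIsometricDilation

end Tuple
end ProductSystem

/-! ### The wandering subspace -/

namespace ProductSystem

open CStarCorrespondence InteriorTensor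

variable {A : Type*} [NonUnitalCStarAlgebra A] [PartialOrder A] [StarOrderedRing A] {k : ℕ}
  {K : Type*} [NormedAddCommGroup K] [InnerProductSpace ℂ K] [CompleteSpace K]
  {P : ProductSystem A k} {l m n p q r : Fin k → ℕ}

/-- The restriction of a representation of `A` to an invariant subspace. -/
def restrictRep (σ : A →⋆ₙₐ[ℂ] (K →L[ℂ] K)) (M : Submodule ℂ K) [CompleteSpace M]
    (hM : ∀ a, ∀ v ∈ M, σ a v ∈ M) : A →⋆ₙₐ[ℂ] (M →L[ℂ] M) where
  toFun a := (σ a ∘L M.subtypeL).codRestrict M fun v => hM a v v.2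
  map_smul' c a := ContinuousLinearMap.ext fun v =>
    Subtype.ext (DFunLike.congr_fun (map_smul σ c a) (v : K))
  map_zero' := ContinuousLinearMap.ext fun v =>
    Subtype.ext (DFunLike.congr_fun (map_zero σ) (v : K))
  map_add' a b := ContinuousLinearMap.ext fun v =>
    Subtype.ext (DFunLike.congr_fun (map_add σ a b) (v : K))
  map_mul' a b := ContinuousLinearMap.ext fun v =>
    Subtype.ext (DFunLike.congr_fun (map_mul σ a b) (v : K))
  map_star' a := by
    rw [ContinuousLinearMap.star_eq_adjoint, ContinuousLinearMap.eq_adjoint_iff]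
    intro u v
    have h := inner_rep σ (star a) (u : K) (v : K)
    rwa [star_star] at h

lemma restrictRep_coe (σ : A →⋆ₙₐ[ℂ] (K →L[ℂ] K)) (M : Submodule ℂ K) [CompleteSpace M]
    (hM : ∀ a, ∀ v ∈ M, σ a v ∈ M) (a : A) (v : M) :
    (restrictRep σ M hM a v : K) = σ a v := rfl

/-- A restriction to an invariant subspace is nondegenerate, since no nonzero vector is annihilated
by all `σ(a)`. -/
lemma nondegenerate_restrictRep {σ : A →⋆ₙₐ[ℂ] (K →L[ℂ] K)} (hσ : Nondegenerate σ)
    (M : Submodule ℂ K) [CompleteSpace M] (hM : ∀ a, ∀ v ∈ M, σ a v ∈ M) :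
    Nondegenerate (restrictRep σ M hM) := by
  rw [Nondegenerate, Submodule.topologicalClosure_eq_top_iff, Submodule.eq_bot_iff]
  intro v hv
  have h1 : ∀ a, σ a (v : K) = 0 := fun a => by
    have h2 : inner ℂ (restrictRep σ M hM (star a) (restrictRep σ M hM a v)) v = 0 :=
      hv _ (Submodule.subset_span ⟨_, _, rfl⟩)
    rw [inner_rep, star_star] at h2
    have h3 := inner_self_eq_zero.1 h2
    rw [← restrictRep_coe σ M hM, h3]
    rfl
  exact Subtype.ext (hσ.ext_inner fun a => by rw [h1, Submodule.coe_zero, map_zero])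

namespace Tuple

variable {V : P.Tuple K}

namespace IsRepresentation

lemma σ_mem_rangeL_orthogonal (hV : V.IsRepresentation) (a : A) {v : K}
    (hv : v ∈ (V.rangeL n)ᗮ) : V.σ a v ∈ (V.rangeL n)ᗮ := by
  rw [mem_rangeL_orthogonal] at hv ⊢
  intro x h
  rw [← star_star a, ← inner_rep, ← ContinuousLinearMap.comp_apply, ← hV.op_left, hv]

lemma _root_.ProductSystem.Tuple.rangeL_le_of_create {M : Submodule ℂ K} (h : m + n = p)
    (hM : IsClosed (M : Set K))
    (hmem : ∀ x z, V.tilde p (P.create V.σ h x z) ∈ M) : V.rangeL p ≤ M := by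
  refine Submodule.topologicalClosure_minimal _ ?_ hM
  have := P.eq_top_of_create_mem h (M.comap (V.tilde p).toLinearMap)
    (hM.preimage (V.tilde p).continuous) hmem
  rintro _ ⟨u, rfl⟩
  have hu : u ∈ M.comap (V.tilde p).toLinearMap := this ▸ Submodule.mem_top
  exact hu

lemma rangeL_zero (hV : V.IsRepresentation) : V.rangeL 0 = ⊤ := by
  rw [eq_top_iff, ← hV.nondegenerate]
  refine Submodule.topologicalClosure_minimal _ ?_ (V.isClosed_rangeL 0)
  rw [Submodule.span_le]
  rintro _ ⟨a, h, rfl⟩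
  rw [← hV.op_unit]
  exact V.op_mem_rangeL _ h

lemma op_mem_rangeL_add (hV : V.IsRepresentation) (h : m + n = p) (x : P.fiber m) {v : K}
    (hv : v ∈ V.rangeL n) : V.op m x v ∈ V.rangeL p := by
  have h1 : V.rangeL n ≤ (V.rangeL p).comap (V.op m x).toLinearMap :=
    rangeL_le ((V.isClosed_rangeL p).preimage (V.op m x).continuous) fun y g => by
      have := V.op_mem_rangeL (P.mul h x y) g
      rwa [hV.op_mul] at this
  exact h1 hv

/-- A vector in the range of `Ṽ(m)` all of whose `E(m)`-coefficients lie in the range of `Ṽ(n)`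
lies in the range of `Ṽ(m + n)`. -/
lemma mem_rangeL_add (hV : V.IsRepresentation) (hi : V.IsIsometric) (h : m + n = p) {u : K}
    (hu : u ∈ V.rangeL m) (hu' : ∀ x : P.fiber m, (V.op m x).adjoint u ∈ V.rangeL n) :
    u ∈ V.rangeL p := by
  set u' := u - (V.rangeL p).starProjection u with hu'_def
  have hp : ∀ x : P.fiber m, V.rangeL p ≤ (V.rangeL n).comap (V.op m x).adjoint.toLinearMap :=
    fun x => rangeL_le_of_create h ((V.isClosed_rangeL n).preimage (V.op m x).adjoint.continuous)
      fun y z => by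
        have h1 : (V.op m x).adjoint (V.tilde p (P.create V.σ h y z))
            = V.tilde n (leftRep _ V.σ (ip x y) z) := by
          refine ext_inner_left ℂ fun v => ?_
          rw [ContinuousLinearMap.adjoint_inner_right, hV.tilde_create, hV.inner_op hi,
            hV.tilde_leftRep]
        rw [Submodule.mem_comap]
        exact h1 ▸ V.tilde_mem_rangeL n _
  have h0 : ∀ x : P.fiber m, (V.op m x).adjoint u' = 0 := fun x => by
    have h1 : (V.op m x).adjoint u' ∈ V.rangeL n := by
      rw [hu'_def, map_sub]
      exact Submodule.sub_mem _ (hu' x) (hp x (Submodule.starProjection_apply_mem _ u))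
    have h2 : (V.op m x).adjoint u' ∈ (V.rangeL n)ᗮ := fun v hv => by
      rw [ContinuousLinearMap.adjoint_inner_right]
      exact Submodule.sub_starProjection_mem_orthogonal u _ (hV.op_mem_rangeL_add h x hv)
    exact Submodule.disjoint_def.1 (Submodule.orthogonal_disjoint _) _ h1 h2
  have h1 : u' ∈ (V.rangeL m)ᗮ := mem_rangeL_orthogonal.2 fun x g => by
    rw [← ContinuousLinearMap.adjoint_inner_right, h0, inner_zero_right]
  have h2 : u' ∈ V.rangeL m := Submodule.sub_mem _ hu
    (hV.rangeL_anti h (Submodule.starProjection_apply_mem _ u))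
  have h3 : u' = 0 := Submodule.disjoint_def.1 (Submodule.orthogonal_disjoint _) _ h2 h1
  rw [sub_eq_zero.1 h3]
  exact Submodule.starProjection_apply_mem _ u

end IsRepresentation

variable (V) in
/-- Double commutation of an isometric representation: the projection onto the closed range of
`Ṽ⁽ⁱ⁾` commutes with the operators `V⁽ʲ⁾(y)` for `j ≠ i`. -/
def RangesCommute : Prop :=
  ∀ i j, i ≠ j → ∀ y : P.fiber (e j),
    (V.rangeL (e i)).starProjection ∘L V.T j y = V.T j y ∘L (V.rangeL (e i)).starProjection

namespace RangesCommute

lemma apply (hc : V.RangesCommute) {i j : Fin k} (hij : i ≠ j) (y : P.fiber (e j)) (v : K) :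
    (V.rangeL (e i)).starProjection (V.T j y v)
      = V.T j y ((V.rangeL (e i)).starProjection v) :=
  DFunLike.congr_fun (hc i j hij y) v

lemma adjoint_apply (hc : V.RangesCommute) {i j : Fin k} (hij : i ≠ j) (y : P.fiber (e j))
    (v : K) :
    (V.rangeL (e i)).starProjection ((V.T j y).adjoint v)
      = (V.T j y).adjoint ((V.rangeL (e i)).starProjection v) := by
  refine ext_inner_left ℂ fun u => ?_
  rw [← Submodule.inner_starProjection_left_eq_right, ContinuousLinearMap.adjoint_inner_right,
    ContinuousLinearMap.adjoint_inner_right, ← hc.apply hij,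
    Submodule.inner_starProjection_left_eq_right]

/-- The projections onto the ranges of the `Ṽ⁽ⁱ⁾` commute. -/
lemma starProjection_comm (hc : V.RangesCommute) (hV : V.IsRepresentation) {i j : Fin k}
    (hij : i ≠ j) (v : K) :
    (V.rangeL (e i)).starProjection ((V.rangeL (e j)).starProjection v)
      = (V.rangeL (e j)).starProjection ((V.rangeL (e i)).starProjection v) := by
  have hle : V.rangeL (e j)
      ≤ (V.rangeL (e j)).comap (V.rangeL (e i)).starProjection.toLinearMap :=
    rangeL_le ((V.isClosed_rangeL _).preimage (V.rangeL (e i)).starProjection.continuous)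
      fun y h => by
        have h1 := V.op_mem_rangeL y ((V.rangeL (e i)).starProjection h)
        rwa [hV.op_single, ← hc.apply hij, ← hV.op_single] at h1
  have hmem : ∀ u ∈ V.rangeL (e j), (V.rangeL (e i)).starProjection u ∈ V.rangeL (e j) :=
    fun u hu => hle hu
  refine (Submodule.eq_starProjection_of_mem_orthogonal
    (hmem _ (Submodule.starProjection_apply_mem _ v)) ?_).symm
  rw [← map_sub]
  intro u hu
  rw [← Submodule.inner_starProjection_left_eq_right]
  exact Submodule.sub_starProjection_mem_orthogonal v _ (hmem u hu)

/-- `V(x)` preserves the kernel of `Ṽ⁽ⁱ⁾*` if the `i`-th component of the degree of `x` is zero. -/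
lemma op_mem_orthogonal (hc : V.RangesCommute) (hV : V.IsRepresentation) {i : Fin k}
    (hm : m i = 0) (x : P.fiber m) {v : K} (hv : v ∈ (V.rangeL (e i))ᗮ) :
    V.op m x v ∈ (V.rangeL (e i))ᗮ := by
  induction m using multiindex_induction with
  | zero =>
    obtain ⟨a, rfl⟩ := P.unit.surjective x
    rw [hV.op_unit]
    exact hV.σ_mem_rangeL_orthogonal a hv
  | add j m ih =>
    have hj : i ≠ j := by
      rintro rfl
      simp at hm
    have hm' : m i = 0 := by
      simp only [Pi.add_apply] at hm
      omega
    have := P.eq_top_of_mul_mem rfl ((V.rangeL (e i))ᗮ.comap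
      (V.tilde (e j + m) ∘L tmulAt _ V.σ v).toLinearMap)
      ((Submodule.isClosed_orthogonal _).preimage (ContinuousLinearMap.continuous _))
      fun y z => by
        change V.op _ (P.mul rfl y z) v ∈ (V.rangeL (e i))ᗮ
        rw [hV.op_mul, ContinuousLinearMap.comp_apply, hV.op_single,
          ← Submodule.starProjection_apply_eq_zero_iff, hc.apply hj,
          (Submodule.starProjection_apply_eq_zero_iff _).2 (ih hm' z), map_zero]
    have hx : x ∈ (V.rangeL (e i))ᗮ.comap
        (V.tilde (e j + m) ∘L tmulAt _ V.σ v).toLinearMap := this ▸ Submodule.mem_top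
    exact hx

/-- `V(y) w ⊥ V(x) v` if `w` is in the kernel of `Ṽ⁽ⁱ⁾*` and the degree of `x` exceeds that of `y`
in the `i`-th component. -/
lemma inner_op_eq_zero (hc : V.RangesCommute) (hV : V.IsRepresentation) (hi : V.IsIsometric)
    {i : Fin k} (hmn : m i < n i) (x : P.fiber n) (y : P.fiber m) (v : K) {w : K}
    (hw : w ∈ (V.rangeL (e i))ᗮ) : inner ℂ (V.op n x v) (V.op m y w) = 0 := by
  obtain ⟨r, m', n', hrm, hrn, hm'⟩ : ∃ r m' n' : Fin k → ℕ, r + m' = m ∧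
      r + (e i + n') = n ∧ m' i = 0 := by
    -- Cancel the common factor `m i • e_i`; in the truncated differences only `m i < n i` matters,
    -- as the other components are left alone.
    refine ⟨Pi.single i (m i), m - Pi.single i (m i), n - Pi.single i (m i) - e i, ?_, ?_, by simp⟩
    · refine add_tsub_cancel_of_le fun j => ?_
      rcases eq_or_ne j i with rfl | hj
      · simp
      · simp [Pi.single_eq_of_ne hj]
    · funext j
      rcases eq_or_ne j i with rfl | hj
      · simp only [Pi.add_apply, Pi.single_eq_same, Pi.sub_apply]
        omega
      · simp [Pi.single_eq_of_ne hj]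
  have key : ∀ x₁ (x₂ : P.fiber (e i + n')) y₁ (y₂ : P.fiber m'),
      inner ℂ (V.op n (P.mul hrn x₁ x₂) v) (V.op m (P.mul hrm y₁ y₂) w) = 0 := by
    intro x₁ x₂ y₁ y₂
    rw [hV.op_mul, hV.op_mul, ContinuousLinearMap.comp_apply, ContinuousLinearMap.comp_apply,
      hV.inner_op hi, ← ContinuousLinearMap.comp_apply, ← hV.op_left]
    exact hc.op_mem_orthogonal hV hm' _ hw _ (hV.rangeL_anti rfl (V.op_mem_rangeL x₂ v))
  have h1 : ∀ x₁ x₂, innerSL ℂ (V.op n (P.mul hrn x₁ x₂) v) ∘L V.tilde m ∘L tmulAt _ V.σ w = 0 :=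
    fun x₁ x₂ => P.clm_ext_mul hrm fun y₁ y₂ => key x₁ x₂ y₁ y₂
  have h2 : innerSL ℂ (V.op m y w) ∘L V.tilde n ∘L tmulAt _ V.σ v = 0 :=
    P.clm_ext_mul hrn fun x₁ x₂ => inner_eq_zero_symm.1 (DFunLike.congr_fun (h1 x₁ x₂) y)
  exact inner_eq_zero_symm.1 (DFunLike.congr_fun h2 x)

end RangesCommute

variable (V) in
/-- The wandering subspace: the joint kernel of the operators `Ṽ⁽ⁱ⁾*`. -/
def wandering : Submodule ℂ K := ⨅ i, (V.rangeL (e i))ᗮ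

lemma mem_wandering {v : K} : v ∈ V.wandering ↔ ∀ i, v ∈ (V.rangeL (e i))ᗮ :=
  Submodule.mem_iInf _

instance : CompleteSpace V.wandering := by
  have h : IsClosed (V.wandering : Set K) := by
    rw [wandering, Submodule.coe_iInf]
    exact isClosed_iInter fun i => Submodule.isClosed_orthogonal _
  exact h.completeSpace_coe

lemma IsRepresentation.σ_mem_wandering (hV : V.IsRepresentation) (a : A) (v : K)
    (hv : v ∈ V.wandering) : V.σ a v ∈ V.wandering :=
  mem_wandering.2 fun i => hV.σ_mem_rangeL_orthogonal a (mem_wandering.1 hv i)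

/-- The representation of `A` on the wandering subspace. -/
def wanderingRep (hV : V.IsRepresentation) : A →⋆ₙₐ[ℂ] (V.wandering →L[ℂ] V.wandering) :=
  restrictRep V.σ V.wandering hV.σ_mem_wandering

/-- The isometry `E(n) ⊗ W → K`, `x ⊗ w ↦ V(x) w`, for the wandering subspace `W`. -/
def wanderingMap (hV : V.IsRepresentation) (hi : V.IsIsometric) (n : Fin k → ℕ) :
    InteriorTensor (P.fiber n) (wanderingRep hV) →ₗᵢ[ℂ] K where
  toLinearMap := (V.tilde n ∘L idTensor (P.fiber n) (wanderingRep hV) V.σ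
    V.wandering.subtypeL).toLinearMap
  norm_map' u := by
    have h1 : ∀ a w, V.wandering.subtypeL (wanderingRep hV a w)
        = V.σ a (V.wandering.subtypeL w) := fun a w => rfl
    have h2 : V.wandering.subtypeL.adjoint ∘L V.wandering.subtypeL = 1 := by
      ext w
      refine congrArg Subtype.val (ext_inner_left ℂ fun v => ?_)
      rw [ContinuousLinearMap.comp_apply, ContinuousLinearMap.adjoint_inner_right]
      rfl
    exact (hV.norm_tilde hi _).trans (norm_idTensor h1 h2 u)

lemma wanderingMap_apply (hV : V.IsRepresentation) (hi : V.IsIsometric)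
    (u : InteriorTensor (P.fiber n) (wanderingRep hV)) :
    wanderingMap hV hi n u
      = V.tilde n (idTensor (P.fiber n) (wanderingRep hV) V.σ V.wandering.subtypeL u) := rfl

lemma wanderingMap_tmul (hV : V.IsRepresentation) (hi : V.IsIsometric) (x : P.fiber n)
    (w : V.wandering) :
    wanderingMap hV hi n (of _ (wanderingRep hV) (x ⊗ₜ w)) = V.op n x w := by
  have h1 : ∀ a w, V.wandering.subtypeL (wanderingRep hV a w)
      = V.σ a (V.wandering.subtypeL w) := fun a w => rfl
  rw [wanderingMap_apply, idTensor_tmul h1]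
  rfl

lemma wanderingMap_create (hV : V.IsRepresentation) (hi : V.IsIsometric) (h : m + n = p)
    (x : P.fiber m) (u : InteriorTensor (P.fiber n) (wanderingRep hV)) :
    wanderingMap hV hi p (P.create _ h x u) = V.op m x (wanderingMap hV hi n u) := by
  have h1 : ∀ a w, V.wandering.subtypeL (wanderingRep hV a w)
      = V.σ a (V.wandering.subtypeL w) := fun a w => rfl
  rw [wanderingMap_apply, P.idTensor_create h1, hV.tilde_create]
  rfl

lemma wanderingMap_leftRep (hV : V.IsRepresentation) (hi : V.IsIsometric) (a : A)
    (u : InteriorTensor (P.fiber n) (wanderingRep hV)) :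
    wanderingMap hV hi n (leftRep _ _ a u) = V.σ a (wanderingMap hV hi n u) := by
  rw [← create_unit, wanderingMap_create, hV.op_unit]

/-- The subspaces generated in different degrees by the wandering subspace are orthogonal. -/
lemma RangesCommute.orthogonalFamily (hc : V.RangesCommute) (hV : V.IsRepresentation)
    (hi : V.IsIsometric) :
    OrthogonalFamily ℂ (fun n => InteriorTensor (P.fiber n) (wanderingRep hV))
      (wanderingMap hV hi) := by
  intro m n hmn u v
  suffices innerSL ℂ (wanderingMap hV hi m u) ∘L
      (wanderingMap hV hi n).toContinuousLinearMap = 0 from DFunLike.congr_fun this v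
  refine clm_ext fun y w' => ?_
  suffices innerSL ℂ (wanderingMap hV hi n (of _ _ (y ⊗ₜ w'))) ∘L
      (wanderingMap hV hi m).toContinuousLinearMap = 0 from
    inner_eq_zero_symm.1 (DFunLike.congr_fun this u)
  refine clm_ext fun x w => ?_
  change inner ℂ (wanderingMap hV hi n (of _ _ (y ⊗ₜ w')))
    (wanderingMap hV hi m (of _ _ (x ⊗ₜ w))) = 0
  rw [wanderingMap_tmul, wanderingMap_tmul]
  obtain ⟨i, hne⟩ := Function.ne_iff.1 hmn
  rcases lt_or_gt_of_ne hne with h | h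
  · exact hc.inner_op_eq_zero hV hi h y x w' (mem_wandering.1 w.2 i)
  · exact inner_eq_zero_symm.1 (hc.inner_op_eq_zero hV hi h x y w (mem_wandering.1 w'.2 i))

end Tuple
end ProductSystem

/-! ### Wold decomposition, purity and induced representations -/

namespace ProductSystem

open CStarCorrespondence InteriorTensor

variable {A : Type*} [NonUnitalCStarAlgebra A] [PartialOrder A] [StarOrderedRing A] {k : ℕ}
  {P : ProductSystem A k} {l m n p q r : Fin k → ℕ}

section Fock

variable {G : Type*} [NormedAddCommGroup G] [InnerProductSpace ℂ G] [CompleteSpace G]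
  (π : A →⋆ₙₐ[ℂ] (G →L[ℂ] G))

variable (P) in
lemma fockRep_single (a : A) (n : Fin k → ℕ) (z : InteriorTensor (P.fiber n) π) :
    P.fockRep π a (lp.single 2 n z) = lp.single 2 n (leftRep _ π a z) := by
  refine lp.ext (funext fun m => ?_)
  change leftRep (P.fiber m) π a ((lp.single 2 n z : P.Fock π) m) = _
  rcases eq_or_ne m n with rfl | h
  · rw [lp.single_apply_self, lp.single_apply_self]
  · rw [lp.single_apply_ne _ _ _ h, lp.single_apply_ne _ _ _ h, map_zero]

/-- The creation operator maps the summand of degree `n` to that of degree `e_i + n`. -/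
lemma fockCreate_single (i : Fin k) (x : P.fiber (e i)) (n : Fin k → ℕ)
    (z : InteriorTensor (P.fiber n) π) :
    P.fockCreate π i x (lp.single 2 n z) = lp.single 2 (e i + n) (P.create π rfl x z) := by
  refine lp.ext (funext fun m => ?_)
  change shiftFun π i x (lp.single 2 n z) m = _
  by_cases hm : m ∈ Set.range fun n : Fin k → ℕ => e i + n
  · obtain ⟨l, rfl⟩ := hm
    dsimp only
    rw [shiftFun_add]
    rcases eq_or_ne l n with rfl | h
    · rw [lp.single_apply_self, lp.single_apply_self]
    · rw [lp.single_apply_ne _ _ _ h, lp.single_apply_ne _ _ _ ((add_right_injective _).ne h),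
        map_zero]
  · rw [shiftFun_of_notMem _ _ _ _ _ _ hm, lp.single_apply_ne]
    rintro rfl
    exact hm ⟨n, rfl⟩

end Fock

namespace Tuple

section Wold

variable {K : Type w} [NormedAddCommGroup K] [InnerProductSpace ℂ K] [CompleteSpace K]
  {V : P.Tuple K}

/-- If the translates of the wandering subspace span, a doubly commuting isometric representation
is isomorphic to the one induced by the representation of `A` on the wandering subspace. -/
lemma RangesCommute.isIsomorphicToInduced (hc : V.RangesCommute) (hV : V.IsRepresentation)
    (hi : V.IsIsometric)
    (htot : ∀ v : K, (∀ n (x : P.fiber n), ∀ w ∈ V.wandering, inner ℂ (V.op n x w) v = 0) → v = 0) :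
    V.IsIsomorphicToInduced := by
  have hsum : IsHilbertSum ℂ (fun n => InteriorTensor (P.fiber n) (wanderingRep hV))
      (wanderingMap hV hi) := by
    refine IsHilbertSum.mk (hc.orthogonalFamily hV hi) (le_of_eq ?_)
    symm
    rw [Submodule.topologicalClosure_eq_top_iff, Submodule.eq_bot_iff]
    refine fun v hv => htot v fun n x w hw => ?_
    refine hv _ (Submodule.mem_iSup_of_mem n ⟨of _ _ (x ⊗ₜ ⟨w, hw⟩), ?_⟩)
    exact wanderingMap_tmul hV hi x ⟨w, hw⟩
  refine ⟨V.wandering, inferInstance, inferInstance, inferInstance, wanderingRep hV,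
    nondegenerate_restrictRep hV.nondegenerate _ _, ?_⟩
  set Φ := hsum.linearIsometryEquiv with hΦ
  have hsymm : ∀ n z, Φ.symm (lp.single 2 n z) = wanderingMap hV hi n z := fun n z =>
    hsum.linearIsometryEquiv_symm_apply_single z
  have key : ∀ (F : P.Fock (wanderingRep hV) →L[ℂ] P.Fock (wanderingRep hV)) (L : K →L[ℂ] K),
      (∀ n z, Φ.symm (F (lp.single 2 n z)) = L (wanderingMap hV hi n z)) →
        ∀ h, F (Φ h) = Φ (L h) := fun F L hFL h => by
    have h1 := lp.hasSum_single (p := 2) (by norm_num) (Φ h)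
    have h2 : Φ.symm (F (Φ h)) = L (Φ.symm (Φ h)) := by
      refine ((h1.mapL F).mapL Φ.symm.toContinuousLinearEquiv.toContinuousLinearMap).unique ?_
      convert (h1.mapL Φ.symm.toContinuousLinearEquiv.toContinuousLinearMap).mapL L using 2 with n
      · change Φ.symm (F (lp.single 2 n (Φ h n))) = L (Φ.symm (lp.single 2 n (Φ h n)))
        rw [hFL, hsymm]
      · rfl
    rw [Φ.symm_apply_apply] at h2
    rw [← h2, Φ.apply_symm_apply]
  refine ⟨Φ, fun a h => key (P.fockRep _ a) (V.σ a) (fun n z => ?_) h,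
    fun i x h => key (P.fockCreate _ i x) (V.T i x) (fun n z => ?_) h⟩
  · rw [fockRep_single, hsymm, wanderingMap_leftRep]
  · rw [fockCreate_single, hsymm, wanderingMap_create, hV.op_single]

/-- The wandering subspace of a doubly commuting isometric representation is generating if the
representation is generated by a subspace orthogonal to the unitary parts `⋂ₗ Ṽ(l e_j) K`. -/
lemma RangesCommute.eq_zero_of_orthogonal_wandering (hc : V.RangesCommute)
    (hV : V.IsRepresentation) (hi : V.IsIsometric) (S : Set K)
    (hmin : ∀ W : Submodule ℂ K, IsClosed (W : Set K) → S ⊆ W →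
      (∀ i (x : P.fiber (e i)), ∀ w ∈ W, V.T i x w ∈ W) → W = ⊤)
    (hpure : ∀ (j : Fin k) (u : K), (∀ l : ℕ, u ∈ V.rangeL (l • e j)) → ∀ h ∈ S, inner ℂ u h = 0)
    {v : K} (hv : ∀ n (x : P.fiber n), ∀ w ∈ V.wandering, inner ℂ (V.op n x w) v = 0) : v = 0 := by
  -- `N` is the orthogonal complement of the part generated by the wandering subspace.
  set N : Submodule ℂ K := (Submodule.span ℂ
    {u | ∃ (n : Fin k → ℕ) (x : P.fiber n), ∃ w ∈ V.wandering, V.op n x w = u})ᗮ with hN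
  have memN : ∀ v, v ∈ N ↔
      ∀ n (x : P.fiber n), ∀ w ∈ V.wandering, inner ℂ (V.op n x w) v = 0 := by
    refine fun v => ⟨fun h n x w hw => h _ (Submodule.subset_span ⟨n, x, w, hw, rfl⟩), fun h => ?_⟩
    rw [hN, Submodule.mem_orthogonal]
    intro u hu
    induction hu using Submodule.span_induction with
    | mem u hu =>
      obtain ⟨n, x, w, hw, rfl⟩ := hu
      exact h n x w hw
    | zero => rw [inner_zero_left]
    | add u u' _ _ h1 h2 => rw [inner_add_left, h1, h2, add_zero]
    | smul c u _ h1 => rw [inner_smul_left, h1, mul_zero]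
  have adjN : ∀ j (x : P.fiber (e j)), ∀ v ∈ N, (V.T j x).adjoint v ∈ N := by
    intro j x v hv
    rw [memN] at hv ⊢
    intro n y w hw
    rw [ContinuousLinearMap.adjoint_inner_right, ← hV.op_single, ← ContinuousLinearMap.comp_apply,
      ← hV.op_mul rfl, hv _ _ w hw]
  have projN : ∀ j, ∀ v ∈ N, (V.rangeL (e j)).starProjection v ∈ N := by
    intro j v hv
    rw [memN] at hv ⊢
    intro n y w hw
    rw [← Submodule.inner_starProjection_left_eq_right]
    by_cases hn : n j = 0
    · rw [(Submodule.starProjection_apply_eq_zero_iff _).2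
        (hc.op_mem_orthogonal hV hn y (mem_wandering.1 hw j)), inner_zero_left]
    · have hmem : V.op n y w ∈ V.rangeL (e j) := by
        refine hV.rangeL_anti (n := n - e j) (add_tsub_cancel_of_le fun l => ?_)
          (V.op_mem_rangeL y w)
        rcases eq_or_ne l j with rfl | hl
        · simp only [Pi.single_eq_same]
          omega
        · simp [Pi.single_eq_of_ne hl]
      rw [Submodule.starProjection_eq_self_iff.2 hmem, hv _ _ w hw]
  -- The vectors in `N` which are in the kernels of all but finitely many `Ṽ⁽ⁱ⁾*` vanish: the
  -- indices are removed from the set of these kernels one by one.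
  have key : ∀ s : Finset (Fin k), ∀ v ∈ N, (∀ i, i ∉ s → v ∈ (V.rangeL (e i))ᗮ) → v = 0 := by
    intro s
    induction s using Finset.induction_on with
    | empty =>
      intro v hv hv'
      refine hV.nondegenerate.ext_inner fun a => ?_
      have h1 := (memN v).1 hv 0 (P.unit (star a * a)) v
        (mem_wandering.2 fun i => hv' i (by simp))
      rw [hV.op_unit, map_mul, mul_apply_eq_comp, inner_rep, star_star] at h1
      rw [inner_self_eq_zero.1 h1, map_zero]
    | insert j s hj ih =>
      set N' : Submodule ℂ K := N ⊓ ⨅ i ∈ ((insert j s)ᶜ : Finset (Fin k)), (V.rangeL (e i))ᗮ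
        with hN'
      have memN' : ∀ v, v ∈ N' ↔ v ∈ N ∧ ∀ i, i ∉ insert j s → v ∈ (V.rangeL (e i))ᗮ := by
        intro v
        simp only [hN', Submodule.mem_inf, Submodule.mem_iInf, Finset.mem_compl]
      -- Vectors in `N'` are in the range of `Ṽ⁽ʲ⁾`, since `1 - Q_j` maps `N'` to zero by induction.
      have hrange : ∀ v ∈ N', v ∈ V.rangeL (e j) := by
        intro v hv
        obtain ⟨hv1, hv2⟩ := (memN' v).1 hv
        have h0 := ih (v - (V.rangeL (e j)).starProjection v)
          (Submodule.sub_mem _ hv1 (projN j v hv1)) fun i his => by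
            rcases eq_or_ne i j with rfl | hij
            · exact Submodule.sub_starProjection_mem_orthogonal v
            · have h1 := hv2 i (by simp [hij, his])
              rw [← Submodule.starProjection_apply_eq_zero_iff] at h1 ⊢
              rw [map_sub, hc.starProjection_comm hV hij, h1, map_zero, sub_zero]
        rw [sub_eq_zero.1 h0]
        exact Submodule.starProjection_apply_mem _ v
      have hadj : ∀ i (x : P.fiber (e i)), ∀ v ∈ N', (V.T i x).adjoint v ∈ N' := by
        intro i x v hv
        obtain ⟨hv1, hv2⟩ := (memN' v).1 hv
        refine (memN' _).2 ⟨adjN i x v hv1, fun i' hi' => ?_⟩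
        have h1 := hv2 i' hi'
        rcases eq_or_ne i' i with rfl | hne
        · have h2 : (V.T i' x).adjoint v = 0 := ext_inner_left ℂ fun u => by
            rw [ContinuousLinearMap.adjoint_inner_right, inner_zero_right, ← hV.op_single]
            exact mem_rangeL_orthogonal.1 h1 x u
          rw [h2]
          exact Submodule.zero_mem _
        · rw [← Submodule.starProjection_apply_eq_zero_iff] at h1 ⊢
          rw [hc.adjoint_apply hne, h1, map_zero]
      -- Iterating this, since the adjoints of the `V⁽ʲ⁾(x)` preserve `N'`.
      have hrange' : ∀ l : ℕ, ∀ v ∈ N', v ∈ V.rangeL (l • e j) := by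
        intro l
        induction l with
        | zero =>
          intro v _
          rw [zero_smul, hV.rangeL_zero]
          exact Submodule.mem_top
        | succ l ihl =>
          intro v hv
          refine hV.mem_rangeL_add hi (by rw [succ_nsmul, add_comm]) (hrange v hv) fun x => ?_
          rw [hV.op_single]
          exact ihl _ (hadj j x v hv)
      -- Hence `N'` is orthogonal to the generating set, and its complement is invariant.
      have hbot : N'ᗮ = ⊤ := by
        refine hmin _ (Submodule.isClosed_orthogonal _) (fun h hh u hu => ?_)
          fun i x w hw u hu => ?_
        · exact hpure j u (fun l => hrange' l u hu) h hh
        · rw [← ContinuousLinearMap.adjoint_inner_left]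
          exact hw _ (hadj i x u hu)
      intro v hv hv'
      have hvN' : v ∈ N' := (memN' v).2 ⟨hv, hv'⟩
      have hv2 : v ∈ N'ᗮ := hbot ▸ Submodule.mem_top
      exact inner_self_eq_zero.1 (hv2 v hvN')
  exact key Finset.univ v ((memN v).2 hv) fun i hi => absurd (Finset.mem_univ i) hi

end Wold

namespace IsMinimalIsometricDilation

variable {H K : Type*} [NormedAddCommGroup H] [InnerProductSpace ℂ H] [CompleteSpace H]
  [NormedAddCommGroup K] [InnerProductSpace ℂ K] [CompleteSpace K]
  {T : P.Tuple H} {V : P.Tuple K} {ι : H →ₗᵢ[ℂ] K}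

/-- The compression of `V⁽ⁱ⁾(x)` to `H` is `T⁽ⁱ⁾(x)`. -/
lemma inner_ι_T_ι (hD : T.IsMinimalIsometricDilation V ι) (hT : T.IsRepresentation) (i : Fin k)
    (x : P.fiber (e i)) (h g : H) :
    inner ℂ (ι g) (V.T i x (ι h)) = inner ℂ g (T.T i x h) := by
  have h0 : (0 : Fin k → ℕ) ⊓ e i = 0 := by
    funext j
    simp
  have h1 : ∀ a f, inner ℂ (ι (T.σ a f)) (V.T i x (ι h)) = inner ℂ (T.σ a f) (T.T i x h) :=
    fun a f => by
      have := hD.inner_dil h0 (of _ T.σ (P.unit a ⊗ₜ f)) (of _ T.σ (x ⊗ₜ h))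
      rwa [hD.dil_tmul, hD.dil_tmul, hD.isRepresentation.op_unit, hD.isRepresentation.op_single,
        hD.restrict, hT.tilde_zero_tmul, ← op_apply, hT.op_single] at this
  have h2 : innerSL ℂ (V.T i x (ι h)) ∘L ι.toContinuousLinearMap = innerSL ℂ (T.T i x h) :=
    hT.nondegenerate.ext fun a f => by
      rw [ContinuousLinearMap.comp_apply, innerSL_apply_apply, innerSL_apply_apply]
      rw [← inner_conj_symm, ← inner_conj_symm (T.T i x h), ← h1]
      rfl
  have h3 : inner ℂ (V.T i x (ι h)) (ι g) = inner ℂ (T.T i x h) g := DFunLike.congr_fun h2 g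
  rw [← inner_conj_symm, h3, inner_conj_symm]

/-- `V⁽ⁱ⁾(x)*` extends `T⁽ⁱ⁾(x)*`. -/
lemma adjoint_T_ι (hD : T.IsMinimalIsometricDilation V ι) (hT : T.IsRepresentation) (i : Fin k)
    (x : P.fiber (e i)) (h : H) : (V.T i x).adjoint (ι h) = ι ((T.T i x).adjoint h) := by
  obtain ⟨g, hg⟩ := hD.coinvariant i x h
  have hg' : (V.T i x).adjoint (ι h) = ι g := hg.symm
  rw [hg']
  congr 1
  refine ext_inner_right ℂ fun f => ?_
  rw [ContinuousLinearMap.adjoint_inner_left, ← hD.inner_ι_T_ι hT,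
    ← ContinuousLinearMap.adjoint_inner_left, hg', ι.inner_map_map]

lemma adjoint_ι_intertwines (hD : T.IsMinimalIsometricDilation V ι) (a : A) (v : K) :
    ι.toContinuousLinearMap.adjoint (V.σ a v) = T.σ a (ι.toContinuousLinearMap.adjoint v) :=
  adjoint_intertwines hD.ι_intertwines a v

/-- `P_H Ṽ(n) = T̃(n) (I ⊗ P_H)`. -/
lemma adjoint_ι_comp_tilde (hD : T.IsMinimalIsometricDilation V ι) (hT : T.IsRepresentation)
    (n : Fin k → ℕ) :
    ι.toContinuousLinearMap.adjoint ∘L V.tilde n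
      = T.tilde n ∘L idTensor _ V.σ T.σ ι.toContinuousLinearMap.adjoint := by
  induction n using multiindex_induction with
  | zero =>
    refine clm_ext fun x v => ?_
    obtain ⟨a, rfl⟩ := P.unit.surjective x
    rw [ContinuousLinearMap.comp_apply, ContinuousLinearMap.comp_apply,
      idTensor_tmul hD.adjoint_ι_intertwines, hT.tilde_zero_tmul,
      hD.isRepresentation.tilde_zero_tmul, hD.adjoint_ι_intertwines]
  | add i n ih =>
    refine P.clm_ext_create rfl fun x z => ?_
    have h1 : ∀ v, ι.toContinuousLinearMap.adjoint (V.T i x v)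
        = T.T i x (ι.toContinuousLinearMap.adjoint v) := fun v => by
      refine ext_inner_left ℂ fun h => ?_
      rw [ContinuousLinearMap.adjoint_inner_right, ← ContinuousLinearMap.adjoint_inner_left,
        ← ContinuousLinearMap.adjoint_inner_left, ContinuousLinearMap.adjoint_inner_right]
      exact congrArg (fun u => inner ℂ u v) (hD.adjoint_T_ι hT i x h)
    have h2 := DFunLike.congr_fun ih z
    rw [ContinuousLinearMap.comp_apply, ContinuousLinearMap.comp_apply] at h2
    rw [ContinuousLinearMap.comp_apply, ContinuousLinearMap.comp_apply,
      hD.isRepresentation.tilde_add_create, h1, h2, P.idTensor_create hD.adjoint_ι_intertwines,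
      hT.tilde_add_create]

/-- `‖Ṽ(n)* h‖ = ‖T̃(n)* h‖` for `h ∈ H`, because `Ṽ(n)* ι = (I ⊗ ι) T̃(n)*`. -/
lemma norm_adjoint_tilde_ι (hD : T.IsMinimalIsometricDilation V ι) (hT : T.IsRepresentation)
    (n : Fin k → ℕ) (h : H) : ‖(V.tilde n).adjoint (ι h)‖ = ‖(T.tilde n).adjoint h‖ := by
  have h1 := congrArg ContinuousLinearMap.adjoint (hD.adjoint_ι_comp_tilde hT n)
  rw [ContinuousLinearMap.adjoint_comp, ContinuousLinearMap.adjoint_comp,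
    ContinuousLinearMap.adjoint_adjoint, idTensor_adjoint hD.adjoint_ι_intertwines,
    ContinuousLinearMap.adjoint_adjoint] at h1
  have h2 := DFunLike.congr_fun h1 h
  rw [ContinuousLinearMap.comp_apply, ContinuousLinearMap.comp_apply] at h2
  have h3 : ι.toContinuousLinearMap.adjoint ∘L ι.toContinuousLinearMap = 1 := by
    ext u
    refine ext_inner_left ℂ fun v => ?_
    rw [ContinuousLinearMap.comp_apply, ContinuousLinearMap.adjoint_inner_right]
    exact ι.inner_map_map v u
  rw [← norm_idTensor hD.ι_intertwines h3 ((T.tilde n).adjoint h), ← h2]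
  rfl

/-- If `‖T̃(l e_j)* h‖ → 0` for all `h`, then `H` is orthogonal to `⋂ₗ Ṽ(l e_j) K`. -/
lemma inner_ι_eq_zero (hD : T.IsMinimalIsometricDilation V ι) (hT : T.IsRepresentation) (j : Fin k)
    {h : H} (hlim : Filter.Tendsto (fun l : ℕ => ‖(T.tilde (l • e j)).adjoint h‖)
      Filter.atTop (nhds 0)) {u : K} (hu : ∀ l : ℕ, u ∈ V.rangeL (l • e j)) :
    inner ℂ u (ι h) = 0 := by
  have hbound : ∀ l : ℕ, ‖inner ℂ u (ι h)‖ ≤ ‖u‖ * ‖(T.tilde (l • e j)).adjoint h‖ := fun l => by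
    have hcl : IsClosed {u : K | ‖inner ℂ u (ι h)‖ ≤ ‖u‖ * ‖(T.tilde (l • e j)).adjoint h‖} :=
      isClosed_le (by fun_prop) (by fun_prop)
    refine closure_minimal ?_ hcl (hu l)
    rintro _ ⟨z, rfl⟩
    rw [Set.mem_ofPred_eq, ContinuousLinearMap.coe_coe, ← ContinuousLinearMap.adjoint_inner_right,
      hD.isRepresentation.norm_tilde hD.isIsometric, ← hD.norm_adjoint_tilde_ι hT]
    exact norm_inner_le_norm _ _
  have h1 : Filter.Tendsto (fun l : ℕ => ‖u‖ * ‖(T.tilde (l • e j)).adjoint h‖)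
      Filter.atTop (nhds 0) := by
    simpa using hlim.const_mul ‖u‖
  exact norm_le_zero_iff.1 (ge_of_tendsto' h1 hbound)

end IsMinimalIsometricDilation

section pure

variable {K G : Type*} [NormedAddCommGroup K] [InnerProductSpace ℂ K] [CompleteSpace K]
  [NormedAddCommGroup G] [InnerProductSpace ℂ G] [CompleteSpace G]
  {V : P.Tuple K} {π : A →⋆ₙₐ[ℂ] (G →L[ℂ] G)}

/-- In an induced representation, the range of `Ṽ(l e_j)` has components only in degrees whose
`j`-th entry is at least `l`. -/
lemma tilde_apply_eq_zero (hV : V.IsRepresentation) (U : K ≃ₗᵢ[ℂ] P.Fock π)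
    (hU : ∀ i (x : P.fiber (e i)) v, P.fockCreate π i x (U v) = U (V.T i x v)) (j : Fin k) (l : ℕ)
    (z : InteriorTensor (P.fiber (l • e j)) V.σ) (n : Fin k → ℕ) (hn : n j < l) :
    U (V.tilde (l • e j) z) n = 0 := by
  have hcl : ∀ n, Continuous fun v : K => U v n := fun n => by
    have h1 : Continuous fun f : P.Fock π => f n :=
      (continuous_apply n).comp (lp.uniformContinuous_coe (p := 2)).continuous
    exact h1.comp U.continuous
  induction l generalizing n with
  | zero => omega
  | succ l ih =>
    have hle : e j + l • e j = (l + 1) • e j := by rw [succ_nsmul, add_comm]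
    let M : Submodule ℂ K :=
      { carrier := {v | U v n = 0}
        add_mem' := fun {a b} ha hb => by
          rw [Set.mem_ofPred_eq] at ha hb ⊢
          rw [map_add, lp.coeFn_add, Pi.add_apply, ha, hb, add_zero]
        zero_mem' := by
          rw [Set.mem_ofPred_eq, map_zero]
          rfl
        smul_mem' := fun c a ha => by
          rw [Set.mem_ofPred_eq] at ha ⊢
          rw [map_smul, lp.coeFn_smul, Pi.smul_apply, ha, smul_zero] }
    have hM : V.rangeL ((l + 1) • e j) ≤ M := by
      refine rangeL_le_of_create hle (isClosed_eq (hcl n) continuous_const) fun x z => ?_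
      change U _ n = 0
      rw [hV.tilde_add_create, ← hU]
      change shiftFun π j x (U (V.tilde (l • e j) z)) n = 0
      by_cases hmem : n ∈ Set.range fun n : Fin k → ℕ => e j + n
      · obtain ⟨n', rfl⟩ := hmem
        dsimp only
        rw [shiftFun_add, ih, map_zero]
        simp only [Pi.add_apply, Pi.single_eq_same] at hn
        omega
      · exact shiftFun_of_notMem _ _ _ _ _ _ hmem
    exact hM (V.tilde_mem_rangeL _ z)

/-- A representation isomorphic to an induced one is pure: `Ṽ(l e_j)* v → 0` for all `v`. -/
lemma tendsto_adjoint_tilde (hV : V.IsRepresentation) (hi : V.IsIsometric)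
    (hind : V.Isomorphic (P.induced π)) (j : Fin k) (v : K) :
    Filter.Tendsto (fun l : ℕ => ‖(V.tilde (l • e j)).adjoint v‖) Filter.atTop (nhds 0) := by
  obtain ⟨U, -, hU⟩ := hind
  have hcontr : ∀ n u, ‖(V.tilde n).adjoint u‖ ≤ ‖u‖ := fun n u => by
    have h1 : ‖V.tilde n‖ ≤ 1 := ContinuousLinearMap.opNorm_le_bound _ zero_le_one fun z => by
      rw [hV.norm_tilde hi, one_mul]
    refine (ContinuousLinearMap.le_opNorm _ _).trans ?_
    rw [LinearIsometryEquiv.norm_map]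
    exact mul_le_of_le_one_left (norm_nonneg _) h1
  rw [Metric.tendsto_atTop]
  intro ε hε
  have hs := lp.hasSum_single (p := 2) (by norm_num) (U v)
  obtain ⟨s, hs⟩ := (Metric.tendsto_nhds.1 hs ε hε).exists
  -- A finite partial sum `f` of `U v` is annihilated by `Ṽ(l e_j)*` for large `l`.
  set f : P.Fock π := ∑ n ∈ s, lp.single 2 n (U v n) with hf
  refine ⟨(s.sup fun n => n j) + 1, fun l hl => ?_⟩
  have h0 : (V.tilde (l • e j)).adjoint (U.symm f) = 0 := by
    refine ext_inner_left ℂ fun z => ?_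
    rw [ContinuousLinearMap.adjoint_inner_right, inner_zero_right, ← U.inner_map_map,
      U.apply_symm_apply, hf, inner_sum]
    refine Finset.sum_eq_zero fun n hn => ?_
    have hnl : n j < l := lt_of_le_of_lt (Finset.le_sup (f := fun n : Fin k → ℕ => n j) hn) hl
    rw [lp.inner_single_right, tilde_apply_eq_zero hV U hU j l z n hnl, inner_zero_left]
  have h1 : (V.tilde (l • e j)).adjoint v = (V.tilde (l • e j)).adjoint (v - U.symm f) := by
    rw [map_sub, h0, sub_zero]
  rw [dist_zero_right, norm_norm, h1]
  refine (hcontr _ _).trans_lt ?_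
  rw [← U.norm_map, map_sub, U.apply_symm_apply, ← dist_eq_norm, dist_comm]
  exact hs

end pure

end Tuple
end ProductSystem

end

theorem proposition2p4 {A : Type*} [NonUnitalCStarAlgebra A] [PartialOrder A] [StarOrderedRing A]
    {k : ℕ} (P : ProductSystem A k)
    {H : Type*} [NormedAddCommGroup H] [InnerProductSpace ℂ H] [CompleteSpace H]
    {K : Type*} [NormedAddCommGroup K] [InnerProductSpace ℂ K] [CompleteSpace K]
    (T : P.Tuple H) (hT : T.IsRepresentation) (hdc : T.IsDoublyCommuting)
    (V : P.Tuple K) (ι : H →ₗᵢ[ℂ] K) (hV : T.IsMinimalIsometricDilation V ι) :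
    V.IsIsomorphicToInduced ↔
      ∀ (h : H) (j : Fin k),
        Filter.Tendsto
          (fun l : ℕ => ‖ContinuousLinearMap.adjoint (T.tilde (l • ProductSystem.e j)) h‖)
          Filter.atTop (nhds 0) := by
  constructor
  · rintro ⟨G, _, _, _, π, -, hind⟩ h j
    simp only [← hV.norm_adjoint_tilde_ι hT]
    exact ProductSystem.Tuple.tendsto_adjoint_tilde hV.isRepresentation hV.isIsometric hind j (ι h)
  · intro hlim
    have hc : V.RangesCommute := fun i j hij y => hV.starProjection_comm hT hdc hij y
    refine hc.isIsomorphicToInduced hV.isRepresentation hV.isIsometric fun v hv =>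
      hc.eq_zero_of_orthogonal_wandering hV.isRepresentation hV.isIsometric (Set.range ι)
        (fun W hW hS hinv => hV.minimal W hW (fun h => hS ⟨h, rfl⟩) hinv) ?_ hv
    rintro j u hu _ ⟨h, rfl⟩
    exact hV.inner_ι_eq_zero hT j (hlim h j) hu
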